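/- **LQCI instances.** An LQCI instance $\mathcal C$ over a finite alphabet $\Sigma$ consists of length bounds $m\le n$ in $\mathbb N$; a hard specification with language $\mathcal H\subseteq\Sigma^*$; a cost function $\mathcal K:\Sigma^*\to\mathbb Q$; a label function $L:\Sigma^*\to\Omega=\{\ell_1,\dots,\ell_{|\Omega|}\}$; a rational $c\ge 0$; rationals $0\le\lambda\le\rho\le1$; and rationals $0\le\hat\alpha_i\le\hat\beta_i\le 1$ for each label $\ell_i$. Let $$I=\{w\in\mathcal H: m\le|w|\le n\},\quad \Theta=\mathcal K(I),\quad I_i=\{w\in I:L(w)=\ell_i\},\quad I_{i,\theta}=\{w\in I_i:\mathcal K(w)=\theta\}\ (\theta\in\Theta).$$ A distribution $D$ on $\Sigma^*$ is *improvising* for $\mathcal C$ if $D(I)=1$; $\mathbb E_{w\sim D}[\mathcal K(w)]\le c$; $\lambda\le D(I_i)\le\rho$ for all $i$; and $\hat\alpha_i\le D(\{y\})/D(I_i)\le\hat\beta_i$ for all $i$ with $D(I_i)>0$ and all $y\in I_i$. The instance is *feasible* if an improvising distribution exists. An *improviser* for $\mathcal C$ is a probabilistic program (using fair coin tosses) without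 input, of finite expected running time, whose output distribution is improvising for $\mathcal C$. An instance is presented to algorithms by a description, in any formalism, of $\Sigma,m,n,\mathcal H,\mathcal K,L$, together with $c,\lambda,\rho$ and the list of the $(\hat\alpha_i,\hat\beta_i)$ written in binary; its *size* is the length of this presentation. Numbers in outputs are also written in binary. **Theorem.** Let $\mathcal P$ be a class of LQCI instances for which the following operations can be performed, uniformly over $\mathcal C\in\mathcal P$, in time polynomial in the size of $\mathcal C$: 1. given $\mathcal C$, compute the list of possible costs $\Theta$; 2. given $\mathcal C$, $i\in\{1,\dots,|\Omega|\}$ and $\theta\in\Theta$, compute $|I_{i,\theta}|$; 3. given $\mathcal C$, $i\in\{1,\dots,|\Omega|\}$ and $\theta\in\Theta$ with $I_{i,\theta}\ne\emptyset$, sample exactly uniformly from $I_{i,\theta}$ (with fair coin tosses, in polynomial expected time). Then $\mathcal P$ has a polynomial-time improvisation scheme: there are an algorithm $S$ and polynomials $p,q$ such that for every $\mathcal C\in\mathcal P$, $S$ runs on $\mathcal C$ in time at most $p(\text{size of }\mathcal C)$; if $\mathcal C$ is infeasible, $S$ reports this; and if $\mathcal C$ is feasible, $S$ outputs (the text of)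 an improviser for $\mathcal C$ whose expected running time is at most $q(\text{size of }\mathcal C)$. -/

import Mathlib

open scoped ENNReal

namespace LQCI

/-! ## Probabilistic programs with a running time

Programs manipulate binary trees (as in the classical WHILE language over `nil`/`cons`), with one
extra instruction that tosses a fair coin. Every instruction is charged the size of the data it
reads, so the running time agrees, up to a polynomial, with that of a probabilistic
Turing machine; in particular, the size of an output is at most three times the running time. -/

/-- The data of the programming language: binary trees. -/
inductive Value : Type
  | nil : Value
  | cons : Value → Value → Value

namespace Value

/-- Number of nodes and leaves. -/
def size : Value → ℕ
  | nil => 1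
  | cons a b => a.size + b.size + 1

def fst : Value → Value
  | nil => nil
  | cons a _ => a

def snd : Value → Value
  | nil => nil
  | cons _ b => b

end Value

/-! ### Encodings: numbers are written in binary -/

def encBool : Bool → Value
  | false => .nil
  | true => .cons .nil .nil

def encList : List Value → Value
  | [] => .nil
  | a :: l => .cons a (encList l)

/-- A natural number, as the list of its binary digits (least significant digit first). -/
def encNat (k : ℕ) : Value := encList (k.bits.map encBool)

/-- A rational number, as sign, absolute value of the numerator, denominator (lowest terms). -/
def encRat (q : ℚ) : Value :=
  .cons (encBool (decide (q < 0))) (.cons (encNat q.num.natAbs) (encNat q.den))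

/-- A word over the alphabet `Fin a`, as the list of (the binary encodings of) its letters. -/
def encWord {a : ℕ} (w : List (Fin a)) : Value := encList (w.map fun x => encNat x.val)

/-- Programs. A program maps a value (its input) to a value (its output). -/
inductive Prog : Type
  /-- output the fixed value `d` -/
  | const (d : Value) : Prog
  /-- output the input -/
  | id : Prog
  /-- output the left subtree of the input -/
  | fst : Prog
  /-- output the right subtree of the input -/
  | snd : Prog
  /-- toss a fair coin and output the result -/
  | flip : Prog
  /-- run both programs on the input and output the pair of their results -/
  | pair (p q : Prog) : Prog
  /-- run `p`, then run `q` on the output of `p` -/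
  | seq (p q : Prog) : Prog
  /-- run `p` if the value of the test `c` on the input is not `nil`, and `q` otherwise -/
  | ite (c p q : Prog) : Prog
  /-- as long as the value of the test `c` on the current value is not `nil`, replace the current
  value by the output of `p` on it -/
  | while (c p : Prog) : Prog

/-- The text of a program, as a value. -/
def Prog.code : Prog → Value
  | .const d => .cons (encNat 0) d
  | .id => .cons (encNat 1) .nil
  | .fst => .cons (encNat 2) .nil
  | .snd => .cons (encNat 3) .nil
  | .flip => .cons (encNat 4) .nil
  | .pair p q => .cons (encNat 5) (.cons p.code q.code)
  | .seq p q => .cons (encNat 6) (.cons p.code q.code)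
  | .ite c p q => .cons (encNat 7) (.cons c.code (.cons p.code q.code))
  | .while c p => .cons (encNat 8) (.cons c.code p.code)

/-- `Eval p x s y t`: on input `x`, if its successive coin tosses have the results `s`, the program
`p` halts after exactly these tosses, with output `y`, in time `t`. -/
inductive Eval : Prog → Value → List Bool → Value → ℕ → Prop
  | const (d x : Value) : Eval (.const d) x [] d (x.size + d.size)
  | id (x : Value) : Eval .id x [] x x.size
  | fst (x : Value) : Eval .fst x [] x.fst x.size
  | snd (x : Value) : Eval .snd x [] x.snd x.size
  | flip (x : Value) (b : Bool) : Eval .flip x [b] (encBool b) x.size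
  | pair {p q : Prog} {x y z : Value} {s₁ s₂ : List Bool} {t₁ t₂ : ℕ} :
      Eval p x s₁ y t₁ → Eval q x s₂ z t₂ →
      Eval (.pair p q) x (s₁ ++ s₂) (.cons y z) (x.size + t₁ + t₂)
  | seq {p q : Prog} {x y z : Value} {s₁ s₂ : List Bool} {t₁ t₂ : ℕ} :
      Eval p x s₁ y t₁ → Eval q y s₂ z t₂ →
      Eval (.seq p q) x (s₁ ++ s₂) z (x.size + t₁ + t₂)
  | ite_true {c p q : Prog} {x a b y : Value} {s₁ s₂ : List Bool} {t₁ t₂ : ℕ} :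
      Eval c x s₁ (.cons a b) t₁ → Eval p x s₂ y t₂ →
      Eval (.ite c p q) x (s₁ ++ s₂) y (x.size + t₁ + t₂)
  | ite_false {c p q : Prog} {x y : Value} {s₁ s₂ : List Bool} {t₁ t₂ : ℕ} :
      Eval c x s₁ .nil t₁ → Eval q x s₂ y t₂ →
      Eval (.ite c p q) x (s₁ ++ s₂) y (x.size + t₁ + t₂)
  | while_stop {c p : Prog} {x : Value} {s : List Bool} {t : ℕ} :
      Eval c x s .nil t →
      Eval (.while c p) x s x (x.size + t)
  | while_step {c p : Prog} {x a b y z : Value} {s₁ s₂ s₃ : List Bool} {t₁ t₂ t₃ : ℕ} :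
      Eval c x s₁ (.cons a b) t₁ → Eval p x s₂ y t₂ → Eval (.while c p) y s₃ z t₃ →
      Eval (.while c p) x (s₁ ++ (s₂ ++ s₃)) z (x.size + t₁ + t₂ + t₃)

namespace Prog

/-- On input `x`, the program outputs `y` within time `N`, without tossing coins. -/
def ComputesInTime (p : Prog) (x y : Value) (N : ℕ) : Prop :=
  ∃ t ≤ N, Eval p x [] y t

/-- The halting runs of a program on an input: the coin tosses, the output and the time. -/
def Run (p : Prog) (x : Value) : Type :=
  {r : List Bool × Value × ℕ // Eval p x r.1 r.2.1 r.2.2}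

namespace Run

variable {p : Prog} {x : Value}

def output (r : Run p x) : Value := r.1.2.1

def time (r : Run p x) : ℕ := r.1.2.2

/-- The probability of a halting run with `k` coin tosses is `2⁻ᵏ`. -/
noncomputable def prob (r : Run p x) : ℝ≥0∞ := (2⁻¹ : ℝ≥0∞) ^ r.1.1.length

end Run

open Classical in
/-- The probability that `p`, on input `x`, halts with output `y`. -/
noncomputable def outProb (p : Prog) (x y : Value) : ℝ≥0∞ :=
  ∑' r : Run p x, if r.output = y then r.prob else 0

/-- The probability that `p` halts on input `x`. -/
noncomputable def haltProb (p : Prog) (x : Value) : ℝ≥0∞ :=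
  ∑' r : Run p x, r.prob

/-- The expected running time of `p` on input `x`; it is infinite if `p` fails to halt with
positive probability. -/
noncomputable def expectedTime (p : Prog) (x : Value) : ℝ≥0∞ :=
  (∑' r : Run p x, r.prob * (r.time : ℝ≥0∞)) + (1 - p.haltProb x) * ⊤

/-- The output of `p` on input `x` is distributed (as the encoding of a word) according to `D`. -/
def Samples {a : ℕ} (p : Prog) (x : Value) (D : PMF (List (Fin a))) : Prop :=
  ∀ w : List (Fin a), p.outProb x (encWord w) = D w

end Prog

/-! ## LQCI instances -/

/-- A labelled quantitative control improvisation instance. The alphabet is `Fin a` and the set of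
labels is `Fin numLabels`; the hard specification is given by its language. -/
structure Instance where
  /-- size of the alphabet -/
  a : ℕ
  /-- number of labels -/
  numLabels : ℕ
  /-- bounds on the length of words -/
  m : ℕ
  n : ℕ
  m_le_n : m ≤ n
  /-- language of the hard specification -/
  H : Language (Fin a)
  /-- cost function -/
  K : List (Fin a) → ℚ
  /-- label function -/
  L : List (Fin a) → Fin numLabels
  /-- bound on the expected cost -/
  c : ℚ
  c_nonneg : 0 ≤ c
  /-- bounds on the probabilities of the labels -/
  lam : ℚ
  rho : ℚ
  lam_nonneg : 0 ≤ lam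
  lam_le_rho : lam ≤ rho
  rho_le_one : rho ≤ 1
  /-- bounds on the conditional probabilities of words in each label class -/
  alpha : Fin numLabels → ℚ
  beta : Fin numLabels → ℚ
  alpha_nonneg : ∀ i, 0 ≤ alpha i
  alpha_le_beta : ∀ i, alpha i ≤ beta i
  beta_le_one : ∀ i, beta i ≤ 1

/-- The probability of the event `S` under the distribution `D`. -/
noncomputable def prob {α : Type*} (D : PMF α) (S : Set α) : ℝ := (D.toOuterMeasure S).toReal

namespace Instance

variable (C : Instance)

abbrev Word : Type := List (Fin C.a)

/-- The set `I` of improvisations. -/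
def improvisations : Set C.Word := {w | C.m ≤ w.length ∧ w.length ≤ C.n ∧ w ∈ C.H}

theorem improvisations_finite : C.improvisations.Finite :=
  (List.finite_length_le (Fin C.a) C.n).subset fun _ h => h.2.1

/-- The set `Θ` of possible costs. -/
def possibleCosts : Set ℚ := C.K '' C.improvisations

/-- The label class `I_i`. -/
def labelClass (i : Fin C.numLabels) : Set C.Word := {w ∈ C.improvisations | C.L w = i}

/-- The cost class of the label `i` and the cost `θ`. -/
def costClass (i : Fin C.numLabels) (θ : ℚ) : Set C.Word :=
  {w ∈ C.improvisations | C.L w = i ∧ C.K w = θ}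

/-- Improvising distributions. The sum in `cost` has finitely many nonzero terms, because of
`hard`. Conditional probabilities given `I_i` are constrained when they are defined, that is, when
`I_i` has positive probability. -/
structure IsImprovisingDistribution (D : PMF C.Word) : Prop where
  hard : prob D C.improvisations = 1
  cost : ∑' w, prob D {w} * (C.K w : ℝ) ≤ (C.c : ℝ)
  labels : ∀ i, (C.lam : ℝ) ≤ prob D (C.labelClass i) ∧ prob D (C.labelClass i) ≤ (C.rho : ℝ)
  words : ∀ i, prob D (C.labelClass i) ≠ 0 → ∀ y ∈ C.labelClass i,
    (C.alpha i : ℝ) ≤ prob D ({y} ∩ C.labelClass i) / prob D (C.labelClass i) ∧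
      prob D ({y} ∩ C.labelClass i) / prob D (C.labelClass i) ≤ (C.beta i : ℝ)

def Feasible : Prop := ∃ D : PMF C.Word, C.IsImprovisingDistribution D

/-- An improviser: a probabilistic program without input (it is run on `nil`), of finite expected
running time, whose output has an improvising distribution. -/
def IsImproviser (G : Prog) : Prop :=
  G.expectedTime .nil < ⊤ ∧
    ∃ D : PMF C.Word, C.IsImprovisingDistribution D ∧ G.Samples .nil D

end Instance

/-- An LQCI instance, together with a description of its specifications: `desc` presents the
alphabet, the length bounds, the hard specification, the cost function and the label function, in
any formalism whatsoever. -/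
structure EncodedInstance extends Instance where
  desc : Value

namespace EncodedInstance

variable (C : EncodedInstance)

/-- The encoding of the instance: the description of the specifications, followed by the numerical
parameters in binary (the last component has one entry for each label). -/
def code : Value :=
  .cons C.desc (.cons (encRat C.c) (.cons (encRat C.lam) (.cons (encRat C.rho)
    (encList (List.ofFn fun i => .cons (encRat (C.alpha i)) (encRat (C.beta i)))))))

/-- The size of the instance. -/
def size : ℕ := C.code.size

end EncodedInstance

/-! ## The three operations -/

/-- The list of the possible costs can be computed in polynomial time. -/
def CanListCosts (𝒞 : Set EncodedInstance) : Prop :=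
  ∃ (p : Prog) (P : Polynomial ℕ), ∀ C ∈ 𝒞, ∃ θs : List ℚ,
    θs.Nodup ∧ (∀ θ, θ ∈ θs ↔ θ ∈ C.possibleCosts) ∧
    p.ComputesInTime C.code (encList (θs.map encRat)) (P.eval C.size)

/-- The sizes of the cost classes can be computed in polynomial time. -/
def CanCountCostClasses (𝒞 : Set EncodedInstance) : Prop :=
  ∃ (p : Prog) (P : Polynomial ℕ), ∀ C ∈ 𝒞, ∀ i, ∀ θ ∈ C.possibleCosts,
    p.ComputesInTime (.cons C.code (.cons (encNat i.val) (encRat θ)))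
      (encNat (C.costClass i θ).ncard) (P.eval C.size)

open Classical in
/-- One can sample uniformly from the (nonempty) cost classes in polynomial expected time. -/
def CanSampleCostClasses (𝒞 : Set EncodedInstance) : Prop :=
  ∃ (p : Prog) (P : Polynomial ℕ), ∀ C ∈ 𝒞, ∀ i, ∀ θ ∈ C.possibleCosts,
    (C.costClass i θ).Nonempty →
    p.expectedTime (.cons C.code (.cons (encNat i.val) (encRat θ))) ≤ (P.eval C.size : ℕ) ∧
    ∃ D : PMF C.Word,
      (∀ w, D w = if w ∈ C.costClass i θ then ((C.costClass i θ).ncard : ℝ≥0∞)⁻¹ else 0) ∧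
      p.Samples (.cons C.code (.cons (encNat i.val) (encRat θ))) D

/-! ## Improvisation schemes -/

/-- The answer of an improvisation scheme: `none` for infeasible, or the text of a program. -/
def encAnswer : Option Prog → Value
  | none => .nil
  | some G => .cons .nil G.code

/-- A polynomial-time improvisation scheme: a polynomial-time algorithm that decides the
feasibility of each instance of the class, and, if the instance is feasible, outputs an improviser
whose expected running time is polynomial in the size of the instance. -/
def HasPolyTimeImprovisationScheme (𝒞 : Set EncodedInstance) : Prop :=
  ∃ (S : Prog) (P Q : Polynomial ℕ), ∀ C ∈ 𝒞,
    (¬ C.Feasible → S.ComputesInTime C.code (encAnswer none) (P.eval C.size)) ∧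
    (C.Feasible → ∃ G : Prog,
      S.ComputesInTime C.code (encAnswer (some G)) (P.eval C.size) ∧
      C.IsImproviser G ∧ G.expectedTime .nil ≤ (Q.eval C.size : ℕ))

end LQCI

/-!
The class admits an improvisation scheme because the optimal distribution of an instance can be
written down explicitly.

*The optimal distribution.* Whether a distribution is improvising depends only on the probabilities
of the label classes and, given a label, on the probabilities of the costs, as the words of a cost
class may be taken to be equally likely. Given a label `i`, a cost class with `k` words needs a
conditional probability between `k * α i` and `k * β i`, and the sum over the costs has to be `1`;
the least expected cost is reached by the greedy rule that gives every cost its lower bound and then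
fills up the costs in increasing order. The labels pose a problem of the same kind: the label
classes need probabilities between `λ` and `ρ` (or `0`, if the conditional problem of the label has
no solution), and again the greedy rule, in the order of the least conditional costs, is optimal.
So an instance is feasible if and only if these two greedy solutions exist and their cost is at most
`c`. The amount that the greedy rule gives to an item is a closed expression in the sums of the
bounds of the items that come before (`greedy`), so that nothing has to be sorted. Its optimality
(`greedy_optimal`) is an exchange argument: all items before some threshold are full, and all items
beyond it are at their lower bounds. `Scaling.accepts_of_feasible` and
`Scaling.exists_improvisingDistribution` are the two directions of the criterion for feasibility.

*The algorithm.* All numbers are multiplied by a common denominator, and the costs are shifted, so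
that the computation consists of sums, products, truncated differences, quotients and comparisons of
natural numbers. A calculus of functions that are computable in polynomial time, between types with
an encoding (`PolyTime`), reduces this to loops over lists with small intermediate results
(`PolyTime.foldl_mem`), from which binary arithmetic is built. Promises, such as the membership of
an instance in the class, are expressed by subtypes of the domain.

*The improviser.* The scheme outputs a fixed program applied to a constant, the list of the cost
classes with their weights. This program draws a random number below a power of two until it is
smaller than the sum of the weights, which takes at most two rounds on average, selects the cost
class at that position, and samples from it (`exists_sampler`). Its analysis rests on the
expectation of a function of the output and the running time over the halting runs
(`Prog.expect`), which obeys the expected laws because the coin tosses of the halting runs form a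
prefix-free code (`Eval.unique`).
-/

namespace LQCI

/-! ### Polynomial-time functions between encoded types -/

/-- Types whose elements are presented to programs as values. The encoding need not be injective. -/
class Enc (α : Type*) where
  /-- The value that presents an element. -/
  enc : α → Value

open Enc (enc)

namespace Enc

instance : Enc Value := ⟨fun v => v⟩

instance : Enc Bool := ⟨encBool⟩

instance : Enc ℕ := ⟨encNat⟩

instance : Enc ℚ := ⟨encRat⟩

instance {α β : Type*} [Enc α] [Enc β] : Enc (α × β) := ⟨fun x => .cons (enc x.1) (enc x.2)⟩

instance {α : Type*} [Enc α] : Enc (List α) := ⟨fun l => encList (l.map enc)⟩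

instance {α : Type*} [Enc α] : Enc (Option α) :=
  ⟨fun x => x.elim .nil fun a => .cons .nil (enc a)⟩

/-- An element of a subtype is presented like the underlying element: a predicate is a promise
on the input of a program. -/
instance {α : Type*} [Enc α] {P : α → Prop} : Enc {x // P x} := ⟨fun x => enc x.1⟩

end Enc

section PolyTime

variable {Γ Δ α β γ σ : Type*} [Enc Γ] [Enc Δ] [Enc α] [Enc β] [Enc γ] [Enc σ]

/-- The size of the value that presents `x`. -/
def sz (x : Γ) : ℕ := (enc x).size

theorem Value.one_le_size (v : Value) : 1 ≤ v.size := by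
  cases v <;> simp [Value.size]

theorem one_le_sz (x : Γ) : 1 ≤ sz x := Value.one_le_size _

theorem sz_pair (x : Γ) (y : Δ) : sz (x, y) = sz x + sz y + 1 := rfl

theorem sz_nil : sz ([] : List α) = 1 := rfl

theorem sz_cons (a : α) (l : List α) : sz (a :: l) = sz a + sz l + 1 := rfl

theorem sz_subtype {P : α → Prop} (x : {x // P x}) : sz x = sz x.1 := rfl

theorem sz_append (l₁ l₂ : List α) : sz (l₁ ++ l₂) + 1 = sz l₁ + sz l₂ := by
  induction l₁ with
  | nil => simp [sz_nil]; omega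
  | cons a l ih => simp only [List.cons_append, sz_cons]; omega

theorem length_lt_sz (l : List α) : l.length < sz l := by
  induction l with
  | nil => simp [sz_nil]
  | cons a l ih => simp only [List.length_cons, sz_cons]; have := one_le_sz a; omega

theorem sz_lt_of_mem {a : α} {l : List α} (h : a ∈ l) : sz a < sz l := by
  induction l with
  | nil => simp at h
  | cons b l ih =>
    simp only [sz_cons]
    rcases List.mem_cons.1 h with rfl | h
    · have := one_le_sz l; omega
    · have := ih h; omega

theorem sz_reverse (l : List α) : sz l.reverse = sz l := by
  induction l with
  | nil => rfl
  | cons a l ih =>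
    have := sz_append l.reverse [a]
    simp only [List.reverse_cons, sz_cons, sz_nil] at *
    omega

/-- A program can only build large outputs slowly. -/
theorem Eval.size_le {p : Prog} {x y : Value} {s : List Bool} {t : ℕ} (h : Eval p x s y t) :
    y.size ≤ 3 * t := by
  induction h with
  | fst x => cases x <;> simp [Value.fst, Value.size]; omega
  | snd x => cases x <;> simp [Value.snd, Value.size]; omega
  | flip x b =>
    have := x.one_le_size
    cases b <;> simp [encBool, Value.size] <;> omega
  | pair h₁ h₂ ih₁ ih₂ =>
    rename_i x _ _ _ _ _ _
    have := x.one_le_size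
    simp [Value.size]; omega
  | _ => (try have := Value.one_le_size ‹_›); omega

/-! #### Polynomial bounds -/

theorem eval_mono_nat (P : Polynomial ℕ) {a b : ℕ} (h : a ≤ b) :
    P.eval a ≤ P.eval b := by
  simp only [Polynomial.eval_eq_sum, Polynomial.sum]
  gcongr

/-- A function that is bounded by a polynomial in the size of its argument. -/
def PolyBdd (f : Γ → ℕ) : Prop := ∃ P : Polynomial ℕ, ∀ x, f x ≤ P.eval (sz x)

namespace PolyBdd

theorem mono {f g : Γ → ℕ} (hg : PolyBdd g) (h : ∀ x, f x ≤ g x) : PolyBdd f :=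
  let ⟨P, hP⟩ := hg
  ⟨P, fun x => (h x).trans (hP x)⟩

theorem const (k : ℕ) : PolyBdd fun _ : Γ => k := ⟨Polynomial.C k, fun x => by simp⟩

protected theorem sz : PolyBdd fun x : Γ => sz x := ⟨Polynomial.X, fun x => by simp⟩

theorem add {f g : Γ → ℕ} : PolyBdd f → PolyBdd g → PolyBdd fun x => f x + g x
  | ⟨P, hP⟩, ⟨Q, hQ⟩ => ⟨P + Q, fun x => by
    rw [Polynomial.eval_add]; exact Nat.add_le_add (hP x) (hQ x)⟩

theorem mul {f g : Γ → ℕ} : PolyBdd f → PolyBdd g → PolyBdd fun x => f x * g x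
  | ⟨P, hP⟩, ⟨Q, hQ⟩ => ⟨P * Q, fun x => by
    rw [Polynomial.eval_mul]; exact Nat.mul_le_mul (hP x) (hQ x)⟩

theorem const_mul (k : ℕ) {f : Γ → ℕ} (hf : PolyBdd f) : PolyBdd fun x => k * f x :=
  (const k).mul hf

theorem comp {f : Γ → Δ} {g : Δ → ℕ} (hg : PolyBdd g) (hf : PolyBdd fun x => sz (f x)) :
    PolyBdd fun x => g (f x) := by
  obtain ⟨P, hP⟩ := hf
  obtain ⟨Q, hQ⟩ := hg
  exact ⟨Q.comp P, fun x => by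
    rw [Polynomial.eval_comp]; exact (hQ _).trans (eval_mono_nat Q (hP x))⟩

theorem eval {f : Γ → ℕ} (hf : PolyBdd f) (P : Polynomial ℕ) : PolyBdd fun x => P.eval (f x) := by
  obtain ⟨Q, hQ⟩ := hf
  exact ⟨P.comp Q, fun x => by rw [Polynomial.eval_comp]; exact eval_mono_nat P (hQ x)⟩

end PolyBdd

/-- A function that some program computes, without tossing coins, in time polynomial in the size
of the encoding of its argument. -/
def PolyTime (f : Γ → β) : Prop :=
  ∃ (p : Prog) (t : Γ → ℕ), PolyBdd t ∧ ∀ x, Eval p (enc x) [] (enc (f x)) (t x)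

namespace PolyTime

theorem of_le {f : Γ → β} (p : Prog) {b : Γ → ℕ} (hb : PolyBdd b)
    (h : ∀ x, p.ComputesInTime (enc x) (enc (f x)) (b x)) : PolyTime f := by
  choose t ht he using h
  exact ⟨p, t, hb.mono ht, he⟩

theorem polyBdd_sz {f : Γ → β} : PolyTime f → PolyBdd fun x => sz (f x)
  | ⟨_, _, ht, h⟩ => (ht.const_mul 3).mono fun x => (h x).size_le

theorem congr_enc {f : Γ → β} {g : Γ → γ} (hf : PolyTime f) (h : ∀ x, enc (f x) = enc (g x)) :
    PolyTime g :=
  let ⟨p, t, ht, hp⟩ := hf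
  ⟨p, t, ht, fun x => h x ▸ hp x⟩

protected theorem congr {f g : Γ → β} (hf : PolyTime f) (h : ∀ x, f x = g x) : PolyTime g :=
  hf.congr_enc fun x => by rw [h x]

theorem const (b : β) : PolyTime fun _ : Γ => b :=
  ⟨.const (enc b), _, PolyBdd.sz.add (.const _), fun x => .const (enc b) (enc x)⟩

protected theorem id : PolyTime fun x : Γ => x :=
  ⟨.id, _, .sz, fun x => .id (enc x)⟩

/-- The identity program computes every function that does not change the encoding. -/
theorem of_enc_eq {f : Γ → β} (h : ∀ x, enc x = enc (f x)) : PolyTime f :=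
  PolyTime.id.congr_enc h

theorem comp {g : Δ → β} {f : Γ → Δ} :
    PolyTime g → PolyTime f → PolyTime fun x => g (f x)
  | ⟨q, _, hu, hq⟩, hf@⟨p, _, ht, hp⟩ =>
    ⟨.seq p q, _, (PolyBdd.sz.add ht).add (hu.comp hf.polyBdd_sz), fun x => .seq (hp x) (hq (f x))⟩

theorem pair {f : Γ → α} {g : Γ → β} :
    PolyTime f → PolyTime g → PolyTime fun x => (f x, g x)
  | ⟨p, _, ht, hp⟩, ⟨q, _, hu, hq⟩ =>
    ⟨.pair p q, _, (PolyBdd.sz.add ht).add hu, fun x => .pair (hp x) (hq x)⟩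

theorem fst {f : Γ → α × β} (hf : PolyTime f) : PolyTime fun x => (f x).1 :=
  comp (g := Prod.fst) ⟨.fst, _, .sz, fun x => .fst (enc x)⟩ hf

theorem snd {f : Γ → α × β} (hf : PolyTime f) : PolyTime fun x => (f x).2 :=
  comp (g := Prod.snd) ⟨.snd, _, .sz, fun x => .snd (enc x)⟩ hf

/-- Test whether the encoding of `c x` is `nil`. -/
theorem ite_nil {c : Γ → γ} {f g : Γ → β} {P : Γ → Prop} [DecidablePred P] (hc : PolyTime c)
    (hf : PolyTime f) (hg : PolyTime g) (hP : ∀ x, P x ↔ enc (c x) ≠ .nil) :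
    PolyTime fun x => if P x then f x else g x := by
  obtain ⟨r, v, hv, hr⟩ := hc
  obtain ⟨p, t, ht, hp⟩ := hf
  obtain ⟨q, u, hu, hq⟩ := hg
  refine of_le (.ite r p q) ((((PolyBdd.sz (Γ := Γ)).add hv).add ht).add hu) fun x => ?_
  specialize hr x
  specialize hP x
  cases hcx : enc (c x) with
  | nil =>
    rw [hcx] at hr
    rw [if_neg (by simp [hP, hcx])]
    exact ⟨_, by simp only [sz]; omega, .ite_false hr (hq x)⟩
  | cons a b =>
    rw [hcx] at hr
    rw [if_pos (by simp [hP, hcx])]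
    exact ⟨_, by simp only [sz]; omega, .ite_true hr (hp x)⟩

/-- A predicate that can be decided in polynomial time. -/
def _root_.LQCI.PolyDec (P : Γ → Prop) : Prop := ∃ b : Γ → Bool, PolyTime b ∧ ∀ x, P x ↔ b x = true

protected theorem ite {P : Γ → Prop} [DecidablePred P] {f g : Γ → β} (hc : PolyDec P)
    (hf : PolyTime f) (hg : PolyTime g) : PolyTime fun x => if P x then f x else g x := by
  obtain ⟨b, hb, hP⟩ := hc
  refine ite_nil hb hf hg fun x => ?_
  rw [hP]
  cases h : b x <;> simp [enc, encBool]

/-- Forget a promise. -/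
theorem val {P : α → Prop} {f : Γ → {x // P x}} (hf : PolyTime f) : PolyTime fun x => (f x).1 :=
  hf.congr_enc fun _ => rfl

/-- Record a promise. -/
theorem subtype_mk {P : α → Prop} {f : Γ → α} (hf : PolyTime f) (h : ∀ x, P (f x)) :
    PolyTime fun x => (⟨f x, h x⟩ : {x // P x}) :=
  hf.congr_enc fun _ => rfl

theorem cons {f : Γ → α} {g : Γ → List α} (hf : PolyTime f) (hg : PolyTime g) :
    PolyTime fun x => f x :: g x :=
  (hf.pair hg).congr_enc fun _ => rfl

theorem head {f : Γ → List α} (hf : PolyTime f) (h : ∀ x, f x ≠ []) :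
    PolyTime fun x => (f x).head (h x) := by
  have := comp (g := fun l : {l : List α // l ≠ []} => l.1.head l.2)
    ⟨.fst, _, .sz, fun l => ?_⟩ (hf.subtype_mk h)
  · exact this
  · obtain ⟨_ | ⟨a, l⟩, hl⟩ := l
    · exact absurd rfl hl
    · exact .fst (enc (a :: l))

theorem tail {f : Γ → List α} (hf : PolyTime f) : PolyTime fun x => (f x).tail := by
  refine comp (g := fun l : List α => l.tail) ⟨.snd, _, .sz, fun l => ?_⟩ hf
  cases l <;> exact .snd _

/-! #### Loops over lists -/

/-- A loop over a list is a polynomial-time function if its body is one and the intermediate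
results are small. The body may rely on the promise that it is applied to members of the list. -/
theorem foldl_mem {l : Γ → List α} {init : Γ → σ} {step : Γ → σ → α → σ} {b : Γ → ℕ}
    (hl : PolyTime l) (hi : PolyTime init)
    (hs : PolyTime fun y : {y : Γ × σ × α // y.2.2 ∈ l y.1} => step y.1.1 y.1.2.1 y.1.2.2)
    (hb : PolyBdd b) (h : ∀ x l₁, l₁ <+: l x → sz (l₁.foldl (step x) (init x)) ≤ b x) :
    PolyTime fun x => (l x).foldl (step x) (init x) := by
  -- The state of the loop: the context, the current result and the rest of the list.
  let State := {z : Γ × σ × List α // z.2.2 ≠ [] ∧ z.2.2 ⊆ l z.1}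
  have hz : PolyTime fun z : State => z.1 := PolyTime.id.val
  have hbody : PolyTime fun z : State =>
      (z.1.1, step z.1.1 z.1.2.1 (z.1.2.2.head z.2.1), z.1.2.2.tail) :=
    hz.fst.pair ((hs.comp ((hz.fst.pair (hz.snd.fst.pair
      (hz.snd.snd.head fun z => z.2.1))).subtype_mk fun z =>
        z.2.2 (List.head_mem z.2.1))).pair hz.snd.snd.tail)
  obtain ⟨p, t, ⟨P, hP⟩, hp⟩ := hbody
  obtain ⟨pl, tl, htl, hpl⟩ := id hl
  obtain ⟨pi, ti, hti, hpi⟩ := id hi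
  let S : Γ → ℕ := fun x => sz x + b x + sz (l x) + 2
  have hS : PolyBdd S := ((PolyBdd.sz.add hb).add hl.polyBdd_sz).add (.const 2)
  let K : Γ → ℕ := fun x => 4 * S x + P.eval (S x)
  have hK : PolyBdd K := (hS.const_mul 4).add (hS.eval P)
  have loop : ∀ (x : Γ) (l₂ l₁ : List α), l₁ ++ l₂ = l x →
      ∃ u ≤ (l₂.length + 1) * K x, Eval (.while (.seq .snd .snd) p)
        (enc (x, l₁.foldl (step x) (init x), l₂)) []
        (enc (x, (l x).foldl (step x) (init x), ([] : List α))) u := by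
    intro x l₂
    induction l₂ with
    | nil =>
      intro l₁ hl₁
      have h1 := h x l₁ (by simp [← hl₁])
      obtain rfl : l₁ = l x := by simpa using hl₁
      have h2 : sz (x, (l x).foldl (step x) (init x), ([] : List α)) ≤ S x := by
        have := one_le_sz (l x)
        simp only [sz_pair, sz_nil, S]; omega
      refine ⟨_, ?_, Eval.while_stop (s := [])
        (Eval.seq (.snd (enc (x, (l x).foldl (step x) (init x), ([] : List α)))) (.snd _))⟩
      have h3 : (enc (x, (l x).foldl (step x) (init x), ([] : List α))).snd.size ≤ S x := by
        refine le_trans ?_ h2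
        simp [enc, Value.snd, sz, Value.size]; omega
      simp only [sz] at h2
      simp only [List.length_nil, K]
      omega
    | cons a l₂ ih =>
      intro l₁ hl₁
      have h1 := h x l₁ ⟨_, hl₁⟩
      obtain ⟨u, hu, hev⟩ := ih (l₁ ++ [a]) (by simpa using hl₁)
      rw [List.foldl_append] at hev
      have h2 : sz (x, l₁.foldl (step x) (init x), a :: l₂) ≤ S x := by
        have := sz_append l₁ (a :: l₂)
        have := one_le_sz l₁
        rw [hl₁] at *
        simp only [sz_pair, S]; omega
      have h3 : (enc (x, l₁.foldl (step x) (init x), a :: l₂)).snd.size ≤ S x := by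
        refine le_trans ?_ h2
        simp [enc, Value.snd, sz, Value.size]; omega
      let z : State := ⟨(x, l₁.foldl (step x) (init x), a :: l₂),
        by simp, by rw [← hl₁]; exact List.subset_append_right _ _⟩
      have h4 : t z ≤ P.eval (S x) := (hP z).trans (eval_mono_nat P h2)
      refine ⟨_, ?_, Eval.while_step (s₁ := []) (s₂ := [])
        (Eval.seq (.snd (enc (x, l₁.foldl (step x) (init x), a :: l₂))) (.snd _)) (hp z) hev⟩
      simp only [sz] at h2
      simp only [List.length_cons, add_mul, K] at hu ⊢
      omega
  refine of_le (.seq (.pair .id (.pair pi pl)) (.seq (.while (.seq .snd .snd) p) (.seq .snd .fst)))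
    (b := fun x => (sz x + (sz x + sz x + (sz x + ti x + tl x))) +
      (S x + (sz (l x) + 1) * K x + (4 * S x))) ?_ fun x => ?_
  · exact (PolyBdd.sz.add ((PolyBdd.sz.add .sz).add ((PolyBdd.sz.add hti).add htl))).add
      ((hS.add ((hl.polyBdd_sz.add (.const 1)).mul hK)).add (hS.const_mul 4))
  · obtain ⟨u, hu, hev⟩ := loop x (l x) [] rfl
    refine ⟨_, ?_, .seq (s₁ := []) (s₂ := []) (.pair (s₁ := []) (s₂ := []) (.id _)
      (.pair (s₁ := []) (s₂ := []) (hpi x) (hpl x)))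
      (.seq (s₁ := []) (s₂ := []) hev (.seq (.snd _) (.fst _)))⟩
    have h1 : (enc (x, init x, l x)).size ≤ S x := by
      have := h x [] (by simp)
      have h5 : (enc (x, init x, l x)).size = sz (x, init x, l x) := rfl
      rw [h5]
      simp only [sz_pair, S, List.foldl_nil] at this ⊢; omega
    have h2 : (enc (x, (l x).foldl (step x) (init x), ([] : List α))).size ≤ S x := by
      have := h x (l x) (by simp)
      have h5 : (enc (x, (l x).foldl (step x) (init x), ([] : List α))).size =
        sz (x, (l x).foldl (step x) (init x), ([] : List α)) := rfl
      have := one_le_sz (l x)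
      rw [h5]
      simp only [sz_pair, sz_nil, S]; omega
    have h3 : (enc (x, (l x).foldl (step x) (init x), ([] : List α))).snd.size ≤ S x := by
      refine le_trans ?_ h2
      simp [enc, Value.snd, Value.size]; omega
    have h4 : (Value.cons (enc x) (.cons (enc (init x)) (enc (l x)))).size ≤ S x := h1
    have h6 : (l x).length < sz (l x) := length_lt_sz _
    have h7 : u ≤ (sz (l x) + 1) * K x := hu.trans (Nat.mul_le_mul_right _ (by omega))
    simp only [sz] at *
    omega

theorem foldl {l : Γ → List α} {init : Γ → σ} {step : Γ → σ → α → σ} {b : Γ → ℕ}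
    (hl : PolyTime l) (hi : PolyTime init)
    (hs : PolyTime fun y : Γ × σ × α => step y.1 y.2.1 y.2.2)
    (hb : PolyBdd b) (h : ∀ x l₁, l₁ <+: l x → sz (l₁.foldl (step x) (init x)) ≤ b x) :
    PolyTime fun x => (l x).foldl (step x) (init x) :=
  foldl_mem hl hi (hs.comp (f := fun y : {y : Γ × σ × α // y.2.2 ∈ l y.1} => y.1) PolyTime.id.val)
    hb h

theorem reverse {l : Γ → List α} (hl : PolyTime l) : PolyTime fun x => (l x).reverse := by
  have := foldl (σ := List α) (step := fun _ s a => a :: s) hl (const [])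
    (PolyTime.id.snd.snd.cons PolyTime.id.snd.fst) hl.polyBdd_sz fun x l₁ h => by
      rw [List.foldl_flip_cons_eq_append', List.append_nil, sz_reverse]
      obtain ⟨l₂, h⟩ := h
      have := sz_append l₁ l₂
      have := one_le_sz l₂
      rw [h] at *
      omega
  refine this.congr fun x => ?_
  rw [List.foldl_flip_cons_eq_append', List.append_nil]

theorem append {l₁ l₂ : Γ → List α} (h₁ : PolyTime l₁) (h₂ : PolyTime l₂) :
    PolyTime fun x => l₁ x ++ l₂ x := by
  have := foldl (σ := List α) (step := fun _ s a => a :: s) h₁.reverse h₂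
    (PolyTime.id.snd.snd.cons PolyTime.id.snd.fst) (h₁.polyBdd_sz.add h₂.polyBdd_sz)
    fun x l h => by
      rw [List.foldl_flip_cons_eq_append']
      obtain ⟨l', h⟩ := h
      have e1 := sz_append l l'
      have e2 := one_le_sz l'
      have e3 := sz_append l.reverse (l₂ x)
      rw [h, sz_reverse] at *
      omega
  refine this.congr fun x => ?_
  rw [List.foldl_flip_cons_eq_append', List.reverse_reverse]

theorem _root_.LQCI.sz_le_of_prefix {l₁ l₂ : List α} (h : l₁ <+: l₂) : sz l₁ ≤ sz l₂ := by
  obtain ⟨l', rfl⟩ := h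
  have := sz_append l₁ l'
  have := one_le_sz l'
  omega

theorem _root_.LQCI.sz_le_length_mul {l : List α} {k : ℕ} (h : ∀ a ∈ l, sz a ≤ k) :
    sz l ≤ l.length * (k + 1) + 1 := by
  induction l with
  | nil => simp [sz_nil]
  | cons a l ih =>
    have := ih fun b hb => h b (List.mem_cons_of_mem _ hb)
    have := h a List.mem_cons_self
    simp only [sz_cons, List.length_cons, add_mul]
    omega

theorem map_mem {l : Γ → List α} {f : Γ → α → β} (hl : PolyTime l)
    (hf : PolyTime fun y : {y : Γ × α // y.2 ∈ l y.1} => f y.1.1 y.1.2) :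
    PolyTime fun x => (l x).map (f x) := by
  obtain ⟨P, hP⟩ := hf.polyBdd_sz
  have hy : PolyTime fun y : {y : Γ × List β × α // y.2.2 ∈ l y.1} => y.1 := PolyTime.id.val
  have h2 : ∀ x (l₁ : List α) (s : List β), l₁.foldl (fun s a => f x a :: s) s =
      (l₁.map (f x)).reverse ++ s := by
    intro x l₁
    induction l₁ with
    | nil => simp
    | cons a l₁ ih => intro s; simp [ih]
  have := foldl_mem (σ := List β) (step := fun x s a => f x a :: s) hl (const [])
    ((hf.comp ((hy.fst.pair hy.snd.snd).subtype_mk fun y => y.2)).cons hy.snd.fst)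
    (b := fun x => sz (l x) * (P.eval (sz x + sz (l x) + 1) + 1) + 1) ?_ ?_
  · refine this.reverse.congr fun x => ?_
    simp [h2]
  · exact (hl.polyBdd_sz.mul ((((PolyBdd.sz.add hl.polyBdd_sz).add (.const 1)).eval P).add
      (.const 1))).add (.const 1)
  · intro x l₁ h
    rw [h2, List.append_nil, sz_reverse]
    refine (sz_le_length_mul (k := P.eval (sz x + sz (l x) + 1)) ?_).trans ?_
    · intro b hb
      obtain ⟨a, ha, rfl⟩ := List.mem_map.1 hb
      have ha := h.subset ha
      refine (hP ⟨(x, a), ha⟩).trans (eval_mono_nat P ?_)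
      have := sz_lt_of_mem ha
      rw [sz_subtype, sz_pair]
      omega
    · rw [List.length_map]
      have := h.length_le
      have := length_lt_sz (l x)
      gcongr
      omega

theorem map {l : Γ → List α} {f : Γ → α → β} (hl : PolyTime l)
    (hf : PolyTime fun y : Γ × α => f y.1 y.2) : PolyTime fun x => (l x).map (f x) :=
  map_mem hl (hf.comp (f := fun y : {y : Γ × α // y.2 ∈ l y.1} => y.1) PolyTime.id.val)

theorem flatten {l : Γ → List (List α)} (hl : PolyTime l) : PolyTime fun x => (l x).flatten := by
  have h2 : ∀ (l₁ : List (List α)) (s : List α), l₁.foldl (fun s a => s ++ a) s =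
      s ++ l₁.flatten := by
    intro l₁
    induction l₁ with
    | nil => simp
    | cons a l₁ ih => intro s; simp [ih]
  have h3 : ∀ l : List (List α), sz l.flatten ≤ sz l := by
    intro l
    induction l with
    | nil => simp [sz_nil]
    | cons a l ih =>
      have := sz_append a l.flatten
      simp only [List.flatten_cons, sz_cons]
      omega
  have := foldl (σ := List α) (step := fun _ s a => s ++ a) hl (const [])
    (PolyTime.id.snd.fst.append PolyTime.id.snd.snd) hl.polyBdd_sz fun x l₁ h => by
      rw [h2, List.nil_append]
      exact (h3 _).trans (sz_le_of_prefix h)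
  refine this.congr fun x => ?_
  rw [h2, List.nil_append]

end PolyTime

/-! ### Binary arithmetic in polynomial time -/

namespace PolyDec

theorem not {P : Γ → Prop} : PolyDec P → PolyDec fun x => ¬ P x
  | ⟨b, hb, h⟩ => ⟨fun x => if b x = true then false else true,
    .ite ⟨b, hb, fun _ => Iff.rfl⟩ (.const _) (.const _), fun x => by
      simp only [h]; cases b x <;> simp⟩

theorem and {P Q : Γ → Prop} : PolyDec P → PolyDec Q → PolyDec fun x => P x ∧ Q x
  | ⟨b, hb, h⟩, ⟨c, hc, k⟩ => ⟨fun x => if b x = true then c x else false,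
    .ite ⟨b, hb, fun _ => Iff.rfl⟩ hc (.const _), fun x => by
      simp only [h, k]; cases b x <;> simp⟩

theorem of_bool {b : Γ → Bool} (hb : PolyTime b) : PolyDec fun x => b x = true :=
  ⟨b, hb, fun _ => Iff.rfl⟩

theorem comp {P : Δ → Prop} {f : Γ → Δ} : PolyDec P → PolyTime f → PolyDec fun x => P (f x)
  | ⟨_, hb, h⟩, hf => ⟨_, hb.comp hf, fun _ => h _⟩

protected theorem congr {P Q : Γ → Prop} : PolyDec P → (∀ x, P x ↔ Q x) → PolyDec Q
  | ⟨b, hb, h⟩, k => ⟨b, hb, fun x => (k x).symm.trans (h x)⟩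

end PolyDec

theorem enc_nat_zero : enc (0 : ℕ) = .nil := by simp [enc, encNat, encList]

theorem enc_nat_bit (b : Bool) (n : ℕ) (h : n = 0 → b = true) :
    enc (Nat.bit b n) = .cons (enc b) (enc n) := by
  simp [enc, encNat, Nat.bits_append_bit n b h, encList]

theorem enc_nat_of_ne_zero {n : ℕ} (h : n ≠ 0) :
    enc n = .cons (enc n.bodd) (enc n.div2) := by
  conv_lhs => rw [← Nat.bit_bodd_div2 n]
  apply enc_nat_bit
  intro h'
  by_contra hb
  have := Nat.bit_bodd_div2 n
  simp_all [Nat.bit]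

theorem sz_bool_le (b : Bool) : sz b ≤ 3 := by cases b <;> simp [sz, enc, encBool, Value.size]

theorem sz_nat_le {n k : ℕ} (h : n < 2 ^ k) : sz n ≤ 4 * k + 1 := by
  induction k generalizing n with
  | zero =>
    obtain rfl : n = 0 := by simpa using h
    simp [sz, enc_nat_zero, Value.size]
  | succ k ih =>
    by_cases hn : n = 0
    · subst hn; simp [sz, enc_nat_zero, Value.size]
    · have h1 : n.div2 < 2 ^ k := by rw [Nat.div2_val]; omega
      have h2 := ih h1
      have h3 := sz_bool_le n.bodd
      rw [sz, enc_nat_of_ne_zero hn, Value.size]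
      simp only [sz] at h2 h3
      omega

theorem lt_two_pow_sz (n : ℕ) : n < 2 ^ sz n := by
  induction n using Nat.strong_induction_on with
  | _ n ih =>
    by_cases hn : n = 0
    · subst hn; simp
    · have h1 : n.div2 < n := by rw [Nat.div2_val]; omega
      have h2 := ih _ h1
      have h3 : sz n = sz n.bodd + sz n.div2 + 1 := by
        rw [sz, enc_nat_of_ne_zero hn]; rfl
      rw [h3, pow_succ]
      have h4 : 2 ^ sz n.div2 ≤ 2 ^ (sz n.bodd + sz n.div2) :=
        Nat.pow_le_pow_right (by omega) (by omega)
      rw [Nat.div2_val] at *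
      omega

theorem sz_div2_le (n : ℕ) : sz n.div2 ≤ sz n := by
  by_cases hn : n = 0
  · subst hn; simp
  · rw [sz, sz, enc_nat_of_ne_zero hn, Value.size]; omega

/-- The number with the given binary digits, most significant digit first, after the digits
of `n`. -/
def ofDigits (n : ℕ) (l : List Bool) : ℕ := l.foldl (fun m b => Nat.bit b m) n

theorem ofDigits_cons (n : ℕ) (b : Bool) (l : List Bool) :
    ofDigits n (b :: l) = ofDigits (Nat.bit b n) l := rfl

theorem ofDigits_lt (l : List Bool) (n : ℕ) : ofDigits n l < (n + 1) * 2 ^ l.length := by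
  induction l generalizing n with
  | nil => simp [ofDigits]
  | cons b l ih =>
    refine (ih (Nat.bit b n)).trans_le ?_
    have : Nat.bit b n + 1 ≤ (n + 1) * 2 := by cases b <;> simp [Nat.bit] <;> omega
    rw [List.length_cons, pow_succ', ← mul_assoc]
    gcongr

theorem ofDigits_reverse_bits (n : ℕ) : ofDigits 0 n.bits.reverse = n := by
  induction n using Nat.strong_induction_on with
  | _ n ih =>
    by_cases hn : n = 0
    · subst hn; simp [ofDigits]
    · have h1 : n.div2 < n := by rw [Nat.div2_val]; omega
      have h2 : n.bits = n.bodd :: n.div2.bits := by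
        conv_lhs => rw [← Nat.bit_bodd_div2 n]
        apply Nat.bits_append_bit
        intro h'
        by_contra hb
        have := Nat.bit_bodd_div2 n
        simp_all [Nat.bit]
      have h3 := ih _ h1
      rw [ofDigits] at h3
      rw [h2, List.reverse_cons, ofDigits, List.foldl_append, h3]
      simp [Nat.bit_bodd_div2]

theorem div2_iterate_length_bits (n : ℕ) : Nat.div2^[n.bits.length] n = 0 := by
  have : ∀ k n, n < 2 ^ k → Nat.div2^[k] n = 0 := by
    intro k
    induction k with
    | zero => intro n h; simpa using h
    | succ k ih =>
      intro n h
      rw [Function.iterate_succ_apply]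
      apply ih
      rw [Nat.div2_val]
      omega
  apply this
  have := ofDigits_lt n.bits.reverse 0
  rw [ofDigits_reverse_bits] at this
  simpa using this

theorem foldl_const_eq_iterate {α σ : Type*} (step : σ → σ) (l : List α) (s : σ) :
    l.foldl (fun s _ => step s) s = step^[l.length] s := by
  induction l generalizing s with
  | nil => rfl
  | cons a l ih => simp [ih]

namespace PolyTime

/-- A loop whose body enlarges the result by at most `g x`. -/
theorem foldl_of_growth {l : Γ → List α} {init : Γ → σ} {step : Γ → σ → α → σ} {g : Γ → ℕ}
    (hl : PolyTime l) (hi : PolyTime init)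
    (hs : PolyTime fun y : Γ × σ × α => step y.1 y.2.1 y.2.2)
    (hg : PolyBdd g) (h : ∀ x s a, sz (step x s a) ≤ sz s + g x) :
    PolyTime fun x => (l x).foldl (step x) (init x) := by
  refine foldl hl hi hs (hi.polyBdd_sz.add (hl.polyBdd_sz.mul hg)) fun x l₁ hl₁ => ?_
  have h1 : ∀ (l : List α) (s : σ), sz (l.foldl (step x) s) ≤ sz s + l.length * g x := by
    intro l
    induction l with
    | nil => simp
    | cons a l ih =>
      intro s
      have := ih (step x s a)
      have := h x s a
      simp only [List.foldl_cons, List.length_cons, add_mul]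
      omega
  have h2 : l₁.length ≤ sz (l x) := hl₁.length_le.trans (length_lt_sz _).le
  have h3 := h1 l₁ (init x)
  have h4 : l₁.length * g x ≤ sz (l x) * g x := Nat.mul_le_mul_right _ h2
  omega

theorem not {f : Γ → Bool} (hf : PolyTime f) : PolyTime fun x => !(f x) :=
  (PolyTime.ite (.of_bool hf) (.const false) (.const true)).congr fun x => by cases f x <;> simp

theorem xor {f g : Γ → Bool} (hf : PolyTime f) (hg : PolyTime g) :
    PolyTime fun x => (f x).xor (g x) :=
  (PolyTime.ite (.of_bool hf) hg.not hg).congr fun x => by cases f x <;> simp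

theorem and {f g : Γ → Bool} (hf : PolyTime f) (hg : PolyTime g) :
    PolyTime fun x => f x && g x :=
  (PolyTime.ite (.of_bool hf) hg (.const false)).congr fun x => by cases f x <;> simp

theorem or {f g : Γ → Bool} (hf : PolyTime f) (hg : PolyTime g) :
    PolyTime fun x => f x || g x :=
  (PolyTime.ite (.of_bool hf) (.const true) hg).congr fun x => by cases f x <;> simp

theorem bits {f : Γ → ℕ} (hf : PolyTime f) : PolyTime fun x => (f x).bits :=
  hf.congr_enc fun _ => rfl

theorem bodd {f : Γ → ℕ} (hf : PolyTime f) : PolyTime fun x => (f x).bodd := by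
  refine comp (g := Nat.bodd) ⟨.fst, _, .sz, fun n => ?_⟩ hf
  have := Eval.fst (enc n)
  by_cases hn : n = 0
  · subst hn; rw [enc_nat_zero] at this; exact this
  · conv at this => enter [4]; rw [enc_nat_of_ne_zero hn]
    exact this

theorem div2 {f : Γ → ℕ} (hf : PolyTime f) : PolyTime fun x => (f x).div2 := by
  refine comp (g := Nat.div2) ⟨.snd, _, .sz, fun n => ?_⟩ hf
  have := Eval.snd (enc n)
  by_cases hn : n = 0
  · subst hn; rw [enc_nat_zero] at this; exact this
  · conv at this => enter [4]; rw [enc_nat_of_ne_zero hn]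
    exact this

theorem _root_.LQCI.PolyDec.ne_zero {f : Γ → ℕ} (hf : PolyTime f) : PolyDec fun x => f x ≠ 0 := by
  refine ⟨fun x => if f x ≠ 0 then true else false,
    ite_nil hf (.const _) (.const _) fun x => ?_, fun x => by simp⟩
  by_cases hn : f x = 0
  · simp [hn, enc_nat_zero]
  · simp [enc_nat_of_ne_zero hn, hn]

theorem bit {b : Γ → Bool} {f : Γ → ℕ} (hb : PolyTime b) (hf : PolyTime f) :
    PolyTime fun x => Nat.bit (b x) (f x) := by
  have h : PolyTime fun x => if f x ≠ 0 then b x :: (f x).bits else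
      if b x = true then [true] else [] :=
    .ite (.ne_zero hf) (hb.cons hf.bits) (.ite (.of_bool hb) (.const _) (.const _))
  refine h.congr_enc fun x => ?_
  by_cases hn : f x = 0
  · cases hbx : b x
    · simp [hn, enc, encNat]
    · simp [hn, enc, encNat]
  · rw [if_pos hn, enc_nat_bit _ _ (fun h => absurd h hn)]; rfl

theorem ofDigits {f : Γ → ℕ} {l : Γ → List Bool} (hf : PolyTime f) (hl : PolyTime l) :
    PolyTime fun x => ofDigits (f x) (l x) := by
  refine foldl_of_growth (step := fun _ m b => Nat.bit b m) hl hf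
    (bit PolyTime.id.snd.snd PolyTime.id.snd.fst) (.const 8) fun _ m b => ?_
  by_cases hm : m = 0
  · subst hm
    have h : Nat.bit b 0 < 2 ^ 1 := by cases b <;> simp [Nat.bit]
    have := sz_nat_le h
    omega
  · have := sz_bool_le b
    rw [sz, enc_nat_bit _ _ (fun h => absurd h hm)]
    simp only [Value.size, sz] at *
    omega

/-- Iterate a step as many times as the given numbers have digits. -/
theorem iterate_bits₂ {step : σ → σ} {init : Γ → σ} {f g : Γ → ℕ} (k : ℕ) (hstep : PolyTime step)
    (hsz : ∀ s, sz (step s) ≤ sz s + k) (hi : PolyTime init) (hf : PolyTime f)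
    (hg : PolyTime g) :
    PolyTime fun x => step^[(g x).bits.length] (step^[(f x).bits.length] (init x)) := by
  have hloop : ∀ {init : Γ → σ} {h : Γ → ℕ}, PolyTime init → PolyTime h →
      PolyTime fun x => step^[(h x).bits.length] (init x) := fun hi hh =>
    (foldl_of_growth (step := fun _ s _ => step s) hh.bits hi (hstep.comp PolyTime.id.snd.fst)
      (.const k) fun _ s _ => hsz s).congr fun x => foldl_const_eq_iterate _ _ _
  exact hloop (hloop hi hf) hg

end PolyTime

/-- One step of the addition of two numbers. The state consists of the two numbers without the
digits that have been added, the carry, and the digits of the sum so far, in reverse order. -/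
def addStep (s : ℕ × ℕ × Bool × List Bool) : ℕ × ℕ × Bool × List Bool :=
  (s.1.div2, s.2.1.div2,
    ((s.1.bodd && s.2.1.bodd) || (s.2.2.1 && (s.1.bodd.xor s.2.1.bodd))),
    (s.2.2.1.xor (s.1.bodd.xor s.2.1.bodd)) :: s.2.2.2)

/-- One step of the subtraction of two numbers, with a borrow instead of the carry. -/
def subStep (s : ℕ × ℕ × Bool × List Bool) : ℕ × ℕ × Bool × List Bool :=
  (s.1.div2, s.2.1.div2,
    ((!s.1.bodd && (s.2.1.bodd || s.2.2.1)) || (s.2.1.bodd && s.2.2.1)),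
    (s.2.2.1.xor (s.1.bodd.xor s.2.1.bodd)) :: s.2.2.2)

theorem addStep_invariant (k : ℕ) (s : ℕ × ℕ × Bool × List Bool) :
    (addStep^[k] s).1 = Nat.div2^[k] s.1 ∧ (addStep^[k] s).2.1 = Nat.div2^[k] s.2.1 ∧
    ofDigits ((addStep^[k] s).1 + (addStep^[k] s).2.1 + (addStep^[k] s).2.2.1.toNat)
      (addStep^[k] s).2.2.2 = ofDigits (s.1 + s.2.1 + s.2.2.1.toNat) s.2.2.2 := by
  induction k generalizing s with
  | zero => exact ⟨rfl, rfl, rfl⟩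
  | succ k ih =>
    obtain ⟨h1, h2, h3⟩ := ih (addStep s)
    refine ⟨h1, h2, h3.trans ?_⟩
    obtain ⟨a, b, c, o⟩ := s
    have ha := Nat.bodd_add_div2 a
    have hb := Nat.bodd_add_div2 b
    simp only [addStep, ofDigits_cons]
    congr 1
    cases hx : a.bodd <;> cases hy : b.bodd <;> cases c <;>
      simp [hx, hy, Nat.bit] at * <;> omega

/-- The integer with the given binary digits, most significant digit first, after the digits
of `n`. -/
def intOfDigits (n : ℤ) (l : List Bool) : ℤ := l.foldl (fun m b => 2 * m + b.toNat) n

theorem intOfDigits_natCast (n : ℕ) (l : List Bool) : intOfDigits n l = ofDigits n l := by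
  induction l generalizing n with
  | nil => rfl
  | cons b l ih =>
    rw [ofDigits_cons, ← ih]
    simp only [intOfDigits, List.foldl_cons]
    congr 1
    cases b <;> simp [Nat.bit]

theorem intOfDigits_neg {n : ℤ} (l : List Bool) (h : n < 0) : intOfDigits n l < 0 := by
  induction l generalizing n with
  | nil => exact h
  | cons b l ih =>
    refine ih ?_
    cases b <;> simp <;> omega

theorem subStep_invariant (k : ℕ) (s : ℕ × ℕ × Bool × List Bool) :
    (subStep^[k] s).1 = Nat.div2^[k] s.1 ∧ (subStep^[k] s).2.1 = Nat.div2^[k] s.2.1 ∧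
    intOfDigits ((subStep^[k] s).1 - (subStep^[k] s).2.1 - (subStep^[k] s).2.2.1.toNat)
      (subStep^[k] s).2.2.2 = intOfDigits (s.1 - s.2.1 - s.2.2.1.toNat) s.2.2.2 := by
  induction k generalizing s with
  | zero => exact ⟨rfl, rfl, rfl⟩
  | succ k ih =>
    obtain ⟨h1, h2, h3⟩ := ih (subStep s)
    refine ⟨h1, h2, h3.trans ?_⟩
    obtain ⟨a, b, c, o⟩ := s
    have ha := Nat.bodd_add_div2 a
    have hb := Nat.bodd_add_div2 b
    simp only [subStep, intOfDigits, List.foldl_cons]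
    congr 1
    cases hx : a.bodd <;> cases hy : b.bodd <;> cases c <;>
      simp [hx, hy] at * <;> omega

theorem div2_iterate_zero (k : ℕ) : Nat.div2^[k] 0 = 0 := by
  induction k with
  | zero => rfl
  | succ k ih => rw [Function.iterate_succ_apply]; simpa using ih

theorem div2_iterate_of_length_le {k n : ℕ} (h : n.bits.length ≤ k) : Nat.div2^[k] n = 0 := by
  obtain ⟨j, rfl⟩ := Nat.exists_eq_add_of_le' h
  rw [Function.iterate_add_apply, div2_iterate_length_bits, div2_iterate_zero]

namespace PolyTime

theorem add {f g : Γ → ℕ} (hf : PolyTime f) (hg : PolyTime g) : PolyTime fun x => f x + g x := by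
  have hstep : PolyTime addStep := by
    have h : PolyTime fun s : ℕ × ℕ × Bool × List Bool => s := .id
    have ha := h.fst.bodd
    have hb := h.snd.fst.bodd
    have hc := h.snd.snd.fst
    exact h.fst.div2.pair (h.snd.fst.div2.pair (((ha.and hb).or (hc.and (ha.xor hb))).pair
      ((hc.xor (ha.xor hb)).cons h.snd.snd.snd)))
  have key := iterate_bits₂ 6 hstep (by
    rintro ⟨a, b, c, o⟩
    have h1 := sz_div2_le a
    have h2 := sz_div2_le b
    have h3 := sz_bool_le ((a.bodd && b.bodd) || (c && (a.bodd.xor b.bodd)))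
    have h4 := sz_bool_le (c.xor (a.bodd.xor b.bodd))
    have h5 := one_le_sz c
    simp only [addStep, sz_pair, sz_cons]
    omega) (hf.pair (hg.pair ((const false).pair (const [])))) hf hg
  refine ((key.snd.snd.fst.bit (const 0)).ofDigits key.snd.snd.snd).congr fun x => ?_
  rw [← Function.iterate_add_apply]
  obtain ⟨h1, h2, h3⟩ := addStep_invariant ((g x).bits.length + (f x).bits.length)
    (f x, g x, false, [])
  rw [h1, h2, div2_iterate_of_length_le (by simp), div2_iterate_of_length_le (by simp)] at h3
  refine Eq.trans ?_ (h3.trans (by simp [LQCI.ofDigits]))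
  congr 1
  generalize (addStep^[_] (f x, g x, false, [])).2.2.1 = c
  cases c <;> simp [Nat.bit]

/-- Truncated subtraction. -/
theorem sub {f g : Γ → ℕ} (hf : PolyTime f) (hg : PolyTime g) : PolyTime fun x => f x - g x := by
  have hstep : PolyTime subStep := by
    have h : PolyTime fun s : ℕ × ℕ × Bool × List Bool => s := .id
    have ha := h.fst.bodd
    have hb := h.snd.fst.bodd
    have hc := h.snd.snd.fst
    exact h.fst.div2.pair (h.snd.fst.div2.pair (((ha.not.and (hb.or hc)).or (hb.and hc)).pair
      ((hc.xor (ha.xor hb)).cons h.snd.snd.snd)))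
  have key := iterate_bits₂ 6 hstep (by
    rintro ⟨a, b, c, o⟩
    have h1 := sz_div2_le a
    have h2 := sz_div2_le b
    have h3 := sz_bool_le ((!a.bodd && (b.bodd || c)) || (b.bodd && c))
    have h4 := sz_bool_le (c.xor (a.bodd.xor b.bodd))
    have h5 := one_le_sz c
    simp only [subStep, sz_pair, sz_cons]
    omega) (hf.pair (hg.pair ((const false).pair (const [])))) hf hg
  refine (PolyTime.ite (.of_bool key.snd.snd.fst) (const 0)
    ((const 0).ofDigits key.snd.snd.snd)).congr fun x => ?_
  rw [← Function.iterate_add_apply]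
  obtain ⟨h1, h2, h3⟩ := subStep_invariant ((g x).bits.length + (f x).bits.length)
    (f x, g x, false, [])
  rw [h1, h2, div2_iterate_of_length_le (by simp), div2_iterate_of_length_le (by simp)] at h3
  revert h3
  generalize subStep^[(g x).bits.length + (f x).bits.length] (f x, g x, false, []) = s
  intro h3
  obtain ⟨_, _, c, o⟩ := s
  cases c with
  | true =>
    have := intOfDigits_neg (n := -1) o (by simp)
    simp [intOfDigits] at h3 this ⊢
    omega
  | false =>
    have := intOfDigits_natCast 0 o
    simp [intOfDigits] at h3 this ⊢
    omega

theorem _root_.LQCI.PolyDec.le {f g : Γ → ℕ} (hf : PolyTime f) (hg : PolyTime g) :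
    PolyDec fun x => f x ≤ g x :=
  (PolyDec.ne_zero (hf.sub hg)).not.congr fun x => by rw [not_not, Nat.sub_eq_zero_iff_le]

theorem _root_.LQCI.PolyDec.lt {f g : Γ → ℕ} (hf : PolyTime f) (hg : PolyTime g) :
    PolyDec fun x => f x < g x :=
  (PolyDec.le hg hf).not.congr fun _ => not_le

theorem min {f g : Γ → ℕ} (hf : PolyTime f) (hg : PolyTime g) :
    PolyTime fun x => min (f x) (g x) :=
  (PolyTime.ite (.le hf hg) hf hg).congr fun x => by rw [min_def]

theorem mul {f g : Γ → ℕ} (hf : PolyTime f) (hg : PolyTime g) : PolyTime fun x => f x * g x := by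
  have h0 : PolyTime fun y : Γ × ℕ × Bool => y := .id
  have key : ∀ (m : ℕ) (l : List Bool) (n : ℕ),
      l.foldl (fun s b => s + s + if b = true then m else 0) (n * m) = LQCI.ofDigits n l * m := by
    intro m l
    induction l with
    | nil => intro n; rfl
    | cons b l ih =>
      intro n
      rw [ofDigits_cons, ← ih, List.foldl_cons]
      congr 1
      cases b <;> simp [Nat.bit] <;> ring
  refine (foldl (init := fun _ => 0) (step := fun x s b => s + s + if b = true then g x else 0)
    (b := fun x => 4 * (sz (f x) + sz (g x)) + 1) hf.bits.reverse (const 0)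
    ((h0.snd.fst.add h0.snd.fst).add (.ite (.of_bool h0.snd.snd) (hg.comp h0.fst) (const 0)))
    (((hf.polyBdd_sz.add hg.polyBdd_sz).const_mul 4).add (.const 1)) fun x l hl => ?_).congr
    fun x => ?_
  · have := key (g x) l 0
    rw [zero_mul] at this
    rw [this]
    apply sz_nat_le
    rw [pow_add]
    have h1 := ofDigits_lt l 0
    have h2 := lt_two_pow_sz (g x)
    have h3 : l.length ≤ sz (f x) := by
      have := hl.length_le
      have := length_lt_sz (f x).bits
      rw [List.length_reverse] at *
      exact (by omega : l.length ≤ sz (f x).bits)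
    rw [zero_add, one_mul] at h1
    exact Nat.mul_lt_mul'' (h1.trans_le (Nat.pow_le_pow_right (by omega) h3)) h2
  · have := key (g x) (f x).bits.reverse 0
    rw [zero_mul, ofDigits_reverse_bits] at this
    exact this

/-- Long division. -/
theorem div {f g : Γ → ℕ} (hf : PolyTime f) (hg : PolyTime g) (h : ∀ x, 0 < g x) :
    PolyTime fun x => f x / g x := by
  have h0 : PolyTime fun y : Γ × (ℕ × ℕ) × Bool => y := .id
  have hr := h0.snd.snd.bit h0.snd.fst.snd
  have hc : PolyDec fun y : Γ × (ℕ × ℕ) × Bool => g y.1 ≤ Nat.bit y.2.2 y.2.1.2 :=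
    .le (hg.comp h0.fst) hr
  have key : ∀ (m : ℕ), 0 < m → ∀ (l : List Bool) (n : ℕ),
      l.foldl (fun s b => if m ≤ Nat.bit b s.2 then (Nat.bit true s.1, Nat.bit b s.2 - m)
        else (Nat.bit false s.1, Nat.bit b s.2)) (n / m, n % m) =
      (LQCI.ofDigits n l / m, LQCI.ofDigits n l % m) := by
    intro m hm l
    induction l with
    | nil => intro n; rfl
    | cons b l ih =>
      intro n
      rw [ofDigits_cons, ← ih, List.foldl_cons]
      congr 1
      have h1 := Nat.div_add_mod n m
      have h2 := Nat.mod_lt n hm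
      have h3 : Nat.bit b n = m * (2 * (n / m)) + Nat.bit b (n % m) := by
        conv_lhs => rw [← h1]
        cases b <;> simp [Nat.bit] <;> ring
      have h4 : Nat.bit b (n % m) < 2 * m := by cases b <;> simp [Nat.bit] <;> omega
      dsimp only
      clear ih
      generalize n / m = q, n % m = r at *
      split_ifs with hle
      · have h5 : Nat.bit b n = (Nat.bit b r - m) + m * (Nat.bit true q) := by
          rw [h3]
          have h6 : Nat.bit true q = 2 * q + 1 := rfl
          rw [h6, mul_add]
          omega
        rw [h5, Nat.add_mul_div_left _ _ hm, Nat.add_mul_mod_self_left,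
          Nat.div_eq_of_lt (by omega), Nat.mod_eq_of_lt (by omega), zero_add]
      · rw [h3, Nat.mul_add_div hm, Nat.mul_add_mod, Nat.div_eq_of_lt (by omega),
          Nat.mod_eq_of_lt (by omega)]
        simp [Nat.bit]
  refine (foldl (init := fun _ => (0, 0)) (step := fun x s b =>
      if g x ≤ Nat.bit b s.2 then (Nat.bit true s.1, Nat.bit b s.2 - g x)
        else (Nat.bit false s.1, Nat.bit b s.2))
    (b := fun x => 8 * sz (f x) + 3) hf.bits.reverse (const _)
    (.ite hc ((bit (const true) h0.snd.fst.fst).pair (hr.sub (hg.comp h0.fst)))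
      ((bit (const false) h0.snd.fst.fst).pair hr))
    ((hf.polyBdd_sz.const_mul 8).add (.const 3)) fun x l hl => ?_).fst.congr
    fun x => ?_
  · have := key (g x) (h x) l 0
    rw [Nat.zero_div, Nat.zero_mod] at this
    rw [this]
    have h1 := ofDigits_lt l 0
    have h3 : l.length ≤ sz (f x) := by
      have := hl.length_le
      have := length_lt_sz (f x).bits
      rw [List.length_reverse] at *
      exact (by omega : l.length ≤ sz (f x).bits)
    rw [zero_add, one_mul] at h1
    have h2 : LQCI.ofDigits 0 l < 2 ^ sz (f x) :=
      h1.trans_le (Nat.pow_le_pow_right (by omega) h3)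
    have h4 := sz_nat_le ((Nat.div_le_self (LQCI.ofDigits 0 l) (g x)).trans_lt h2)
    have h5 := sz_nat_le ((Nat.mod_le (LQCI.ofDigits 0 l) (g x)).trans_lt h2)
    rw [sz_pair]
    omega
  · have := key (g x) (h x) (f x).bits.reverse 0
    rw [Nat.zero_div, Nat.zero_mod, ofDigits_reverse_bits] at this
    exact congrArg Prod.fst this

theorem sum {l : Γ → List ℕ} (hl : PolyTime l) : PolyTime fun x => (l x).sum := by
  have h0 : PolyTime fun y : Γ × ℕ × ℕ => y := .id
  have key : ∀ l : List ℕ, l.sum < 2 ^ sz l := by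
    intro l
    induction l with
    | nil => simp
    | cons a l ih =>
      have := lt_two_pow_sz a
      have h1 : 2 ^ sz a ≤ 2 ^ (sz a + sz l) := Nat.pow_le_pow_right (by omega) (by omega)
      have h2 : 2 ^ sz l ≤ 2 ^ (sz a + sz l) := Nat.pow_le_pow_right (by omega) (by omega)
      rw [List.sum_cons, sz_cons, pow_succ]
      omega
  refine (foldl (init := fun _ => 0) (step := fun _ s a => s + a) (b := fun x => 4 * sz (l x) + 1)
    hl (const 0) (h0.snd.fst.add h0.snd.snd) ((hl.polyBdd_sz.const_mul 4).add (.const 1))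
    fun x l₁ h => ?_).congr fun x => List.sum_eq_foldl.symm
  rw [← List.sum_eq_foldl]
  exact sz_nat_le ((key l₁).trans_le (Nat.pow_le_pow_right (by omega) (sz_le_of_prefix h)))

theorem prod {l : Γ → List ℕ} (hl : PolyTime l) : PolyTime fun x => (l x).prod := by
  have h0 : PolyTime fun y : Γ × ℕ × ℕ => y := .id
  have key : ∀ l : List ℕ, l.prod < 2 ^ sz l := by
    intro l
    induction l with
    | nil => simp [sz_nil]
    | cons a l ih =>
      have := lt_two_pow_sz a
      rw [List.prod_cons, sz_cons, pow_succ, pow_add]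
      have := Nat.mul_lt_mul'' this ih
      omega
  refine (foldl (init := fun _ => 1) (step := fun _ s a => s * a) (b := fun x => 4 * sz (l x) + 1)
    hl (const 1) (h0.snd.fst.mul h0.snd.snd) ((hl.polyBdd_sz.const_mul 4).add (.const 1))
    fun x l₁ h => ?_).congr fun x => List.prod_eq_foldl.symm
  rw [← List.prod_eq_foldl]
  exact sz_nat_le ((key l₁).trans_le (Nat.pow_le_pow_right (by omega) (sz_le_of_prefix h)))

theorem length {l : Γ → List α} (hl : PolyTime l) : PolyTime fun x => (l x).length :=
  (hl.map (f := fun _ _ => 1) (const 1)).sum.congr fun x => by simp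

theorem zipIdx {l : Γ → List α} (hl : PolyTime l) : PolyTime fun x => (l x).zipIdx := by
  have h0 : PolyTime fun y : Γ × (ℕ × List (α × ℕ)) × α => y := .id
  have key : ∀ (l : List α) (k : ℕ) (o : List (α × ℕ)),
      l.foldl (fun s a => (s.1 + 1, (a, s.1) :: s.2)) (k, o) =
        (k + l.length, (l.zipIdx k).reverse ++ o) := by
    intro l
    induction l with
    | nil => simp
    | cons a l ih => intro k o; simp [ih]; omega
  refine (foldl (init := fun _ => (0, [])) (step := fun _ s a => (s.1 + 1, (a, s.1) :: s.2))
    (b := fun x => (4 * sz (l x) + 1) + (sz (l x) * (sz (l x) + (4 * sz (l x) + 1) + 1 + 1) + 1) + 1)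
    hl (const (0, []))
    ((h0.snd.fst.fst.add (const 1)).pair ((h0.snd.snd.pair h0.snd.fst.fst).cons h0.snd.fst.snd))
    ?_ fun x l₁ h => ?_).snd.reverse.congr fun x => by simp [key]
  · have h1 := hl.polyBdd_sz
    have h2 := (h1.const_mul 4).add (.const 1)
    exact (h2.add ((h1.mul (((h1.add h2).add (.const 1)).add (.const 1))).add (.const 1))).add
      (.const 1)
  · rw [key, zero_add, List.append_nil, sz_pair, sz_reverse]
    have hlen : l₁.length < sz (l x) := h.length_le.trans_lt (length_lt_sz _)
    have h2 : ∀ k, k < sz (l x) → sz k ≤ 4 * sz (l x) + 1 := fun k hk =>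
      sz_nat_le (hk.trans Nat.lt_two_pow_self)
    have h3 := sz_le_length_mul (l := l₁.zipIdx) (k := sz (l x) + (4 * sz (l x) + 1) + 1) (by
      rintro ⟨a, k⟩ hk
      obtain ⟨-, hk2, hk3⟩ := List.mem_zipIdx hk
      have := h2 k (by omega)
      have h4 : a ∈ l x := h.subset (by rw [hk3]; exact List.getElem_mem _)
      have := sz_lt_of_mem h4
      rw [sz_pair]
      omega)
    have h5 := h2 _ hlen
    have h6 : l₁.zipIdx.length * (sz (l x) + (4 * sz (l x) + 1) + 1 + 1) ≤
      sz (l x) * (sz (l x) + (4 * sz (l x) + 1) + 1 + 1) := by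
      gcongr
      simpa using hlen.le
    omega

end PolyTime

end PolyTime

/-! ### Expectations over the runs of a program -/

/-- The coin tosses of a halting run are prefix-free, and determine the run. -/
theorem Eval.unique {p : Prog} {x y y' : Value} {s s' u u' : List Bool} {t t' : ℕ}
    (h : Eval p x s y t) (h' : Eval p x s' y' t') (hs : s ++ u = s' ++ u') :
    s = s' ∧ y = y' ∧ t = t' := by
  induction h generalizing s' y' t' u u' with
  | const | id | fst | snd => cases h'; exact ⟨rfl, rfl, rfl⟩
  | flip => cases h'; simp_all
  | pair h₁ h₂ ih₁ ih₂ =>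
    cases h' with
    | pair k₁ k₂ =>
      simp only [List.append_assoc] at hs
      obtain ⟨rfl, rfl, rfl⟩ := ih₁ k₁ hs
      obtain ⟨rfl, rfl, rfl⟩ := ih₂ k₂ (List.append_cancel_left hs)
      exact ⟨rfl, rfl, rfl⟩
  | seq h₁ h₂ ih₁ ih₂ =>
    cases h' with
    | seq k₁ k₂ =>
      simp only [List.append_assoc] at hs
      obtain ⟨rfl, rfl, rfl⟩ := ih₁ k₁ hs
      obtain ⟨rfl, rfl, rfl⟩ := ih₂ k₂ (List.append_cancel_left hs)
      exact ⟨rfl, rfl, rfl⟩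
  | ite_true h₁ h₂ ih₁ ih₂ =>
    cases h' with
    | ite_true k₁ k₂ =>
      simp only [List.append_assoc] at hs
      obtain ⟨rfl, e, rfl⟩ := ih₁ k₁ hs
      obtain ⟨rfl, rfl, rfl⟩ := ih₂ k₂ (List.append_cancel_left hs)
      exact ⟨rfl, rfl, rfl⟩
    | ite_false k₁ k₂ =>
      simp only [List.append_assoc] at hs
      obtain ⟨rfl, e, rfl⟩ := ih₁ k₁ hs
      cases e
  | ite_false h₁ h₂ ih₁ ih₂ =>
    cases h' with
    | ite_true k₁ k₂ =>
      simp only [List.append_assoc] at hs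
      obtain ⟨rfl, e, rfl⟩ := ih₁ k₁ hs
      cases e
    | ite_false k₁ k₂ =>
      simp only [List.append_assoc] at hs
      obtain ⟨rfl, e, rfl⟩ := ih₁ k₁ hs
      obtain ⟨rfl, rfl, rfl⟩ := ih₂ k₂ (List.append_cancel_left hs)
      exact ⟨rfl, rfl, rfl⟩
  | while_stop h₁ ih₁ =>
    cases h' with
    | while_stop k₁ =>
      obtain ⟨rfl, e, rfl⟩ := ih₁ k₁ hs
      exact ⟨rfl, rfl, rfl⟩
    | while_step k₁ k₂ k₃ =>
      simp only [List.append_assoc] at hs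
      obtain ⟨rfl, e, rfl⟩ := ih₁ k₁ hs
      cases e
  | while_step h₁ h₂ h₃ ih₁ ih₂ ih₃ =>
    cases h' with
    | while_stop k₁ =>
      simp only [List.append_assoc] at hs
      obtain ⟨rfl, e, rfl⟩ := ih₁ k₁ hs
      cases e
    | while_step k₁ k₂ k₃ =>
      simp only [List.append_assoc] at hs
      obtain ⟨rfl, e, rfl⟩ := ih₁ k₁ hs
      obtain ⟨rfl, rfl, rfl⟩ := ih₂ k₂ (List.append_cancel_left hs)
      obtain ⟨rfl, rfl, rfl⟩ := ih₃ k₃ (List.append_cancel_left (List.append_cancel_left hs))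
      exact ⟨rfl, rfl, rfl⟩

theorem Eval.one_le_time {p : Prog} {x y : Value} {s : List Bool} {t : ℕ} (h : Eval p x s y t) :
    1 ≤ t := by
  have := x.one_le_size
  cases h <;> omega

namespace Prog

/-- The expectation of `F output time` over the runs of `p` on `x` that halt. -/
noncomputable def expect (p : Prog) (x : Value) (F : Value → ℕ → ℝ≥0∞) : ℝ≥0∞ :=
  ∑' r : Run p x, r.prob * F r.output r.time

variable {p q c : Prog} {x : Value}

theorem outProb_eq_expect (y : Value) [DecidableEq Value] :
    p.outProb x y = p.expect x fun z _ => if z = y then 1 else 0 := by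
  unfold outProb expect
  congr 1 with r
  by_cases h : r.output = y <;> simp [h]

theorem haltProb_eq_expect : p.haltProb x = p.expect x fun _ _ => 1 := by
  simp [haltProb, expect]

theorem expect_mono {F G : Value → ℕ → ℝ≥0∞}
    (h : ∀ s y t, Eval p x s y t → F y t ≤ G y t) : p.expect x F ≤ p.expect x G :=
  ENNReal.tsum_le_tsum fun r => mul_le_mul_right (h _ _ _ r.2) _

theorem expect_add (F G : Value → ℕ → ℝ≥0∞) :
    (p.expect x fun y t => F y t + G y t) = p.expect x F + p.expect x G := by
  simp [expect, mul_add, ENNReal.tsum_add]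

theorem expect_const_mul (a : ℝ≥0∞) (F : Value → ℕ → ℝ≥0∞) :
    (p.expect x fun y t => a * F y t) = a * p.expect x F := by
  simp only [expect, ← ENNReal.tsum_mul_left]
  congr 1 with r
  ring

theorem expect_const (a : ℝ≥0∞) : (p.expect x fun _ _ => a) = a * p.haltProb x := by
  rw [haltProb_eq_expect, ← expect_const_mul]
  simp

theorem expectedTime_of_one_le (h : 1 ≤ p.haltProb x) :
    p.expectedTime x = p.expect x fun _ t => t := by
  simp [expectedTime, expect, tsub_eq_zero_of_le h]

theorem expect_time_le : (p.expect x fun _ t => t) ≤ p.expectedTime x :=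
  le_self_add

theorem one_le_haltProb (h : p.expectedTime x < ⊤) : 1 ≤ p.haltProb x := by
  by_contra! hlt
  rw [expectedTime, ENNReal.mul_top (by simpa [tsub_eq_zero_iff_le] using hlt)] at h
  simp at h

/-- The lists of coin tosses of the halting runs form a prefix-free code, so that the Kraft
inequality applies. -/
theorem haltProb_le_one : p.haltProb x ≤ 1 := by
  classical
  have hinj : Function.Injective fun r : Run p x => r.1.1 := by
    rintro ⟨⟨s, y, t⟩, h⟩ ⟨⟨s', y', t'⟩, h'⟩ hs
    obtain ⟨rfl, rfl, rfl⟩ := h.unique h' (congrArg (· ++ []) hs)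
    rfl
  unfold haltProb
  rw [ENNReal.tsum_eq_iSup_sum]
  refine iSup_le fun S => ?_
  by_cases hnil : ∃ r ∈ S, r.1.1 = []
  · obtain ⟨r, hr, hnil⟩ := hnil
    have : S = {r} := by
      refine Finset.eq_singleton_iff_unique_mem.2 ⟨hr, fun r' hr' => hinj ?_⟩
      exact (r'.2.unique r.2 (u := []) (u' := r'.1.1) (by simp [hnil])).1
    rw [this, Finset.sum_singleton, Run.prob, hnil]
    simp
  · push Not at hnil
    have hcode : InformationTheory.UniquelyDecodable
        ((S.image fun r => r.1.1 : Finset (List Bool)) : Set (List Bool)) := by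
      have hmem : ∀ w ∈ ((S.image fun r => r.1.1 : Finset (List Bool)) : Set (List Bool)),
          w ≠ [] ∧ ∃ y t, Eval p x w y t := by
        intro w hw
        obtain ⟨r, hr, rfl⟩ := Finset.mem_image.1 (Finset.mem_coe.1 hw)
        exact ⟨hnil r hr, _, _, r.2⟩
      intro L₁
      induction L₁ with
      | nil =>
        intro L₂ _ h₂ h
        cases L₂ with
        | nil => rfl
        | cons w L₂ =>
          have := (hmem w (h₂ w List.mem_cons_self)).1
          simp_all
      | cons v L₁ ih =>
        intro L₂ h₁ h₂ h
        obtain ⟨hv, y, t, ev⟩ := hmem v (h₁ v List.mem_cons_self)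
        cases L₂ with
        | nil => simp_all
        | cons w L₂ =>
          obtain ⟨-, y', t', ew⟩ := hmem w (h₂ w List.mem_cons_self)
          simp only [List.flatten_cons] at h
          obtain ⟨rfl, -, -⟩ := ev.unique ew h
          rw [ih L₂ (fun u hu => h₁ u (List.mem_cons_of_mem _ hu))
            (fun u hu => h₂ u (List.mem_cons_of_mem _ hu)) (List.append_cancel_left h)]
    have hkraft := InformationTheory.kraft_mcmillan_inequality hcode
    rw [Finset.sum_image fun r _ r' _ h => hinj h] at hkraft
    have h1 : ∑ r ∈ S, r.prob =
        ENNReal.ofReal (∑ r ∈ S, (1 / Fintype.card Bool : ℝ) ^ r.1.1.length) := by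
      rw [ENNReal.ofReal_sum_of_nonneg fun _ _ => by positivity]
      refine Finset.sum_congr rfl fun r _ => ?_
      rw [Run.prob, ENNReal.ofReal_pow (by positivity)]
      congr 1
      rw [Fintype.card_bool, one_div, ENNReal.ofReal_inv_of_pos (by norm_num)]
      simp
    rw [h1]
    exact ENNReal.ofReal_le_one.2 hkraft

theorem expect_eq_of_bijective {P : Prog} {F : Value → ℕ → ℝ≥0∞} (h : ℕ → ℕ → ℕ)
    (Φ : (Σ r : Run p x, Run q r.output) → Run P x) (hΦ : Function.Bijective Φ)
    (h₁ : ∀ r, (Φ r).1.1 = r.1.1.1 ++ r.2.1.1) (h₂ : ∀ r, (Φ r).output = r.2.output)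
    (h₃ : ∀ r, (Φ r).time = h r.1.time r.2.time) :
    P.expect x F = p.expect x fun y t => q.expect y fun z t' => F z (h t t') := by
  unfold expect
  rw [← (Equiv.ofBijective Φ hΦ).tsum_eq, ENNReal.tsum_sigma']
  congr 1 with r
  rw [← ENNReal.tsum_mul_left]
  congr 1 with r'
  simp only [Equiv.ofBijective_apply, h₂, h₃, Run.prob, h₁, List.length_append, pow_add]
  ring

theorem expect_seq (F : Value → ℕ → ℝ≥0∞) :
    (Prog.seq p q).expect x F =
      p.expect x fun y t => q.expect y fun z t' => F z (x.size + t + t') := by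
  refine expect_eq_of_bijective (fun t t' => x.size + t + t')
    (fun r => ⟨(r.1.1.1 ++ r.2.1.1, r.2.1.2.1, x.size + r.1.1.2.2 + r.2.1.2.2), .seq r.1.2 r.2.2⟩)
    ⟨?_, ?_⟩ (fun _ => rfl) (fun _ => rfl) (fun _ => rfl)
  · rintro ⟨⟨⟨s₁, y, t₁⟩, h₁⟩, ⟨⟨s₂, z, t₂⟩, h₂⟩⟩ ⟨⟨⟨s₁', y', t₁'⟩, h₁'⟩, ⟨⟨s₂', z', t₂'⟩, h₂'⟩⟩ h
    have hs : s₁ ++ s₂ = s₁' ++ s₂' := congrArg (fun r => r.1.1) h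
    obtain ⟨rfl, rfl, rfl⟩ := h₁.unique h₁' hs
    obtain rfl := List.append_cancel_left hs
    obtain ⟨-, rfl, rfl⟩ := h₂.unique (u := []) (u' := []) h₂' rfl
    rfl
  · rintro ⟨⟨s, z, t⟩, h⟩
    change Eval _ _ s z t at h
    cases h with
    | seq h₁ h₂ => exact ⟨⟨⟨(_, _, _), h₁⟩, ⟨(_, _, _), h₂⟩⟩, rfl⟩

theorem expect_while_step {a b : Value} {tc : ℕ} (hc : Eval c x [] (.cons a b) tc)
    (F : Value → ℕ → ℝ≥0∞) :
    (Prog.while c p).expect x F =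
      p.expect x fun y t => (Prog.while c p).expect y fun z t' => F z (x.size + tc + t + t') := by
  refine expect_eq_of_bijective (fun t t' => x.size + tc + t + t')
    (fun r => ⟨(r.1.1.1 ++ r.2.1.1, r.2.1.2.1, x.size + tc + r.1.1.2.2 + r.2.1.2.2),
      .while_step (s₁ := []) hc r.1.2 r.2.2⟩)
    ⟨?_, ?_⟩ (fun _ => rfl) (fun _ => rfl) (fun _ => rfl)
  · rintro ⟨⟨⟨s₁, y, t₁⟩, h₁⟩, ⟨⟨s₂, z, t₂⟩, h₂⟩⟩ ⟨⟨⟨s₁', y', t₁'⟩, h₁'⟩, ⟨⟨s₂', z', t₂'⟩, h₂'⟩⟩ h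
    have hs : s₁ ++ s₂ = s₁' ++ s₂' := congrArg (fun r => r.1.1) h
    obtain ⟨rfl, rfl, rfl⟩ := h₁.unique h₁' hs
    obtain rfl := List.append_cancel_left hs
    obtain ⟨-, rfl, rfl⟩ := h₂.unique (u := []) (u' := []) h₂' rfl
    rfl
  · rintro ⟨⟨s, z, t⟩, h⟩
    change Eval _ _ s z t at h
    cases h with
    | while_stop h₁ =>
      obtain ⟨-, e, -⟩ := hc.unique h₁ (u := s) (u' := []) (by simp)
      cases e
    | while_step h₁ h₂ h₃ =>
      obtain ⟨rfl, e, rfl⟩ := hc.unique h₁ (u' := []) (by simp; rfl)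
      exact ⟨⟨⟨(_, _, _), h₂⟩, ⟨(_, _, _), h₃⟩⟩, rfl⟩

/-- A program that always tosses `k` coins. -/
theorem expect_of_eval_vector {k : ℕ} {f : List.Vector Bool k → Value} {t : List.Vector Bool k → ℕ}
    (h : ∀ v : List.Vector Bool k, Eval p x v.toList (f v) (t v)) (F : Value → ℕ → ℝ≥0∞) :
    p.expect x F = ∑ v, (2⁻¹ : ℝ≥0∞) ^ k * F (f v) (t v) := by
  have hbij : Function.Bijective
      (fun v : List.Vector Bool k => (⟨(v.toList, f v, t v), h v⟩ : Run p x)) := by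
    refine ⟨fun v w hvw => ?_, ?_⟩
    · simp only [Subtype.mk.injEq, Prod.mk.injEq] at hvw
      exact List.Vector.toList_injective hvw.1
    · rintro ⟨⟨s, y, u⟩, hs⟩
      let v : List.Vector Bool k := ⟨(s ++ List.replicate k false).take k, by simp⟩
      obtain ⟨h1, h2, h3⟩ := (h v).unique hs (u' := List.replicate k false)
        (List.take_append_drop k (s ++ List.replicate k false))
      exact ⟨v, Subtype.ext (Prod.ext h1 (Prod.ext h2 h3))⟩
  refine ((Equiv.ofBijective _ hbij).tsum_eq
    fun r : Run p x => r.prob * F r.output r.time).symm.trans ?_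
  rw [tsum_fintype]
  refine Finset.sum_congr rfl fun v _ => ?_
  simp [Run.prob, Run.output, Run.time]

theorem expect_of_eval {y : Value} {t : ℕ} (h : Eval p x [] y t) (F : Value → ℕ → ℝ≥0∞) :
    p.expect x F = F y t := by
  rw [expect_of_eval_vector (k := 0) (f := fun _ => y) (t := fun _ => t)
    (fun v => by simpa [List.Vector.eq_nil v] using h)]
  simp

theorem expect_while_stop {tc : ℕ} (hc : Eval c x [] .nil tc) (F : Value → ℕ → ℝ≥0∞) :
    (Prog.while c p).expect x F = F x (x.size + tc) :=
  expect_of_eval (Eval.while_stop hc) F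

end Prog

theorem ofDigits_injective {k : ℕ} : ∀ {l l' : List Bool} {n n' : ℕ}, l.length = k →
    l'.length = k → ofDigits n l = ofDigits n' l' → n = n' ∧ l = l' := by
  induction k with
  | zero =>
    intro l l' n n' hl hl' h
    obtain rfl := List.length_eq_zero_iff.1 hl
    obtain rfl := List.length_eq_zero_iff.1 hl'
    exact ⟨h, rfl⟩
  | succ k ih =>
    intro l l' n n' hl hl' h
    obtain _ | ⟨b, l⟩ := l
    · simp at hl
    obtain _ | ⟨b', l'⟩ := l'
    · simp at hl'
    obtain ⟨h1, rfl⟩ := ih (Nat.succ_injective hl) (Nat.succ_injective hl')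
      (by simpa only [ofDigits_cons] using h)
    cases b <;> cases b' <;> simp [Nat.bit] at h1 ⊢ <;> omega

/-- A uniformly random list of `k` digits is a uniformly random number below `2 ^ k`. -/
theorem sum_ofDigits (k : ℕ) (φ : ℕ → ℝ≥0∞) :
    ∑ v : List.Vector Bool k, φ (ofDigits 0 v.toList) = ∑ r ∈ Finset.range (2 ^ k), φ r := by
  have hlt : ∀ v : List.Vector Bool k, ofDigits 0 v.toList < 2 ^ k := fun v => by
    simpa using ofDigits_lt v.toList 0
  have hbij : Function.Bijective
      (fun v : List.Vector Bool k => (⟨ofDigits 0 v.toList, hlt v⟩ : Fin (2 ^ k))) := by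
    rw [Fintype.bijective_iff_injective_and_card]
    refine ⟨fun v w h => ?_, by simp [card_vector]⟩
    exact List.Vector.toList_injective
      (ofDigits_injective v.toList_length w.toList_length (Fin.mk.inj_iff.1 h)).2
  rw [← Fin.sum_univ_eq_sum_range]
  exact (Equiv.ofBijective _ hbij).sum_comp fun r : Fin (2 ^ k) => φ r

/-! ### Rejection sampling -/

/-- Each round of the loop `while c body`, started in the state `x`, tosses `k` coins, which give
a uniformly random number `r < 2 ^ k`; if `r < N`, the loop is left in the state `y r`, otherwise
the round is repeated. All steps of a round take time at most `T`. -/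
structure RejectionLoop (c body : Prog) (x : Value) (k N T : ℕ) (y : ℕ → Value) : Prop where
  pos : 0 < N
  le : N ≤ 2 ^ k
  size_le : x.size ≤ T
  continues : ∃ a b, ∃ t ≤ T, Eval c x [] (.cons a b) t
  round : ∀ s : List Bool, s.length = k → ∃ t ≤ T,
    Eval body x s (if ofDigits 0 s < N then y (ofDigits 0 s) else x) t
  size_out_le : ∀ r < N, (y r).size ≤ T
  exits : ∀ r < N, ∃ t ≤ T, Eval c (y r) [] .nil t

namespace RejectionLoop

variable {c body : Prog} {x : Value} {k N T : ℕ} {y : ℕ → Value}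

theorem sum_split (hN : N ≤ 2 ^ k) (f g : ℕ → ℝ≥0∞) :
    ∑ r ∈ Finset.range (2 ^ k), (if r < N then f r else g r) =
      ∑ r ∈ Finset.range N, f r + ∑ r ∈ Finset.Ico N (2 ^ k), g r := by
  rw [← Finset.sum_range_add_sum_Ico _ hN]
  congr 1
  · exact Finset.sum_congr rfl fun r hr => if_pos (Finset.mem_range.1 hr)
  · exact Finset.sum_congr rfl fun r hr => if_neg (not_lt.2 (Finset.mem_Ico.1 hr).1)

/-- One round of the loop: bounds on the expectation follow from bounds for each outcome. -/
theorem expect_eq (h : RejectionLoop c body x k N T y) (F : Value → ℕ → ℝ≥0∞) :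
    ∃ (τ : List.Vector Bool k → ℕ) (u : ℕ → ℕ), (∀ v, 1 ≤ τ v ∧ τ v ≤ 3 * T) ∧
      (∀ r < N, u r ≤ 2 * T) ∧
      (Prog.while c body).expect x F = ∑ v : List.Vector Bool k, (2⁻¹ : ℝ≥0∞) ^ k *
        if ofDigits 0 v.toList < N then
          F (y (ofDigits 0 v.toList)) (τ v + u (ofDigits 0 v.toList))
        else (Prog.while c body).expect x fun z t => F z (τ v + t) := by
  obtain ⟨a, b, tc, htc, hc⟩ := h.continues
  have hx := h.size_le
  choose! t ht hb using h.round
  choose! u hu hs using h.exits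
  refine ⟨fun v => x.size + tc + t v.toList, fun r => (y r).size + u r, fun v => ?_, fun r hr => ?_,
    ?_⟩
  · have := ht v.toList (by simp)
    have := x.one_le_size
    dsimp only
    omega
  · have := h.size_out_le r hr
    have := hu r hr
    dsimp only
    omega
  · rw [Prog.expect_while_step hc, Prog.expect_of_eval_vector
      (fun v : List.Vector Bool k => hb v.toList (by simp))]
    refine Finset.sum_congr rfl fun v _ => ?_
    congr 1
    split_ifs with hlt
    · rw [Prog.expect_while_stop (hs _ hlt)]
    · rfl

theorem inv_two_pow_mul (k : ℕ) : (2⁻¹ : ℝ≥0∞) ^ k * 2 ^ k = 1 := by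
  rw [← mul_pow, ENNReal.inv_mul_cancel (by simp) (by simp), one_pow]

theorem expect_le (h : RejectionLoop c body x k N T y) (g : Value → ℝ≥0∞) (κ : ℝ≥0∞) :
    ((Prog.while c body).expect x fun z t => g z + κ * t) ≤
      (2 ^ k / N) * (∑ r ∈ Finset.range N, (2⁻¹ : ℝ≥0∞) ^ k * g (y r) + κ * (5 * T)) := by
  set W := Prog.while c body
  set A := ∑ r ∈ Finset.range N, (2⁻¹ : ℝ≥0∞) ^ k * g (y r)
  set B := (2 ^ k / N : ℝ≥0∞) * (A + κ * (5 * T))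
  have hN0 : (N : ℝ≥0∞) ≠ 0 := by exact_mod_cast h.pos.ne'
  -- `B` solves the equation of the expectation, `B = A + 5 κ T + q B`, where `q` is the
  -- probability of a rejection.
  have hB : (A + κ * (5 * T)) + ∑ r ∈ Finset.Ico N (2 ^ k), (2⁻¹ : ℝ≥0∞) ^ k * B = B := by
    have h1 : A + κ * (5 * T) = ∑ r ∈ Finset.range N, (2⁻¹ : ℝ≥0∞) ^ k * B := by
      rw [Finset.sum_const, Finset.card_range, nsmul_eq_mul]
      simp only [B, div_eq_mul_inv]
      rw [show (N : ℝ≥0∞) * (2⁻¹ ^ k * (2 ^ k * (N : ℝ≥0∞)⁻¹ * (A + κ * (5 * T)))) =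
        (2⁻¹ ^ k * 2 ^ k) * ((N : ℝ≥0∞) * (N : ℝ≥0∞)⁻¹) * (A + κ * (5 * T)) by ring,
        inv_two_pow_mul, ENNReal.mul_inv_cancel hN0 (by simp)]
      simp
    rw [h1, Finset.sum_range_add_sum_Ico _ h.le, Finset.sum_const, Finset.card_range,
      nsmul_eq_mul, ← mul_assoc]
    push_cast
    rw [mul_comm (2 ^ k : ℝ≥0∞), inv_two_pow_mul, one_mul]
  -- Runs of bounded length, by induction on the bound.
  have key : ∀ n : ℕ, (W.expect x fun z t => if t ≤ n then g z + κ * t else 0) ≤ B := by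
    intro n
    induction n with
    | zero =>
      refine le_of_eq_of_le ?_ zero_le
      refine ENNReal.tsum_eq_zero.2 fun r => ?_
      have : 1 ≤ r.time := r.2.one_le_time
      dsimp only
      rw [if_neg (by omega), mul_zero]
    | succ n ih =>
      obtain ⟨τ, u, hτ, hu, he⟩ := h.expect_eq fun z t => if t ≤ n + 1 then g z + κ * t else 0
      rw [he]
      calc _ ≤ ∑ v : List.Vector Bool k, (2⁻¹ : ℝ≥0∞) ^ k * (κ * (5 * T) +
            if ofDigits 0 v.toList < N then g (y (ofDigits 0 v.toList)) else B) := by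
            gcongr with v
            have h1 := hτ v
            split_ifs with h2 h3
            · have h4 := hu _ h2
              rw [add_comm]
              gcongr
              have : τ v + u (ofDigits 0 v.toList) ≤ 5 * T := by omega
              exact_mod_cast this
            · exact zero_le
            · calc _ ≤ W.expect x fun z t => κ * (5 * T) + if t ≤ n then g z + κ * t else 0 := by
                    refine Prog.expect_mono fun s z t _ => ?_
                    by_cases h4 : τ v + t ≤ n + 1
                    · rw [if_pos h4, if_pos (by omega), ← add_assoc, add_comm (κ * (5 * T)),
                        add_assoc, ← mul_add]
                      gcongr
                      have : τ v + t ≤ 5 * T + t := by omega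
                      exact_mod_cast this
                    · rw [if_neg h4]; exact zero_le
                _ ≤ κ * (5 * T) + B := by
                    rw [Prog.expect_add, Prog.expect_const]
                    refine add_le_add ?_ ih
                    exact mul_le_of_le_one_right zero_le Prog.haltProb_le_one
        _ = B := by
            simp only [mul_add, Finset.sum_add_distrib]
            rw [Finset.sum_const, Finset.card_univ, card_vector, Fintype.card_bool, nsmul_eq_mul,
              ← mul_assoc]
            push_cast
            rw [mul_comm (2 ^ k : ℝ≥0∞), inv_two_pow_mul, one_mul,
              sum_ofDigits k fun r => (2⁻¹ : ℝ≥0∞) ^ k * if r < N then g (y r) else B]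
            simp only [mul_ite]
            rw [sum_split h.le, ← add_assoc, add_comm (κ * (5 * T))]
            exact hB
  -- Monotone convergence.
  unfold Prog.expect at key ⊢
  rw [ENNReal.tsum_eq_iSup_sum]
  refine iSup_le fun S => ?_
  refine le_trans ?_ (key (S.sup fun r => r.time))
  refine le_trans ?_ (ENNReal.sum_le_tsum S)
  refine Finset.sum_le_sum fun r hr => ?_
  dsimp only
  rw [if_pos (Finset.le_sup (f := fun r : Prog.Run W x => r.time) hr)]

theorem expect_time_le (h : RejectionLoop c body x k N T y) :
    ((Prog.while c body).expect x fun _ t => t) ≤ 2 ^ k / N * (5 * T) := by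
  simpa using h.expect_le (fun _ => 0) 1

/-- The loop is left in the state `y r`, where `r < N` is uniformly random. -/
theorem expect_output (h : RejectionLoop c body x k N T y) (g : Value → ℝ≥0∞)
    (hg : ∀ r < N, g (y r) ≠ ⊤) :
    ((Prog.while c body).expect x fun z _ => g z) =
      ∑ r ∈ Finset.range N, (N : ℝ≥0∞)⁻¹ * g (y r) := by
  set e := (Prog.while c body).expect x fun z _ => g z with he
  have hN0 : (N : ℝ≥0∞) ≠ 0 := by exact_mod_cast h.pos.ne'
  set A := ∑ r ∈ Finset.range N, (2⁻¹ : ℝ≥0∞) ^ k * g (y r) with hA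
  have hA' : A ≠ ⊤ := by
    refine ENNReal.sum_ne_top.2 fun r hr => ENNReal.mul_ne_top (by simp) (hg r ?_)
    exact Finset.mem_range.1 hr
  have hfin : e ≠ ⊤ := by
    have h1 := h.expect_le g 0
    simp only [zero_mul, add_zero] at h1
    refine ne_top_of_le_ne_top (ENNReal.mul_ne_top (ENNReal.div_ne_top (by simp) hN0) hA') h1
  have h1 : e = A + ∑ r ∈ Finset.Ico N (2 ^ k), (2⁻¹ : ℝ≥0∞) ^ k * e := by
    obtain ⟨τ, u, -, -, h2⟩ := h.expect_eq fun z _ => g z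
    conv_lhs => rw [he, h2]
    simp only [← he]
    rw [sum_ofDigits k fun r => (2⁻¹ : ℝ≥0∞) ^ k * if r < N then g (y r) else e]
    simp only [mul_ite]
    rw [sum_split h.le]
  have h2 : e = ∑ r ∈ Finset.range N, (2⁻¹ : ℝ≥0∞) ^ k * e +
      ∑ r ∈ Finset.Ico N (2 ^ k), (2⁻¹ : ℝ≥0∞) ^ k * e := by
    rw [Finset.sum_range_add_sum_Ico _ h.le, Finset.sum_const, Finset.card_range,
      nsmul_eq_mul, ← mul_assoc]
    push_cast
    rw [mul_comm (2 ^ k : ℝ≥0∞), inv_two_pow_mul, one_mul]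
  have h3 : A = ∑ r ∈ Finset.range N, (2⁻¹ : ℝ≥0∞) ^ k * e := by
    refine (ENNReal.add_left_inj ?_).1 (h1.symm.trans h2)
    exact ENNReal.sum_ne_top.2 fun r _ => ENNReal.mul_ne_top (by simp) hfin
  rw [hA, ← Finset.mul_sum, Finset.sum_const, Finset.card_range, nsmul_eq_mul,
    show (N : ℝ≥0∞) * (2⁻¹ ^ k * e) = 2⁻¹ ^ k * (N * e) by ring] at h3
  rw [ENNReal.mul_right_inj (by simp) (by simp)] at h3
  rw [← Finset.mul_sum, h3, ← mul_assoc, ENNReal.inv_mul_cancel hN0 (by simp), one_mul]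

end RejectionLoop

/-! ### Sampling from a weighted list -/

/-- The search for the item of a weighted list at position `s.2`, counted with weights: the first
component is the item, once it is found, and the second one is the remaining distance. -/
def pickStep (s : Option Value × ℕ) (c : ℕ × Value) : Option Value × ℕ :=
  if s.1 ≠ none then s else if s.2 < c.1 then (some c.2, s.2) else (none, s.2 - c.1)

/-- The item of the weighted list `l` at position `r`, if every item occupies as many consecutive
positions as its weight says. -/
def pick (l : List (ℕ × Value)) (r : ℕ) : Option Value := (l.foldl pickStep (none, r)).1

theorem foldl_pickStep_some (l : List (ℕ × Value)) (v : Value) (r : ℕ) :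
    l.foldl pickStep (some v, r) = (some v, r) := by
  induction l with
  | nil => rfl
  | cons c l ih => simpa [pickStep] using ih

theorem pick_nil (r : ℕ) : pick [] r = none := rfl

theorem pick_cons (c : ℕ × Value) (l : List (ℕ × Value)) (r : ℕ) :
    pick (c :: l) r = if r < c.1 then some c.2 else pick l (r - c.1) := by
  unfold pick
  rw [List.foldl_cons]
  by_cases h : r < c.1
  · simp [pickStep, h, foldl_pickStep_some]
  · simp [pickStep, h]

theorem pick_eq_none_iff (l : List (ℕ × Value)) (r : ℕ) :
    pick l r = none ↔ (l.map Prod.fst).sum ≤ r := by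
  induction l generalizing r with
  | nil => simp [pick_nil]
  | cons c l ih =>
    rw [pick_cons]
    split_ifs with h
    · simp; omega
    · rw [ih]; simp; omega

theorem exists_mem_of_pick {l : List (ℕ × Value)} {r : ℕ} {v : Value} (h : pick l r = some v) :
    ∃ w, 0 < w ∧ (w, v) ∈ l := by
  induction l generalizing r with
  | nil => simp [pick_nil] at h
  | cons c l ih =>
    rw [pick_cons] at h
    split_ifs at h with h1
    · obtain rfl : c.2 = v := by simpa using h
      exact ⟨c.1, by omega, List.mem_cons_self⟩
    · obtain ⟨w, hw, hm⟩ := ih h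
      exact ⟨w, hw, List.mem_cons_of_mem _ hm⟩

theorem sum_pick (l : List (ℕ × Value)) (g : Value → ℝ≥0∞) :
    ∑ r ∈ Finset.range (l.map Prod.fst).sum, g ((pick l r).getD .nil) =
      (l.map fun c => c.1 * g c.2).sum := by
  induction l with
  | nil => simp
  | cons c l ih =>
    rw [List.map_cons, List.sum_cons, Finset.sum_range_add, List.map_cons, List.sum_cons, ← ih]
    congr 1
    · rw [Finset.sum_congr rfl (g := fun _ => g c.2)]
      · simp
      · intro r hr
        rw [pick_cons, if_pos (Finset.mem_range.1 hr)]
        rfl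
    · refine Finset.sum_congr rfl fun r _ => ?_
      rw [pick_cons, if_neg (by omega), Nat.add_sub_cancel_left]

theorem PolyTime.pick {Γ : Type*} [Enc Γ] {l : Γ → List (ℕ × Value)} {r : Γ → ℕ} (hl : PolyTime l)
    (hr : PolyTime r) : PolyTime fun x => pick (l x) (r x) := by
  have h0 : PolyTime fun y : Γ × (Option Value × ℕ) × (ℕ × Value) => y := .id
  have hstep : PolyTime fun y : Γ × (Option Value × ℕ) × (ℕ × Value) => pickStep y.2.1 y.2.2 := by
    refine .ite_nil h0.snd.fst.fst h0.snd.fst (.ite (.lt h0.snd.fst.snd h0.snd.snd.fst) ?_ ?_)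
      fun y => ?_
    · exact (((const Value.nil).pair h0.snd.snd.snd).congr_enc
        (g := fun y => some y.2.2.2) fun y => rfl).pair h0.snd.fst.snd
    · exact (const none).pair (h0.snd.fst.snd.sub h0.snd.snd.fst)
    · cases y.2.1.1 <;> simp [enc]
  refine (foldl (init := fun x => (none, r x)) (step := fun _ => pickStep)
    (b := fun x => (sz (l x) + 2) + (4 * sz (r x) + 1) + 1) hl ((const none).pair hr) hstep
    (((hl.polyBdd_sz.add (.const 2)).add ((hr.polyBdd_sz.const_mul 4).add (.const 1))).add
      (.const 1)) fun x l₁ hl₁ => ?_).fst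
  have h1 : ∀ (l : List (ℕ × Value)) (r : ℕ), (l.foldl pickStep (none, r)).2 ≤ r := by
    intro l
    induction l with
    | nil => simp
    | cons c l ih =>
      intro r
      rw [List.foldl_cons]
      by_cases h : r < c.1
      · simp [pickStep, h, foldl_pickStep_some]
      · simpa [pickStep, h] using (ih (r - c.1)).trans (Nat.sub_le _ _)
  have h2 := sz_nat_le ((h1 l₁ (r x)).trans_lt (lt_two_pow_sz _))
  have h3 : sz (l₁.foldl pickStep (none, r x)).1 ≤ sz (l x) + 2 := by
    cases h : (l₁.foldl pickStep (none, r x)).1 with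
    | none => simp [sz, enc, Value.size]
    | some v =>
      obtain ⟨w, -, hm⟩ := exists_mem_of_pick h
      have h4 := sz_lt_of_mem (hl₁.subset hm)
      rw [sz_pair] at h4
      simp only [sz, enc, Value.size, Option.elim] at *
      omega
  rw [← Prod.mk.eta (p := l₁.foldl pickStep (none, r x)), sz_pair]
  omega

/-- The states of the sampling loop that is to continue: a flag that says so, the sum of the
weights, and the weighted list. -/
abbrev LoopState : Type := Bool × ℕ × List (ℕ × Value)

/-- The next state of the sampling loop, for the given coin tosses. The loop stops in a state with
left subtree `nil`, and the right subtree is the sampled item. -/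
def nextState (y : List Bool × LoopState) : Value :=
  match pick y.2.2.2 (ofDigits 0 y.1.reverse) with
  | none => enc y.2
  | some v => .cons .nil v

theorem polyTime_nextState : PolyTime nextState := by
  have h0 : PolyTime fun y : List Bool × LoopState => y := .id
  have h1 := h0.snd.snd.snd.pick ((PolyTime.const 0).ofDigits h0.fst.reverse)
  refine (PolyTime.ite_nil (P := fun y => pick y.2.2.2 (ofDigits 0 y.1.reverse) ≠ none)
    (f := fun y => enc (pick y.2.2.2 (ofDigits 0 y.1.reverse))) (g := fun y => enc y.2) h1
    (h1.congr_enc fun _ => rfl) (h0.snd.congr_enc fun _ => rfl) fun y => ?_).congr fun y => ?_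
  · cases pick y.2.2.2 (ofDigits 0 y.1.reverse) <;> simp [enc]
  · unfold nextState
    cases pick y.2.2.2 (ofDigits 0 y.1.reverse) <;> simp [enc]

/-- A loop that tosses one coin for each entry of a list. -/
def flipLoop : Prog := .while .fst (.pair (.seq .fst .snd) (.pair .flip .snd))

theorem eval_flipLoop (cs : List Bool) : ∀ (out s : List Bool) (S : ℕ), s.length = cs.length →
    sz cs + sz out + 1 + 4 * cs.length ≤ S → ∃ t ≤ (cs.length + 1) * (9 * S),
    Eval flipLoop (enc (cs, out)) s (enc (([] : List Bool), s.reverse ++ out)) t := by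
  induction cs with
  | nil =>
    intro out s S hs hS
    obtain rfl := List.length_eq_zero_iff.1 hs
    refine ⟨_, ?_, Eval.while_stop (.fst (enc (([] : List Bool), out)))⟩
    have h1 : (enc (([] : List Bool), out)).size = sz ([] : List Bool) + sz out + 1 := rfl
    simp only [List.length_nil] at hS ⊢
    omega
  | cons c cs ih =>
    intro out s S hs hS
    obtain _ | ⟨b, s⟩ := s
    · simp at hs
    have h2 := sz_bool_le b
    have h3 := one_le_sz c
    rw [sz_cons, List.length_cons] at hS
    obtain ⟨t, ht, h⟩ := ih (b :: out) s S (by simpa using hs) (by rw [sz_cons]; omega)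
    have h1 : (enc (c :: cs, out)).size = sz (c :: cs) + sz out + 1 := rfl
    have hbody : Eval (.pair (.seq .fst .snd) (.pair .flip .snd)) (enc (c :: cs, out)) [b]
        (enc (cs, b :: out)) _ :=
      .pair (s₁ := []) (s₂ := [b] ++ []) (.seq (.fst _) (.snd (enc (c :: cs))))
        (.pair (.flip _ b) (.snd _))
    have hstep := Eval.while_step (.fst (enc (c :: cs, out))) hbody h
    have h5 : [] ++ ([b] ++ s) = b :: s := rfl
    have h6 : s.reverse ++ b :: out = (b :: s).reverse ++ out := by simp
    rw [h5, h6] at hstep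
    refine ⟨_, ?_, hstep⟩
    have h4 : (enc (c :: cs, out)).fst.size = sz (c :: cs) := rfl
    have h7 : (enc (c :: cs)).size = sz (c :: cs) := rfl
    rw [sz_cons] at h1 h4 h7
    simp only [List.length_cons, add_mul] at ht ⊢
    omega

/-- One round of the sampling loop: as many coin tosses as the sum of the weights has binary
digits, followed by the computation of the next state by the program `q`. -/
def roundProg (q : Prog) : Prog :=
  .seq (.pair (.seq (.seq .snd .fst) (.seq (.pair .id (.const .nil)) (.seq flipLoop .snd))) .id) q

/-- The value with which the sampling loop is left. -/
def pickedState (ws : List (ℕ × Value)) (r : ℕ) : Value := .cons .nil ((pick ws r).getD .nil)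

theorem exists_rejectionLoop : ∃ (body : Prog) (T : LoopState → ℕ), PolyBdd T ∧
    ∀ ws : List (ℕ × Value), 0 < (ws.map Prod.fst).sum →
      RejectionLoop .fst body (enc ((true, (ws.map Prod.fst).sum, ws) : LoopState))
        (ws.map Prod.fst).sum.bits.length (ws.map Prod.fst).sum
        (T (true, (ws.map Prod.fst).sum, ws)) (pickedState ws) := by
  obtain ⟨q, tq, ⟨Q, hQ⟩, hq⟩ := polyTime_nextState
  let T : LoopState → ℕ := fun x =>
    (40 * sz x + (sz x + 1) * (9 * (6 * sz x))) + Q.eval (5 * sz x + sz x + 2)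
  refine ⟨roundProg q, T, ?_, fun ws hpos => ?_⟩
  · exact ((PolyBdd.sz.const_mul 40).add ((PolyBdd.sz.add (.const 1)).mul
      ((PolyBdd.sz.const_mul 6).const_mul 9))).add
      ((((PolyBdd.sz.const_mul 5).add .sz).add (.const 2)).eval Q)
  set N := (ws.map Prod.fst).sum with hN
  set x : LoopState := (true, N, ws) with hx
  have hx1 : sz x = sz true + (sz N + sz ws + 1) + 1 := rfl
  have hx2 : (enc x).size = sz x := rfl
  have hlen : N.bits.length < sz N := length_lt_sz N.bits
  have hout : ∀ r < N, (pickedState ws r).size ≤ sz x := by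
    intro r hr
    cases h : pick ws r with
    | none =>
      rw [pick_eq_none_iff] at h
      omega
    | some v =>
      obtain ⟨w, -, hm⟩ := exists_mem_of_pick h
      have h4 := sz_lt_of_mem hm
      rw [sz_pair] at h4
      have h5 : sz v = v.size := rfl
      simp only [pickedState, h, Option.getD, Value.size]
      omega
  refine ⟨hpos, ?_, ?_, ⟨_, _, _, ?_, .fst (enc x)⟩, fun s hs => ?_, fun r hr => ?_,
    fun r hr => ⟨_, ?_, .fst (pickedState ws r)⟩⟩
  · simpa [ofDigits_reverse_bits] using (ofDigits_lt N.bits.reverse 0).le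
  · simp only [T]; omega
  · simp only [T]; omega
  · obtain ⟨t, ht, he⟩ := eval_flipLoop N.bits [] s (6 * sz x) hs (by
      have : sz N.bits = sz N := rfl
      rw [sz_nil]; omega)
    rw [List.append_nil] at he
    have hs1 : sz s.reverse ≤ 5 * sz x := by
      have h1 := sz_le_length_mul (l := s) (k := 3) fun b _ => sz_bool_le b
      rw [sz_reverse]
      omega
    have he2 : Eval q (enc (s.reverse, x)) []
        (if ofDigits 0 s < N then pickedState ws (ofDigits 0 s) else enc x)
        (tq (s.reverse, x)) := by
      have h1 := hq (s.reverse, x)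
      have h2 : nextState (s.reverse, x) =
          if ofDigits 0 s < N then pickedState ws (ofDigits 0 s) else enc x := by
        unfold nextState pickedState
        rw [List.reverse_reverse]
        change (match pick ws (ofDigits 0 s) with
          | none => enc x
          | some v => .cons .nil v) = _
        cases h : pick ws (ofDigits 0 s) with
        | none => rw [if_neg (not_lt.2 ((pick_eq_none_iff _ _).1 h))]
        | some v =>
          rw [if_pos (lt_of_not_ge fun hle => by
            rw [(pick_eq_none_iff _ _).2 hle] at h; cases h)]
          rfl
      rw [h2] at h1
      exact h1
    have he1 := Eval.pair (Eval.seq (.seq (.snd (enc x)) (.fst _))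
      (.seq (.pair (.id _) (.const .nil _)) (.seq he (.snd _)))) (.id (enc x))
    simp only [List.append_nil, List.nil_append] at he1
    have he3 := Eval.seq he1 he2
    rw [List.append_nil] at he3
    refine ⟨_, ?_, he3⟩
    have h1 : (enc x).snd.size = sz N + sz ws + 1 := rfl
    have h2 : (enc x).snd.fst.size = sz N := rfl
    have h3 : (Value.cons (enc x).snd.fst .nil).size = sz N + 1 + 1 := rfl
    have h4 : (enc (([] : List Bool), s.reverse)).size = 1 + sz s.reverse + 1 := rfl
    have h5 : (Value.nil).size = 1 := rfl
    have h6 : tq (s.reverse, x) ≤ Q.eval (5 * sz x + sz x + 2) :=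
      (hQ _).trans (eval_mono_nat Q (by rw [sz_pair]; omega))
    have h7 : t ≤ (sz x + 1) * (9 * (6 * sz x)) :=
      ht.trans (Nat.mul_le_mul_right _ (by omega))
    simp only [T]
    omega
  · exact (hout r hr).trans (by simp only [T]; omega)
  · exact (hout r hr).trans (by simp only [T]; omega)

/-- Sampling in polynomial time: a fixed program `U` samples the weighted list that it reads, and
`p` is applied to the sampled item. -/
theorem exists_sampler (p : Prog) : ∃ (U : Prog) (T : LoopState → ℕ), PolyBdd T ∧
    ∀ (ws : List (ℕ × Value)) (x : LoopState) (B : ℕ), x = (true, (ws.map Prod.fst).sum, ws) →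
      0 < x.2.1 → (∀ c ∈ ws, 0 < c.1 → p.expectedTime c.2 ≤ B) →
      (Prog.seq (.const (enc x)) (.seq U p)).expectedTime .nil ≤ (T x + B : ℕ) ∧
      ∀ y, (Prog.seq (.const (enc x)) (.seq U p)).outProb .nil y =
        (x.2.1 : ℝ≥0∞)⁻¹ * (ws.map fun c => c.1 * p.outProb c.2 y).sum := by
  classical
  obtain ⟨body, T, hT, h⟩ := exists_rejectionLoop
  refine ⟨.seq (.while .fst body) .snd, fun x => 40 * T x + (4 * sz x + 10), ?_,
    fun ws x B hx hpos hB => ?_⟩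
  · exact (hT.const_mul 40).add ((PolyBdd.sz.const_mul 4).add (.const 10))
  subst hx
  set x : LoopState := (true, (ws.map Prod.fst).sum, ws)
  set N := (ws.map Prod.fst).sum with hN
  change 0 < N at hpos
  change _ ∧ ∀ y, _ = (N : ℝ≥0∞)⁻¹ * _
  have hW := h ws hpos
  set W : Prog := .while .fst body
  have hpick : ∀ r < N, ∀ g : Value → ℝ≥0∞, (∀ c ∈ ws, 0 < c.1 → g c.2 ≠ ⊤) →
      g ((pick ws r).getD .nil) ≠ ⊤ := by
    intro r hr g hg
    cases hp : pick ws r with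
    | none => rw [pick_eq_none_iff] at hp; omega
    | some v =>
      obtain ⟨w, hw, hm⟩ := exists_mem_of_pick hp
      exact hg _ hm hw
  -- The distribution of the item that is sampled.
  have hout : ∀ g : Value → ℝ≥0∞, (∀ c ∈ ws, 0 < c.1 → g c.2 ≠ ⊤) →
      (W.expect (enc x) fun z _ => g z.snd) =
        (N : ℝ≥0∞)⁻¹ * (ws.map fun c => c.1 * g c.2).sum := by
    intro g hg
    rw [hW.expect_output (fun z => g z.snd) fun r hr => hpick r hr g hg, ← sum_pick,
      Finset.mul_sum]
    rfl
  have hseq : ∀ F : Value → ℕ → ℝ≥0∞,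
      (Prog.seq (.const (enc x)) (.seq (.seq W .snd) p)).expect .nil F =
      W.expect (enc x) fun z t => p.expect z.snd fun y t' =>
        F y (1 + (1 + sz x) + (sz x + (sz x + t + z.size) + t')) := by
    intro F
    rw [Prog.expect_seq, Prog.expect_of_eval (.const _ _), Prog.expect_seq, Prog.expect_seq]
    congr 1
    funext z t
    rw [Prog.expect_of_eval (.snd z)]
    rfl
  have hfin : ∀ c ∈ ws, 0 < c.1 → p.expectedTime c.2 < ⊤ := fun c hc hw =>
    (hB c hc hw).trans_lt (by simp)
  have hsum : (N : ℝ≥0∞)⁻¹ * (ws.map fun c => (c.1 : ℝ≥0∞)).sum = 1 := by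
    have : (ws.map fun c => (c.1 : ℝ≥0∞)).sum = N := by
      rw [hN, Nat.cast_list_sum, List.map_map]
      rfl
    rw [this, ENNReal.inv_mul_cancel (by exact_mod_cast hpos.ne') (by simp)]
  have hhalt : 1 ≤ (Prog.seq (.const (enc x)) (.seq (.seq W .snd) p)).haltProb .nil := by
    rw [Prog.haltProb_eq_expect, hseq]
    simp only [← Prog.haltProb_eq_expect]
    rw [hout (fun v => p.haltProb v) fun c hc hw =>
      ne_top_of_le_ne_top ENNReal.one_ne_top Prog.haltProb_le_one, ← hsum]
    gcongr
    refine List.sum_le_sum fun c hc => ?_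
    by_cases hw : 0 < c.1
    · exact le_mul_of_one_le_right zero_le (Prog.one_le_haltProb (hfin c hc hw))
    · simp [Nat.eq_zero_of_not_pos hw]
  constructor
  · rw [Prog.expectedTime_of_one_le hhalt, hseq]
    calc _ ≤ W.expect (enc x) fun z t => (((4 * sz x + 10 : ℕ) : ℝ≥0∞) + 4 * t) +
          p.expectedTime z.snd := by
          refine Prog.expect_mono fun s z t hz => ?_
          have h1 := hz.size_le
          calc _ ≤ p.expect z.snd fun y t' => ((4 * sz x + 10 + 4 * t : ℕ) : ℝ≥0∞) + t' := by
                refine Prog.expect_mono fun _ y t' _ => ?_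
                norm_cast
                omega
            _ ≤ _ := by
                rw [Prog.expect_add, Prog.expect_const]
                refine add_le_add ((mul_le_of_le_one_right zero_le
                  Prog.haltProb_le_one).trans (by push_cast; exact le_rfl)) Prog.expect_time_le
      _ ≤ _ := by
          rw [Prog.expect_add, Prog.expect_add, Prog.expect_const, Prog.expect_const_mul,
            hout (fun v => p.expectedTime v) fun c hc hw => (hfin c hc hw).ne]
          have h1 : (N : ℝ≥0∞)⁻¹ * (ws.map fun c => (c.1 : ℝ≥0∞) * p.expectedTime c.2).sum ≤ B := by
            calc _ ≤ (N : ℝ≥0∞)⁻¹ * (ws.map fun c => (c.1 : ℝ≥0∞) * B).sum := by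
                  gcongr
                  refine List.sum_le_sum fun c hc => ?_
                  by_cases hw : 0 < c.1
                  · gcongr; exact hB c hc hw
                  · simp [Nat.eq_zero_of_not_pos hw]
              _ = B := by rw [List.sum_map_mul_right, ← mul_assoc, hsum, one_mul]
          have h2 : (2 ^ N.bits.length / N : ℝ≥0∞) ≤ 2 := by
            have h3 : 2 ^ N.bits.length ≤ 2 * N := by
              rw [Nat.size_eq_bits_len]
              have h4 : N.size ≠ 0 := fun h => hpos.ne' (Nat.size_eq_zero.1 h)
              obtain ⟨k, hk⟩ := Nat.exists_eq_succ_of_ne_zero h4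
              have : 2 ^ k ≤ N := Nat.lt_size.1 (by omega)
              rw [hk, pow_succ]
              omega
            refine ENNReal.div_le_of_le_mul ?_
            exact_mod_cast h3
          calc _ ≤ ((4 * sz x + 10 : ℕ) : ℝ≥0∞) * 1 + 4 * (2 * (5 * T x)) + B := by
                refine add_le_add (add_le_add ?_ ?_) h1
                · gcongr
                  exact Prog.haltProb_le_one
                · gcongr
                  exact hW.expect_time_le.trans (by gcongr)
            _ = _ := by push_cast; ring
  · intro y
    rw [Prog.outProb_eq_expect, hseq]
    simp only [← Prog.outProb_eq_expect]
    rw [hout (fun v => p.outProb v y) fun c hc hw => ?_]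
    refine ne_top_of_le_ne_top ENNReal.one_ne_top (le_trans ?_
      (Prog.haltProb_le_one (p := p) (x := c.2)))
    rw [Prog.outProb_eq_expect, Prog.haltProb_eq_expect]
    refine Prog.expect_mono fun _ z _ _ => ?_
    split_ifs <;> simp

/-! ### The greedy solution of a fractional knapsack problem -/

/-- Distribute the amount `M` over the items `k ∈ s`, with lower bounds `lo k` and upper bounds
`hi k`, by giving every item its lower bound first and filling up the items in the order of their
keys. The subtractions are truncated, so that an item gets no more than its lower bound if nothing
is left for it. -/
def greedy {ι : Type*} (s : Finset ι) (key lo hi : ι → ℕ) (M : ℕ) (i : ι) : ℕ :=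
  lo i + min (M - ∑ k ∈ s, lo k - ∑ k ∈ s, if key k < key i then hi k - lo k else 0) (hi i - lo i)

section Greedy

variable {ι : Type*} {s : Finset ι} {key lo hi : ι → ℕ} {M : ℕ}

theorem le_greedy (i : ι) : lo i ≤ greedy s key lo hi M i := Nat.le_add_right _ _

theorem greedy_le {i : ι} (h : lo i ≤ hi i) : greedy s key lo hi M i ≤ hi i := by
  unfold greedy; omega

theorem sum_min_eq (d : ι → ℕ) (R : ℕ) (hkey : Set.InjOn key s) :
    ∑ i ∈ s, min (R - ∑ k ∈ s, if key k < key i then d k else 0) (d i) = min R (∑ i ∈ s, d i) := by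
  classical
  revert hkey
  refine Finset.induction_on_max_value key (motive := fun s => Set.InjOn key s →
    ∑ i ∈ s, min (R - ∑ k ∈ s, if key k < key i then d k else 0) (d i) = min R (∑ i ∈ s, d i)) s ?_ ?_
  · simp
  · intro a s has hmax ih hkey
    have hlt : ∀ i ∈ s, key i < key a := fun i hi => lt_of_le_of_ne (hmax i hi) fun h =>
      has (hkey (by simp [hi]) (by simp) h ▸ hi)
    rw [Finset.sum_insert has, Finset.sum_insert has, Finset.sum_insert has, if_neg (lt_irrefl _),
      zero_add, Finset.sum_congr rfl (g := fun k => d k) fun k hk => if_pos (hlt k hk)]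
    have h1 : ∀ i ∈ s, min (R - ∑ k ∈ insert a s, if key k < key i then d k else 0) (d i) =
        min (R - ∑ k ∈ s, if key k < key i then d k else 0) (d i) := by
      intro i hi
      rw [Finset.sum_insert has, if_neg (hlt i hi).not_gt, zero_add]
    rw [Finset.sum_congr rfl h1, ih (hkey.mono (by simp))]
    omega

theorem sum_greedy (hkey : Set.InjOn key s) (h : ∀ i ∈ s, lo i ≤ hi i)
    (hlo : ∑ i ∈ s, lo i ≤ M) (hhi : M ≤ ∑ i ∈ s, hi i) :
    ∑ i ∈ s, greedy s key lo hi M i = M := by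
  unfold greedy
  have h1 : ∑ i ∈ s, hi i = ∑ i ∈ s, lo i + ∑ i ∈ s, (hi i - lo i) := by
    rw [← Finset.sum_add_distrib]
    exact Finset.sum_congr rfl fun i hi => by have := h i hi; omega
  rw [Finset.sum_add_distrib, sum_min_eq (fun i => hi i - lo i) _ hkey]
  omega

/-- Beyond some threshold the items get their lower bounds, below it they get their upper
bounds. -/
theorem exists_threshold (f : ι → ℝ) (h : ∀ i ∈ s, lo i ≤ hi i)
    (hf : ∀ i ∈ s, ∀ j ∈ s, key i ≤ key j → f i ≤ f j) :
    ∃ t : ℝ, ∀ i ∈ s, (f i < t → greedy s key lo hi M i = hi i) ∧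
      (t < f i → greedy s key lo hi M i = lo i) := by
  classical
  by_cases hfull : ∀ i ∈ s, greedy s key lo hi M i = hi i
  · obtain ⟨t, ht⟩ := (s.image f).exists_le
    refine ⟨t, fun i hi => ⟨fun _ => hfull i hi, fun hlt => ?_⟩⟩
    exact absurd hlt (not_lt.2 (ht _ (Finset.mem_image_of_mem f hi)))
  · push Not at hfull
    obtain ⟨j, hj, hmin⟩ := Finset.exists_min_image
      (s.filter fun i => greedy s key lo hi M i ≠ hi i) key
      (by obtain ⟨i, hi, hne⟩ := hfull; exact ⟨i, by simp [hi, hne]⟩)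
    obtain ⟨hj, hne⟩ := Finset.mem_filter.1 hj
    refine ⟨f j, fun i hi' => ⟨fun hlt => ?_, fun hlt => ?_⟩⟩
    · by_contra hni
      exact absurd hlt (not_lt.2 (hf j hj i hi' (hmin i (by simp [hi', hni]))))
    · have hkey : key j < key i := by
        by_contra! hle
        exact absurd hlt (not_lt.2 (hf i hi' j hj hle))
      have h1 : (hi j - lo j) + ∑ k ∈ s, (if key k < key j then hi k - lo k else 0) ≤
          ∑ k ∈ s, if key k < key i then hi k - lo k else 0 := by
        rw [← Finset.add_sum_erase s (fun k => if key k < key i then hi k - lo k else 0) hj,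
          ← Finset.add_sum_erase s (fun k => if key k < key j then hi k - lo k else 0) hj,
          if_pos hkey, if_neg (lt_irrefl _), zero_add]
        gcongr with k hk
        split_ifs with h1 h2
        · exact le_rfl
        · omega
        · exact Nat.zero_le _
        · exact le_rfl
      have h2 := h j hj
      have h3 := h i hi'
      unfold greedy at hne ⊢
      omega

/-- The greedy distribution minimizes the total cost, if the keys order the items by cost. -/
theorem greedy_optimal (f : ι → ℝ) (hkey : Set.InjOn key s) (h : ∀ i ∈ s, lo i ≤ hi i)
    (hf : ∀ i ∈ s, ∀ j ∈ s, key i ≤ key j → f i ≤ f j)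
    {x : ι → ℝ} (hlo : ∀ i ∈ s, lo i ≤ x i) (hhi : ∀ i ∈ s, x i ≤ hi i)
    (hx : ∑ i ∈ s, x i = M) :
    ∑ i ∈ s, greedy s key lo hi M i * f i ≤ ∑ i ∈ s, x i * f i := by
  obtain ⟨t, ht⟩ := exists_threshold (M := M) f h hf
  have hsum : ∑ i ∈ s, (greedy s key lo hi M i : ℝ) = M := by
    rw [← Nat.cast_sum, sum_greedy hkey h]
    · have := Finset.sum_le_sum hlo
      rw [hx] at this
      exact_mod_cast this
    · have := Finset.sum_le_sum hhi
      rw [hx] at this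
      exact_mod_cast this
  have h1 : 0 ≤ ∑ i ∈ s, (x i - greedy s key lo hi M i) * (f i - t) := by
    refine Finset.sum_nonneg fun i hi' => ?_
    obtain ⟨ht1, ht2⟩ := ht i hi'
    rcases lt_trichotomy (f i) t with hlt | heq | hgt
    · rw [ht1 hlt]
      exact mul_nonneg_of_nonpos_of_nonpos (by linarith [hhi i hi']) (by linarith)
    · rw [heq, sub_self, mul_zero]
    · rw [ht2 hgt]
      exact mul_nonneg (by linarith [hlo i hi']) (by linarith)
  have h2 : ∑ i ∈ s, (x i - greedy s key lo hi M i) * (f i - t) =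
      (∑ i ∈ s, x i * f i - ∑ i ∈ s, greedy s key lo hi M i * f i) -
        (∑ i ∈ s, x i - ∑ i ∈ s, (greedy s key lo hi M i : ℝ)) * t := by
    rw [← Finset.sum_sub_distrib, ← Finset.sum_sub_distrib, Finset.sum_mul,
      ← Finset.sum_sub_distrib]
    exact Finset.sum_congr rfl fun i _ => by ring
  rw [h2, hx, hsum] at h1
  linarith

end Greedy

/-! ### Improvising distributions as weights of words -/

theorem prob_eq_sum {α : Type*} (D : PMF α) (s : Finset α) (h : ∀ w ∉ s, D w = 0) (S : Set α)
    [DecidablePred (· ∈ S)] : prob D S = ∑ w ∈ s with w ∈ S, (D w).toReal := by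
  rw [prob, PMF.toOuterMeasure_apply, tsum_eq_sum (s := s), ENNReal.toReal_sum, Finset.sum_filter]
  · refine Finset.sum_congr rfl fun w _ => ?_
    by_cases hw : w ∈ S <;> simp [hw]
  · intro w _
    by_cases hw : w ∈ S <;> simp [hw, PMF.apply_ne_top]
  · intro w hw
    by_cases hw' : w ∈ S <;> simp [hw', h w hw]

namespace Instance

variable (C : Instance)

/-- The improvisations, as a finite set. -/
noncomputable def impr : Finset C.Word := C.improvisations_finite.toFinset

theorem mem_impr {w : C.Word} : w ∈ C.impr ↔ w ∈ C.improvisations := by simp [impr]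

/-- The weights of an improvising distribution, apart from their positivity and their sum. -/
structure IsImprovisingWeight (e : C.Word → ℝ) : Prop where
  cost : ∑ w ∈ C.impr, e w * (C.K w : ℝ) ≤ C.c
  labels : ∀ i, (C.lam : ℝ) ≤ ∑ w ∈ C.impr with C.L w = i, e w ∧
    ∑ w ∈ C.impr with C.L w = i, e w ≤ (C.rho : ℝ)
  words : ∀ i, ∑ w ∈ C.impr with C.L w = i, e w ≠ 0 → ∀ y ∈ C.impr, C.L y = i →
    (C.alpha i : ℝ) ≤ e y / ∑ w ∈ C.impr with C.L w = i, e w ∧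
      e y / ∑ w ∈ C.impr with C.L w = i, e w ≤ (C.beta i : ℝ)

variable {C}

theorem eq_zero_of_prob_eq_one {D : PMF C.Word} (h : prob D C.improvisations = 1) {w : C.Word}
    (hw : w ∉ C.impr) : D w = 0 := by
  rw [prob, ENNReal.toReal_eq_one_iff, PMF.toOuterMeasure_apply_eq_one_iff] at h
  by_contra h0
  exact hw (C.mem_impr.2 (h ((PMF.mem_support_iff _ _).2 h0)))

theorem isImprovingDistribution_iff {D : PMF C.Word} (hD : ∀ w ∉ C.impr, D w = 0) :
    C.IsImprovisingDistribution D ↔ C.IsImprovisingWeight fun w => (D w).toReal := by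
  classical
  have hlabel : ∀ i, prob D (C.labelClass i) = ∑ w ∈ C.impr with C.L w = i, (D w).toReal := by
    intro i
    rw [prob_eq_sum D C.impr hD]
    refine Finset.sum_congr (Finset.filter_congr fun w hw => ?_) fun _ _ => rfl
    have := C.mem_impr.1 hw
    exact ⟨fun h => h.2, fun h => ⟨this, h⟩⟩
  have hword : ∀ i, ∀ y ∈ C.labelClass i, prob D ({y} ∩ C.labelClass i) = (D y).toReal := by
    intro i y hy
    rw [Set.inter_eq_left.2 (by simpa using hy), prob, PMF.toOuterMeasure_apply_singleton]
  have hhard : prob D C.improvisations = 1 := by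
    rw [prob, ENNReal.toReal_eq_one_iff, PMF.toOuterMeasure_apply_eq_one_iff]
    intro w hw
    by_contra h
    exact (PMF.mem_support_iff _ _).1 hw (hD w fun h' => h (C.mem_impr.1 h'))
  have hcost : ∑' w, prob D {w} * (C.K w : ℝ) = ∑ w ∈ C.impr, (D w).toReal * (C.K w : ℝ) := by
    rw [tsum_eq_sum (s := C.impr)]
    · refine Finset.sum_congr rfl fun w _ => ?_
      rw [prob, PMF.toOuterMeasure_apply_singleton]
    · intro w hw
      rw [prob, PMF.toOuterMeasure_apply_singleton, hD w hw]
      simp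
  have hmem : ∀ {i y}, y ∈ C.labelClass i ↔ y ∈ C.impr ∧ C.L y = i := by
    intro i y
    rw [C.mem_impr]
    exact Iff.rfl
  constructor
  · intro h
    refine ⟨hcost ▸ h.cost, fun i => hlabel i ▸ h.labels i, fun i hi y hy hyi => ?_⟩
    have := h.words i (by rwa [hlabel]) y (hmem.2 ⟨hy, hyi⟩)
    rwa [hword i y (hmem.2 ⟨hy, hyi⟩), hlabel] at this
  · intro h
    refine ⟨hhard, hcost ▸ h.cost, fun i => hlabel i ▸ h.labels i, fun i hi y hy => ?_⟩
    rw [hword i y hy, hlabel]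
    exact h.words i (by rwa [hlabel] at hi) y (hmem.1 hy).1 (hmem.1 hy).2

end Instance

/-! ### The greedy improvising distribution -/

/-- The numbers of an instance, multiplied by a common denominator `M`. The costs are also
shifted, to make them natural numbers. -/
structure Scaling (C : Instance) where
  M : ℕ
  lam : ℕ
  rho : ℕ
  alpha : Fin C.numLabels → ℕ
  beta : Fin C.numLabels → ℕ
  shift : ℕ
  c : ℕ
  cost : ℚ → ℕ
  costs : Finset ℚ
  M_pos : 0 < M
  lam_eq : (lam : ℝ) = C.lam * M
  rho_eq : (rho : ℝ) = C.rho * M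
  alpha_eq : ∀ i, (alpha i : ℝ) = C.alpha i * M
  beta_eq : ∀ i, (beta i : ℝ) = C.beta i * M
  c_eq : (c : ℝ) = shift + C.c * M
  mem_costs : ∀ θ, θ ∈ costs ↔ θ ∈ C.possibleCosts
  cost_eq : ∀ θ ∈ costs, (cost θ : ℝ) = shift + θ * M

namespace Scaling

variable {C : Instance} (Z : Scaling C)

/-- The number of words of a label and a cost. -/
noncomputable def count (_ : Scaling C) (i : Fin C.numLabels) (θ : ℚ) : ℕ := (C.costClass i θ).ncard

/-- The greedy conditional probability, times `M`, of a cost, given a label. -/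
noncomputable def cellWeight (i : Fin C.numLabels) : ℚ → ℕ :=
  greedy Z.costs Z.cost (fun θ => Z.alpha i * Z.count i θ) (fun θ => Z.beta i * Z.count i θ) Z.M

/-- The bounds on the conditional probabilities given this label are satisfiable. -/
def Usable (i : Fin C.numLabels) : Prop :=
  ∑ θ ∈ Z.costs, Z.alpha i * Z.count i θ ≤ Z.M ∧ Z.M ≤ ∑ θ ∈ Z.costs, Z.beta i * Z.count i θ

/-- The minimal conditional expectation of the (scaled) cost, times `M`, given a label. -/
noncomputable def labelCost (i : Fin C.numLabels) : ℕ :=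
  ∑ θ ∈ Z.costs, Z.cellWeight i θ * Z.cost θ

/-- Labels are ordered by their costs, and labels of the same cost by their indices. -/
noncomputable def labelKey (i : Fin C.numLabels) : ℕ := Z.labelCost i * C.numLabels + i

open Classical in
/-- The lower bound, times `M`, on the probability of a label: it is `0` if the conditional problem
of the label has no solution. -/
noncomputable def labelLo (i : Fin C.numLabels) : ℕ := if Z.Usable i then Z.lam else 0

open Classical in
/-- The upper bound, times `M`, on the probability of a label: it is `0` if the conditional problem
of the label has no solution, so that the label is not used. -/
noncomputable def labelHi (i : Fin C.numLabels) : ℕ := if Z.Usable i then Z.rho else 0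

/-- The greedy probability, times `M`, of a label. -/
noncomputable def labelWeight : Fin C.numLabels → ℕ :=
  greedy Finset.univ Z.labelKey Z.labelLo Z.labelHi Z.M

/-- The test for feasibility. -/
structure Accepts : Prop where
  usable : ∀ i, Z.Usable i ∨ Z.lam = 0
  lo_le : ∑ i, Z.labelLo i ≤ Z.M
  le_hi : Z.M ≤ ∑ i, Z.labelHi i
  cost_le : ∑ i, Z.labelWeight i * Z.labelCost i ≤ Z.c * (Z.M * Z.M)

theorem alpha_le_beta (i : Fin C.numLabels) : Z.alpha i ≤ Z.beta i := by
  have h : (Z.alpha i : ℝ) ≤ Z.beta i := by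
    rw [Z.alpha_eq, Z.beta_eq]
    have := C.alpha_le_beta i
    gcongr
  exact_mod_cast h

theorem lam_le_rho : Z.lam ≤ Z.rho := by
  have h : (Z.lam : ℝ) ≤ Z.rho := by
    rw [Z.lam_eq, Z.rho_eq]
    have := C.lam_le_rho
    gcongr
  exact_mod_cast h

theorem M_pos' : (0 : ℝ) < Z.M := by exact_mod_cast Z.M_pos

theorem cost_le_iff {θ θ' : ℚ} (h : θ ∈ Z.costs) (h' : θ' ∈ Z.costs) :
    Z.cost θ ≤ Z.cost θ' ↔ θ ≤ θ' := by
  have : (Z.cost θ : ℝ) ≤ Z.cost θ' ↔ (θ : ℝ) ≤ θ' := by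
    rw [Z.cost_eq θ h, Z.cost_eq θ' h', add_le_add_iff_left, mul_le_mul_iff_left₀ Z.M_pos']
  rw [← Nat.cast_le (α := ℝ), this, Rat.cast_le]

theorem cost_injOn : Set.InjOn Z.cost Z.costs := fun _ h _ h' heq =>
  le_antisymm ((Z.cost_le_iff h h').1 heq.le) ((Z.cost_le_iff h' h).1 heq.ge)

theorem labelKey_le {i j : Fin C.numLabels} (h : Z.labelKey i ≤ Z.labelKey j) :
    Z.labelCost i ≤ Z.labelCost j := by
  by_contra! hlt
  have h1 := Nat.mul_le_mul_right C.numLabels (Nat.succ_le_of_lt hlt)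
  have h2 := j.isLt
  rw [Nat.succ_mul] at h1
  unfold labelKey at h
  omega

theorem labelKey_injective : Function.Injective Z.labelKey := by
  intro i j h
  have h1 : Z.labelCost i = Z.labelCost j :=
    le_antisymm (Z.labelKey_le h.le) (Z.labelKey_le h.ge)
  unfold labelKey at h
  rw [h1] at h
  exact Fin.ext (by omega)

theorem labelLo_le_labelHi (i : Fin C.numLabels) : Z.labelLo i ≤ Z.labelHi i := by
  unfold labelLo labelHi
  split_ifs
  · exact Z.lam_le_rho
  · exact le_rfl

theorem sum_cellWeight {i : Fin C.numLabels} (h : Z.Usable i) :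
    ∑ θ ∈ Z.costs, Z.cellWeight i θ = Z.M :=
  sum_greedy Z.cost_injOn (fun _ _ => Nat.mul_le_mul_right _ (Z.alpha_le_beta i)) h.1 h.2

theorem le_cellWeight (i : Fin C.numLabels) (θ : ℚ) :
    Z.alpha i * Z.count i θ ≤ Z.cellWeight i θ :=
  le_greedy (lo := fun θ => Z.alpha i * Z.count i θ) θ

theorem cellWeight_le (i : Fin C.numLabels) (θ : ℚ) :
    Z.cellWeight i θ ≤ Z.beta i * Z.count i θ :=
  greedy_le (lo := fun θ => Z.alpha i * Z.count i θ) (hi := fun θ => Z.beta i * Z.count i θ)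
    (Nat.mul_le_mul_right _ (Z.alpha_le_beta i))

/-- Sums over the improvisations of a label, arranged by cost. -/
theorem sum_label (i : Fin C.numLabels) (f : C.Word → ℝ) :
    ∑ w ∈ C.impr with C.L w = i, f w =
      ∑ θ ∈ Z.costs, ∑ w ∈ C.impr with C.L w = i ∧ C.K w = θ, f w := by
  rw [← Finset.sum_fiberwise_of_maps_to (t := Z.costs) (g := C.K)]
  · simp only [Finset.filter_filter]
  · intro w hw
    exact (Z.mem_costs _).2 ⟨w, C.mem_impr.1 (Finset.mem_filter.1 hw).1, rfl⟩

theorem card_cell (i : Fin C.numLabels) (θ : ℚ) :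
    (C.impr.filter fun w => C.L w = i ∧ C.K w = θ).card = Z.count i θ := by
  rw [count, ← Set.ncard_coe_finset]
  congr 1
  ext w
  simp [Instance.mem_impr, Instance.costClass]

/-- Within a label class the greedy weights are optimal. -/
theorem labelCost_le {e : C.Word → ℝ} {i : Fin C.numLabels}
    (hP : 0 < ∑ w ∈ C.impr with C.L w = i, e w)
    (he : ∀ y ∈ C.impr, C.L y = i →
      (C.alpha i : ℝ) ≤ e y / ∑ w ∈ C.impr with C.L w = i, e w ∧
        e y / ∑ w ∈ C.impr with C.L w = i, e w ≤ (C.beta i : ℝ)) :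
    Z.Usable i ∧ (Z.labelCost i : ℝ) * ∑ w ∈ C.impr with C.L w = i, e w ≤
      Z.M * ∑ w ∈ C.impr with C.L w = i, e w * Z.cost (C.K w) := by
  set P := ∑ w ∈ C.impr with C.L w = i, e w with hPdef
  have hM := Z.M_pos'
  let x : ℚ → ℝ := fun θ => Z.M / P * ∑ w ∈ C.impr with C.L w = i ∧ C.K w = θ, e w
  have hlo : ∀ θ ∈ Z.costs, ((Z.alpha i * Z.count i θ : ℕ) : ℝ) ≤ x θ := by
    intro θ _
    have h1 : (Z.count i θ : ℝ) * (C.alpha i * P) ≤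
        ∑ w ∈ C.impr with C.L w = i ∧ C.K w = θ, e w := by
      rw [← Z.card_cell, ← nsmul_eq_mul, ← Finset.sum_const]
      refine Finset.sum_le_sum fun w hw => ?_
      obtain ⟨hw, hi, -⟩ := Finset.mem_filter.1 hw
      exact (le_div_iff₀ hP).1 (he w hw hi).1
    push_cast
    rw [Z.alpha_eq]
    calc (C.alpha i : ℝ) * Z.M * Z.count i θ = Z.M / P * (Z.count i θ * (C.alpha i * P)) := by
          field_simp
      _ ≤ x θ := by simp only [x]; gcongr
  have hhi : ∀ θ ∈ Z.costs, x θ ≤ ((Z.beta i * Z.count i θ : ℕ) : ℝ) := by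
    intro θ _
    have h1 : ∑ w ∈ C.impr with C.L w = i ∧ C.K w = θ, e w ≤
        (Z.count i θ : ℝ) * (C.beta i * P) := by
      rw [← Z.card_cell, ← nsmul_eq_mul, ← Finset.sum_const]
      refine Finset.sum_le_sum fun w hw => ?_
      obtain ⟨hw, hi, -⟩ := Finset.mem_filter.1 hw
      exact (div_le_iff₀ hP).1 (he w hw hi).2
    push_cast
    rw [Z.beta_eq]
    calc x θ ≤ Z.M / P * (Z.count i θ * (C.beta i * P)) := by simp only [x]; gcongr
      _ = _ := by field_simp
  have hsum : ∑ θ ∈ Z.costs, x θ = Z.M := by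
    simp only [x]
    rw [← Finset.mul_sum, ← Z.sum_label, ← hPdef, div_mul_cancel₀ _ hP.ne']
  refine ⟨⟨?_, ?_⟩, ?_⟩
  · have := Finset.sum_le_sum hlo
    rw [hsum] at this
    exact_mod_cast this
  · have := Finset.sum_le_sum hhi
    rw [hsum] at this
    exact_mod_cast this
  · have h1 := greedy_optimal (fun θ => (Z.cost θ : ℝ)) Z.cost_injOn
      (fun _ _ => Nat.mul_le_mul_right _ (Z.alpha_le_beta i))
      (fun _ _ _ _ h => by exact_mod_cast h) hlo hhi hsum
    have h2 : ∑ θ ∈ Z.costs, x θ * Z.cost θ =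
        Z.M / P * ∑ w ∈ C.impr with C.L w = i, e w * Z.cost (C.K w) := by
      rw [Z.sum_label, Finset.mul_sum]
      refine Finset.sum_congr rfl fun θ _ => ?_
      simp only [x]
      rw [mul_assoc, Finset.sum_mul]
      congr 1
      refine Finset.sum_congr rfl fun w hw => ?_
      rw [(Finset.mem_filter.1 hw).2.2]
    rw [h2] at h1
    have h3 : (Z.labelCost i : ℝ) ≤
        Z.M / P * ∑ w ∈ C.impr with C.L w = i, e w * Z.cost (C.K w) := by
      unfold labelCost cellWeight
      push_cast
      exact h1
    calc (Z.labelCost i : ℝ) * P ≤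
          (Z.M / P * ∑ w ∈ C.impr with C.L w = i, e w * Z.cost (C.K w)) * P := by gcongr
      _ = _ := by field_simp

theorem accepts_of_isImprovisingWeight {e : C.Word → ℝ} (he0 : ∀ w, 0 ≤ e w)
    (he1 : ∑ w ∈ C.impr, e w = 1) (h : C.IsImprovisingWeight e) : Z.Accepts := by
  have hM := Z.M_pos'
  set P : Fin C.numLabels → ℝ := fun i => ∑ w ∈ C.impr with C.L w = i, e w with hP
  have hP0 : ∀ i, 0 ≤ P i := fun i => Finset.sum_nonneg fun w _ => he0 w
  have hPsum : ∑ i, P i = 1 := by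
    rw [← he1]
    exact Finset.sum_fiberwise _ _ _
  have hlab : ∀ i, (Z.Usable i ∨ P i = 0) ∧ (Z.labelCost i : ℝ) * P i ≤
      Z.M * ∑ w ∈ C.impr with C.L w = i, e w * Z.cost (C.K w) := by
    intro i
    rcases (hP0 i).eq_or_lt' with h0 | hpos
    · refine ⟨.inr h0, ?_⟩
      rw [h0, mul_zero]
      exact mul_nonneg hM.le (Finset.sum_nonneg fun w _ => mul_nonneg (he0 w) (Nat.cast_nonneg _))
    · obtain ⟨h1, h2⟩ := Z.labelCost_le hpos (h.words i hpos.ne')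
      exact ⟨.inl h1, h2⟩
  have hlo : ∀ i ∈ Finset.univ, (Z.labelLo i : ℝ) ≤ Z.M * P i := by
    intro i _
    unfold labelLo
    split_ifs with hu
    · rw [Z.lam_eq, mul_comm]
      exact mul_le_mul_of_nonneg_left (h.labels i).1 hM.le
    · simpa using mul_nonneg hM.le (hP0 i)
  have hhi : ∀ i ∈ Finset.univ, Z.M * P i ≤ (Z.labelHi i : ℝ) := by
    intro i _
    unfold labelHi
    split_ifs with hu
    · rw [Z.rho_eq, mul_comm]
      exact mul_le_mul_of_nonneg_right (h.labels i).2 hM.le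
    · rw [(hlab i).1.resolve_left hu]
      simp
  have hsum : ∑ i, Z.M * P i = Z.M := by rw [← Finset.mul_sum, hPsum, mul_one]
  refine ⟨fun i => ?_, ?_, ?_, ?_⟩
  · rcases (hlab i).1 with hu | h0
    · exact .inl hu
    · right
      have h1 : (Z.lam : ℝ) ≤ 0 := by
        rw [Z.lam_eq]
        have := (h.labels i).1
        rw [show ∑ w ∈ C.impr with C.L w = i, e w = 0 from h0] at this
        exact mul_nonpos_of_nonpos_of_nonneg this hM.le
      exact_mod_cast le_antisymm h1 (Nat.cast_nonneg _)
  · have := Finset.sum_le_sum hlo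
    rw [hsum] at this
    exact_mod_cast this
  · have := Finset.sum_le_sum hhi
    rw [hsum] at this
    exact_mod_cast this
  · have h1 := greedy_optimal (fun i => (Z.labelCost i : ℝ)) (Z.labelKey_injective.injOn)
      (fun i _ => Z.labelLo_le_labelHi i)
      (fun i _ j _ hij => by exact_mod_cast Z.labelKey_le hij) hlo hhi hsum
    have h2 : ∑ i, Z.M * P i * Z.labelCost i ≤ Z.M * (Z.M * ∑ w ∈ C.impr, e w * Z.cost (C.K w)) := by
      rw [← Finset.sum_fiberwise C.impr C.L fun w => e w * (Z.cost (C.K w) : ℝ), Finset.mul_sum,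
        Finset.mul_sum]
      refine Finset.sum_le_sum fun i _ => ?_
      rw [mul_assoc, mul_comm (P i)]
      exact mul_le_mul_of_nonneg_left (hlab i).2 hM.le
    have h3 : ∑ w ∈ C.impr, e w * Z.cost (C.K w) ≤ Z.c := by
      have h4 : ∑ w ∈ C.impr, e w * Z.cost (C.K w) =
          Z.shift * ∑ w ∈ C.impr, e w + Z.M * ∑ w ∈ C.impr, e w * C.K w := by
        rw [Finset.mul_sum, Finset.mul_sum, ← Finset.sum_add_distrib]
        refine Finset.sum_congr rfl fun w hw => ?_
        rw [Z.cost_eq _ ((Z.mem_costs _).2 ⟨w, C.mem_impr.1 hw, rfl⟩)]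
        ring
      rw [h4, he1, Z.c_eq, mul_one, mul_comm (C.c : ℝ)]
      have := h.cost
      gcongr
    have h5 : ((∑ i, Z.labelWeight i * Z.labelCost i : ℕ) : ℝ) ≤ (Z.c * (Z.M * Z.M) : ℕ) := by
      unfold labelWeight
      push_cast
      refine h1.trans (h2.trans ?_)
      calc (Z.M : ℝ) * (Z.M * ∑ w ∈ C.impr, e w * Z.cost (C.K w)) ≤ Z.M * (Z.M * Z.c) := by gcongr
        _ = _ := by ring
    exact_mod_cast h5

theorem accepts_of_feasible (h : C.Feasible) : Z.Accepts := by
  obtain ⟨D, hD⟩ := h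
  have h0 : ∀ w ∉ C.impr, D w = 0 := fun w hw => Instance.eq_zero_of_prob_eq_one hD.hard hw
  refine Z.accepts_of_isImprovisingWeight (fun _ => ENNReal.toReal_nonneg) ?_
    ((Instance.isImprovingDistribution_iff h0).1 hD)
  have h1 := D.tsum_coe
  rw [tsum_eq_sum h0] at h1
  rw [← ENNReal.toReal_sum fun w _ => D.apply_ne_top w, h1, ENNReal.toReal_one]

/-- The weight, times `M * M`, of all words of the given label and cost together. -/
noncomputable def jointWeight (i : Fin C.numLabels) (θ : ℚ) : ℕ :=
  Z.labelWeight i * Z.cellWeight i θ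

/-- The probability of a word: the labels and costs have the greedy probabilities, and words of
the same label and cost are equally likely. -/
noncomputable def wordWeight (w : C.Word) : ℝ :=
  Z.jointWeight (C.L w) (C.K w) / (Z.M * Z.M) / Z.count (C.L w) (C.K w)

theorem sum_wordWeight_cell (i : Fin C.numLabels) (θ : ℚ) :
    ∑ w ∈ C.impr with C.L w = i ∧ C.K w = θ, Z.wordWeight w =
      Z.jointWeight i θ / (Z.M * Z.M) := by
  have h1 : ∀ w ∈ C.impr.filter (fun w => C.L w = i ∧ C.K w = θ), Z.wordWeight w =
      Z.jointWeight i θ / (Z.M * Z.M) / Z.count i θ := by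
    intro w hw
    obtain ⟨-, rfl, rfl⟩ := Finset.mem_filter.1 hw
    rfl
  rw [Finset.sum_congr rfl h1, Finset.sum_const, Z.card_cell, nsmul_eq_mul]
  by_cases h0 : Z.count i θ = 0
  · have h2 := Z.cellWeight_le i θ
    rw [h0, mul_zero] at h2
    simp [jointWeight, h0, Nat.le_zero.1 h2]
  · field_simp

theorem labelWeight_eq_zero {i : Fin C.numLabels} (h : ¬ Z.Usable i) : Z.labelWeight i = 0 := by
  have h1 : Z.labelWeight i ≤ Z.labelHi i := greedy_le (Z.labelLo_le_labelHi i)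
  rw [labelHi, if_neg h] at h1
  omega

theorem sum_jointWeight (i : Fin C.numLabels) :
    ∑ θ ∈ Z.costs, Z.jointWeight i θ = Z.labelWeight i * Z.M := by
  unfold jointWeight
  rw [← Finset.mul_sum]
  by_cases h : Z.Usable i
  · rw [Z.sum_cellWeight h]
  · rw [Z.labelWeight_eq_zero h, zero_mul, zero_mul]

theorem sum_wordWeight_label (i : Fin C.numLabels) :
    ∑ w ∈ C.impr with C.L w = i, Z.wordWeight w = Z.labelWeight i / Z.M := by
  have hM := Z.M_pos'
  rw [Z.sum_label, Finset.sum_congr rfl fun θ _ => Z.sum_wordWeight_cell i θ, ← Finset.sum_div,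
    ← Nat.cast_sum, Z.sum_jointWeight]
  push_cast
  field_simp

theorem sum_labelWeight (h : Z.Accepts) : ∑ i, Z.labelWeight i = Z.M :=
  sum_greedy Z.labelKey_injective.injOn (fun i _ => Z.labelLo_le_labelHi i) h.lo_le h.le_hi

theorem sum_wordWeight (h : Z.Accepts) : ∑ w ∈ C.impr, Z.wordWeight w = 1 := by
  rw [← Finset.sum_fiberwise C.impr C.L, Finset.sum_congr rfl fun i _ => Z.sum_wordWeight_label i,
    ← Finset.sum_div, ← Nat.cast_sum, Z.sum_labelWeight h, div_self Z.M_pos'.ne']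

theorem isImprovisingWeight_wordWeight (h : Z.Accepts) : C.IsImprovisingWeight Z.wordWeight := by
  have hM := Z.M_pos'
  refine ⟨?_, fun i => ?_, fun i hi y hy hyi => ?_⟩
  · have h1 : ∑ w ∈ C.impr, Z.wordWeight w * Z.cost (C.K w) =
        Z.shift + Z.M * ∑ w ∈ C.impr, Z.wordWeight w * C.K w := by
      rw [← mul_one (Z.shift : ℝ), ← Z.sum_wordWeight h, Finset.mul_sum, Finset.mul_sum,
        ← Finset.sum_add_distrib]
      refine Finset.sum_congr rfl fun w hw => ?_
      rw [Z.cost_eq _ ((Z.mem_costs _).2 ⟨w, C.mem_impr.1 hw, rfl⟩)]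
      ring
    have h2 : ∑ w ∈ C.impr, Z.wordWeight w * Z.cost (C.K w) =
        (∑ i, Z.labelWeight i * Z.labelCost i : ℕ) / (Z.M * Z.M) := by
      rw [← Finset.sum_fiberwise C.impr C.L, Nat.cast_sum, Finset.sum_div]
      refine Finset.sum_congr rfl fun i _ => ?_
      rw [Z.sum_label, labelCost, Finset.mul_sum, Nat.cast_sum, Finset.sum_div]
      refine Finset.sum_congr rfl fun θ _ => ?_
      have h3 : ∀ w ∈ C.impr.filter (fun w => C.L w = i ∧ C.K w = θ),
          Z.wordWeight w * Z.cost (C.K w) = Z.wordWeight w * Z.cost θ := by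
        intro w hw
        rw [(Finset.mem_filter.1 hw).2.2]
      rw [Finset.sum_congr rfl h3, ← Finset.sum_mul, Z.sum_wordWeight_cell, jointWeight]
      push_cast
      ring
    have h3 : ((∑ i, Z.labelWeight i * Z.labelCost i : ℕ) : ℝ) ≤ Z.c * (Z.M * Z.M) := by
      exact_mod_cast h.cost_le
    rw [← div_le_iff₀ (by positivity), ← h2, h1, Z.c_eq, mul_comm (C.c : ℝ)] at h3
    exact le_of_mul_le_mul_left (by linarith) hM
  · rw [Z.sum_wordWeight_label, le_div_iff₀ hM, div_le_iff₀ hM, ← Z.lam_eq, ← Z.rho_eq,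
      Nat.cast_le, Nat.cast_le]
    have h1 : Z.labelLo i ≤ Z.labelWeight i := le_greedy i
    have h2 : Z.labelWeight i ≤ Z.labelHi i := greedy_le (Z.labelLo_le_labelHi i)
    unfold labelLo at h1
    unfold labelHi at h2
    by_cases hu : Z.Usable i
    · rw [if_pos hu] at h1 h2
      exact ⟨h1, h2⟩
    · rw [(h.usable i).resolve_left hu, Z.labelWeight_eq_zero hu]
      simp
  · rw [Z.sum_wordWeight_label] at hi ⊢
    subst hyi
    have hl : (Z.labelWeight (C.L y) : ℝ) ≠ 0 := fun h0 => hi (by rw [h0, zero_div])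
    have hn : (0 : ℝ) < Z.count (C.L y) (C.K y) := by
      rw [← Z.card_cell]
      exact_mod_cast Finset.card_pos.2 ⟨y, by simp [hy]⟩
    have h1 : Z.wordWeight y / (Z.labelWeight (C.L y) / Z.M) =
        Z.cellWeight (C.L y) (C.K y) / (Z.M * Z.count (C.L y) (C.K y)) := by
      unfold wordWeight jointWeight
      push_cast
      field_simp
    have h2 : (Z.alpha (C.L y) * Z.count (C.L y) (C.K y) : ℝ) ≤ Z.cellWeight (C.L y) (C.K y) := by
      exact_mod_cast Z.le_cellWeight (C.L y) (C.K y)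
    have h3 : (Z.cellWeight (C.L y) (C.K y) : ℝ) ≤ Z.beta (C.L y) * Z.count (C.L y) (C.K y) := by
      exact_mod_cast Z.cellWeight_le (C.L y) (C.K y)
    rw [Z.alpha_eq] at h2
    rw [Z.beta_eq] at h3
    rw [h1, le_div_iff₀ (by positivity), div_le_iff₀ (by positivity)]
    constructor <;> linarith

theorem exists_improvisingDistribution (h : Z.Accepts) : ∃ D : PMF C.Word,
    C.IsImprovisingDistribution D ∧
      ∀ w, D w = if w ∈ C.impr then ENNReal.ofReal (Z.wordWeight w) else 0 := by
  classical
  have h0 : ∀ w, 0 ≤ Z.wordWeight w := fun w => by unfold wordWeight; positivity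
  let D : PMF C.Word := PMF.ofFinset
    (fun w => if w ∈ C.impr then ENNReal.ofReal (Z.wordWeight w) else 0) C.impr (by
      rw [Finset.sum_congr rfl fun w hw => if_pos hw,
        ← ENNReal.ofReal_sum_of_nonneg fun w _ => h0 w, Z.sum_wordWeight h, ENNReal.ofReal_one])
    fun w hw => if_neg hw
  have hD : ∀ w, D w = if w ∈ C.impr then ENNReal.ofReal (Z.wordWeight w) else 0 := fun _ => rfl
  refine ⟨D, (Instance.isImprovingDistribution_iff fun w hw => by rw [hD, if_neg hw]).2 ?_, hD⟩
  have h1 := Z.isImprovisingWeight_wordWeight h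
  have h2 : ∀ w ∈ C.impr, (D w).toReal = Z.wordWeight w := fun w hw => by
    rw [hD, if_pos hw, ENNReal.toReal_ofReal (h0 w)]
  have h3 : ∀ i, ∑ w ∈ C.impr with C.L w = i, (D w).toReal =
      ∑ w ∈ C.impr with C.L w = i, Z.wordWeight w := fun i =>
    Finset.sum_congr rfl fun w hw => h2 w (Finset.mem_filter.1 hw).1
  refine ⟨?_, fun i => ?_, fun i hi y hy hyi => ?_⟩
  · rw [Finset.sum_congr rfl fun w hw => by rw [h2 w hw]]
    exact h1.cost
  · rw [h3]; exact h1.labels i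
  · rw [h3] at hi ⊢
    rw [h2 y hy]
    exact h1.words i hi y hy hyi

end Scaling

/-! ### Common denominators -/

/-- The absolute value of a rational number, multiplied by a multiple `M` of its denominator. -/
def scaleAbs (M : ℕ) (q : ℚ) : ℕ := q.num.natAbs * (M / q.den)

theorem scaleAbs_eq {M : ℕ} {q : ℚ} (h : q.den ∣ M) : (scaleAbs M q : ℝ) = |(q : ℝ)| * M := by
  have h1 : (q.den : ℝ) ≠ 0 := by exact_mod_cast q.den_ne_zero
  have h2 : |(q : ℝ)| = (q.num.natAbs : ℝ) / q.den := by
    conv_lhs => rw [Rat.cast_def q]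
    rw [abs_div, Nat.abs_cast, Nat.cast_natAbs, Int.cast_abs]
  rw [scaleAbs, h2]
  push_cast
  rw [Nat.cast_div h h1]
  field_simp

theorem scaleAbs_eq_of_nonneg {M : ℕ} {q : ℚ} (h : q.den ∣ M) (hq : 0 ≤ q) :
    (scaleAbs M q : ℝ) = q * M := by
  rw [scaleAbs_eq h, abs_of_nonneg (by exact_mod_cast hq)]

theorem scaleAbs_le (M : ℕ) (q : ℚ) : scaleAbs M q ≤ M * q.num.natAbs := by
  rw [scaleAbs, mul_comm]
  exact Nat.mul_le_mul_right _ (Nat.div_le_self _ _)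

namespace Instance

variable (C : Instance) (l : List ℚ)

/-- A common denominator of the numbers of an instance with the list `l` of possible costs. -/
def commonDen : ℕ :=
  C.c.den * (C.lam.den * (C.rho.den *
    ((List.ofFn fun i => (C.alpha i).den * (C.beta i).den).prod * (l.map Rat.den).prod)))

/-- An upper bound on the absolute values of the scaled costs. -/
def costShift : ℕ := C.commonDen l * (l.map fun θ => θ.num.natAbs).sum

/-- The scaled and shifted cost. -/
def scaledCost (θ : ℚ) : ℕ :=
  if θ < 0 then C.costShift l - scaleAbs (C.commonDen l) θ
  else C.costShift l + scaleAbs (C.commonDen l) θ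

theorem commonDen_pos : 0 < C.commonDen l := by
  have h1 : 0 < (List.ofFn fun i => (C.alpha i).den * (C.beta i).den).prod := by
    rw [List.prod_ofFn]
    exact Finset.prod_pos fun i _ => Nat.mul_pos (C.alpha i).den_pos (C.beta i).den_pos
  have h2 : 0 < (l.map Rat.den).prod :=
    List.prod_pos fun a ha => by obtain ⟨q, -, rfl⟩ := List.mem_map.1 ha; exact q.den_pos
  have h3 := C.c.den_pos
  have h4 := C.lam.den_pos
  have h5 := C.rho.den_pos
  unfold commonDen
  positivity

theorem alpha_beta_den_dvd (i : Fin C.numLabels) :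
    (C.alpha i).den * (C.beta i).den ∣ C.commonDen l := by
  refine Dvd.dvd.mul_left (Dvd.dvd.mul_left (Dvd.dvd.mul_left (Dvd.dvd.mul_right ?_ _) _) _) _
  exact List.dvd_prod ((List.mem_ofFn' _ _).2 ⟨i, rfl⟩)

theorem cost_den_dvd {θ : ℚ} (h : θ ∈ l) : θ.den ∣ C.commonDen l :=
  Dvd.dvd.mul_left (Dvd.dvd.mul_left (Dvd.dvd.mul_left (Dvd.dvd.mul_left
    (List.dvd_prod (List.mem_map_of_mem h)) _) _) _) _

theorem scaledCost_eq {θ : ℚ} (h : θ ∈ l) :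
    (C.scaledCost l θ : ℝ) = C.costShift l + θ * C.commonDen l := by
  have h1 : scaleAbs (C.commonDen l) θ ≤ C.costShift l := (scaleAbs_le _ _).trans
    (Nat.mul_le_mul_left _ (List.single_le_sum (fun _ _ => Nat.zero_le _) _
      (List.mem_map_of_mem (f := fun θ : ℚ => θ.num.natAbs) h)))
  unfold scaledCost
  split_ifs with h0
  · rw [Nat.cast_sub h1, scaleAbs_eq (C.cost_den_dvd l h), abs_of_neg (by exact_mod_cast h0)]
    ring
  · rw [Nat.cast_add, scaleAbs_eq_of_nonneg (C.cost_den_dvd l h) (not_lt.1 h0)]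

/-- The scaling by the common denominator. -/
def scaling (hl : ∀ θ, θ ∈ l ↔ θ ∈ C.possibleCosts) : Scaling C where
  M := C.commonDen l
  lam := scaleAbs (C.commonDen l) C.lam
  rho := scaleAbs (C.commonDen l) C.rho
  alpha i := scaleAbs (C.commonDen l) (C.alpha i)
  beta i := scaleAbs (C.commonDen l) (C.beta i)
  shift := C.costShift l
  c := C.costShift l + scaleAbs (C.commonDen l) C.c
  cost := C.scaledCost l
  costs := l.toFinset
  M_pos := C.commonDen_pos l
  lam_eq := scaleAbs_eq_of_nonneg
    (Dvd.dvd.mul_left (Dvd.intro _ rfl) _) C.lam_nonneg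
  rho_eq := scaleAbs_eq_of_nonneg (Dvd.dvd.mul_left (Dvd.dvd.mul_left (Dvd.intro _ rfl) _) _)
    (C.lam_nonneg.trans C.lam_le_rho)
  alpha_eq i := scaleAbs_eq_of_nonneg
    ((Dvd.intro _ rfl).trans (C.alpha_beta_den_dvd l i)) (C.alpha_nonneg i)
  beta_eq i := scaleAbs_eq_of_nonneg ((Dvd.intro_left _ rfl).trans (C.alpha_beta_den_dvd l i))
    ((C.alpha_nonneg i).trans (C.alpha_le_beta i))
  c_eq := by
    have h : C.c.den ∣ C.commonDen l := Dvd.intro _ rfl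
    rw [Nat.cast_add, scaleAbs_eq_of_nonneg h C.c_nonneg]
  mem_costs θ := by rw [List.mem_toFinset, hl]
  cost_eq θ h := C.scaledCost_eq l (List.mem_toFinset.1 h)

end Instance

/-! ### The algorithm -/

instance : Enc EncodedInstance := ⟨EncodedInstance.code⟩

section Algorithm

variable {Γ : Type*} [Enc Γ]

namespace PolyTime

theorem rat_data {q : Γ → ℚ} (hq : PolyTime q) :
    PolyTime fun x => (decide (q x < 0), (q x).num.natAbs, (q x).den) :=
  hq.congr_enc fun _ => rfl

theorem den {q : Γ → ℚ} (hq : PolyTime q) : PolyTime fun x => (q x).den := hq.rat_data.snd.snd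

theorem natAbs_num {q : Γ → ℚ} (hq : PolyTime q) : PolyTime fun x => (q x).num.natAbs :=
  hq.rat_data.snd.fst

theorem _root_.LQCI.PolyDec.rat_neg {q : Γ → ℚ} (hq : PolyTime q) : PolyDec fun x => q x < 0 :=
  ⟨_, hq.rat_data.fst, fun x => by simp⟩

theorem scaleAbs {M : Γ → ℕ} {q : Γ → ℚ} (hM : PolyTime M) (hq : PolyTime q) :
    PolyTime fun x => scaleAbs (M x) (q x) :=
  hq.natAbs_num.mul (hM.div hq.den fun x => (q x).den_pos)

/-- Sums over finite sets that are given by lists. -/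
theorem sum_toFinset {l : Γ → List ℚ} {f : Γ → ℚ → ℕ} (hl : PolyTime l) (h : ∀ x, (l x).Nodup)
    (hf : PolyTime fun y : {y : Γ × ℚ // y.2 ∈ l y.1} => f y.1.1 y.1.2) :
    PolyTime fun x => ∑ θ ∈ (l x).toFinset, f x θ :=
  (hl.map_mem hf).sum.congr fun x => (List.sum_toFinset _ (h x)).symm

end PolyTime

variable {𝒞 : Set EncodedInstance}

/-- The components of the encoding of an instance. -/
def EncodedInstance.data (C : EncodedInstance) : Value × ℚ × ℚ × ℚ × List (ℚ × ℚ) :=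
  (C.desc, C.c, C.lam, C.rho, List.ofFn fun i => (C.alpha i, C.beta i))

theorem EncodedInstance.polyTime_data : PolyTime fun C : {C // C ∈ 𝒞} => C.1.data :=
  .of_enc_eq fun C => by
    simp only [enc, EncodedInstance.code, EncodedInstance.data, List.map_ofFn]
    rfl

/-- An instance of the class, with one of its labels. -/
abbrev LabelIdx (𝒞 : Set EncodedInstance) : Type :=
  Σ C : {C : EncodedInstance // C ∈ 𝒞}, Fin C.1.numLabels

/-- The data that present a label: the instance, the bounds for the label, and its index. -/
def LabelIdx.data (y : LabelIdx 𝒞) : {C // C ∈ 𝒞} × (ℚ × ℚ) × ℕ :=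
  (y.1, (y.1.1.alpha y.2, y.1.1.beta y.2), y.2)

instance : Enc (LabelIdx 𝒞) := ⟨fun y => enc y.data⟩

theorem LabelIdx.polyTime_data : PolyTime (LabelIdx.data (𝒞 := 𝒞)) := .of_enc_eq fun _ => rfl

/-- Loops over the labels of an instance. -/
theorem PolyTime.ofFn {β : Type*} [Enc β] [Inhabited β] {C : Γ → {C // C ∈ 𝒞}} {F : Γ × LabelIdx 𝒞 → β}
    (hC : PolyTime C) (hF : PolyTime F) :
    PolyTime fun x => List.ofFn fun i => F (x, ⟨C x, i⟩) := by
  let row : Γ → List ((ℚ × ℚ) × ℕ) := fun x => (C x).1.data.2.2.2.2.zipIdx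
  have hrow : PolyTime row := (EncodedInstance.polyTime_data.comp hC).snd.snd.snd.snd.zipIdx
  have hrow_eq : ∀ x, row x =
      List.ofFn fun i => (((C x).1.alpha i, (C x).1.beta i), (i : ℕ)) := by
    intro x
    refine List.ext_getElem (by simp [row, EncodedInstance.data]) fun n h₁ h₂ => ?_
    simp [row, EncodedInstance.data]
  have hmem : ∀ y : {y : Γ × ((ℚ × ℚ) × ℕ) // y.2 ∈ row y.1}, ∃ i : Fin (C y.1.1).1.numLabels,
      (((C y.1.1).1.alpha i, (C y.1.1).1.beta i), (i : ℕ)) = y.1.2 := by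
    rintro ⟨⟨x, a⟩, h⟩
    rw [hrow_eq, List.mem_ofFn'] at h
    exact h
  choose i hi using hmem
  have hy : PolyTime fun y : {y : Γ × ((ℚ × ℚ) × ℕ) // y.2 ∈ row y.1} => y.1 := PolyTime.id.val
  have hidx : PolyTime fun y : {y : Γ × ((ℚ × ℚ) × ℕ) // y.2 ∈ row y.1} =>
      (y.1.1, (⟨C y.1.1, i y⟩ : LabelIdx 𝒞)) := by
    refine hy.fst.pair (((hC.comp hy.fst).pair hy.snd).congr_enc fun y => ?_)
    rw [← hi y]
    rfl
  let f : Γ → (ℚ × ℚ) × ℕ → β := fun x a =>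
    if h : a.2 < (C x).1.numLabels then F (x, ⟨C x, ⟨a.2, h⟩⟩) else default
  refine (hrow.map_mem (f := f) ((hF.comp hidx).congr fun y => ?_)).congr fun x => ?_
  · have h1 := congrArg Prod.snd (hi y)
    have h2 : y.1.2.2 < (C y.1.1).1.numLabels := h1 ▸ (i y).isLt
    simp only [f, dif_pos h2]
    congr 3
    exact Fin.ext h1
  · rw [hrow_eq, List.map_ofFn]
    congr 1
    funext i
    simp [f]

theorem PolyTime.sum_fin {C : Γ → {C // C ∈ 𝒞}} {F : Γ × LabelIdx 𝒞 → ℕ}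
    (hC : PolyTime C) (hF : PolyTime F) : PolyTime fun x => ∑ i, F (x, ⟨C x, i⟩) :=
  (PolyTime.ofFn hC hF).sum.congr fun x => by rw [List.sum_ofFn]

variable {costs : {C // C ∈ 𝒞} → List ℚ}

/-- A label of an instance, with one of the possible costs. -/
abbrev CellIdx (costs : {C // C ∈ 𝒞} → List ℚ) : Type :=
  {z : LabelIdx 𝒞 × ℚ // z.2 ∈ costs z.1.1}

/-- The instance, label index and cost on which the counting operation is run. -/
def CellIdx.query (z : CellIdx costs) : {C // C ∈ 𝒞} × ℕ × ℚ := (z.1.1.1, (z.1.1.2 : ℕ), z.1.2)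

section Numbers

variable (hcosts : PolyTime costs)
include hcosts

theorem polyTime_commonDen :
    PolyTime fun C : {C // C ∈ 𝒞} => C.1.commonDen (costs C) := by
  have h : PolyTime fun C : {C // C ∈ 𝒞} => C.1.data := EncodedInstance.polyTime_data
  have h1 : PolyTime fun C : {C // C ∈ 𝒞} =>
      (C.1.data.2.2.2.2.map fun r => r.1.den * r.2.den).prod :=
    (h.snd.snd.snd.snd.map (f := fun _ r => r.1.den * r.2.den)
      (PolyTime.id.snd.fst.den.mul PolyTime.id.snd.snd.den)).prod
  refine (h.snd.fst.den.mul (h.snd.snd.fst.den.mul (h.snd.snd.snd.fst.den.mul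
    (h1.mul (hcosts.map (f := fun _ q => q.den) PolyTime.id.snd.den).prod)))).congr fun C => ?_
  simp only [EncodedInstance.data, Instance.commonDen, List.map_ofFn]
  rfl

theorem polyTime_costShift :
    PolyTime fun C : {C // C ∈ 𝒞} => C.1.costShift (costs C) :=
  (polyTime_commonDen hcosts).mul
    (hcosts.map (f := fun _ q => q.num.natAbs) PolyTime.id.snd.natAbs_num).sum

theorem polyTime_scaledCost {C : Γ → {C // C ∈ 𝒞}} {θ : Γ → ℚ} (hC : PolyTime C)
    (hθ : PolyTime θ) : PolyTime fun x => (C x).1.scaledCost (costs (C x)) (θ x) :=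
  have h1 := (polyTime_costShift hcosts).comp hC
  have h2 := ((polyTime_commonDen hcosts).comp hC).scaleAbs hθ
  .ite (.rat_neg hθ) (h1.sub h2) (h1.add h2)

end Numbers

/-- Run a program on the output of a polynomial-time function. -/
theorem PolyTime.comp_prog {Δ β : Type*} [Enc Δ] [Enc β] {f : Γ → Δ} {g : Γ → β} {b : Γ → ℕ}
    (p : Prog) (hf : PolyTime f) (hb : PolyBdd b)
    (h : ∀ x, p.ComputesInTime (enc (f x)) (enc (g x)) (b x)) : PolyTime g := by
  obtain ⟨q, u, hu, hq⟩ := hf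
  refine of_le (.seq q p) ((PolyBdd.sz.add hu).add hb) fun x => ?_
  obtain ⟨t, ht, he⟩ := h x
  exact ⟨_, by simp only [sz]; omega, .seq (s₁ := []) (hq x) he⟩

theorem LabelIdx.polyTime_instance : PolyTime fun y : LabelIdx 𝒞 => y.1 :=
  LabelIdx.polyTime_data.fst

theorem CellIdx.polyTime_data : PolyTime fun z : CellIdx costs => z.1.1.data :=
  LabelIdx.polyTime_data.comp PolyTime.id.val.fst

theorem CellIdx.polyTime_query : PolyTime (CellIdx.query (costs := costs)) :=
  CellIdx.polyTime_data.fst.pair (CellIdx.polyTime_data.snd.snd.pair PolyTime.id.val.snd)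

/-- The scaling of the instances of a class by the common denominators of their numbers. -/
abbrev scalingOf (hmem : ∀ C : {C // C ∈ 𝒞}, ∀ θ, θ ∈ costs C ↔ θ ∈ C.1.possibleCosts)
    (C : {C // C ∈ 𝒞}) : Scaling C.1.toInstance :=
  C.1.toInstance.scaling (costs C) (hmem C)

section Solver

variable {hmem : ∀ C : {C // C ∈ 𝒞}, ∀ θ, θ ∈ costs C ↔ θ ∈ C.1.possibleCosts}

theorem polyTime_count (hcount : CanCountCostClasses 𝒞) :
    PolyTime fun z : CellIdx costs => (scalingOf hmem z.1.1.1).count z.1.1.2 z.1.2 := by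
  obtain ⟨p, P, h⟩ := hcount
  exact CellIdx.polyTime_query.comp_prog p
    (CellIdx.polyTime_query.fst.polyBdd_sz.eval P) fun z =>
      h z.1.1.1.1 z.1.1.1.2 z.1.1.2 z.1.2 ((hmem _ _).1 z.2)

variable (hcosts : PolyTime costs)
include hcosts

theorem polyTime_M : PolyTime fun C : {C // C ∈ 𝒞} => (scalingOf hmem C).M :=
  polyTime_commonDen hcosts

theorem polyTime_lam : PolyTime fun C : {C // C ∈ 𝒞} => (scalingOf hmem C).lam :=
  (polyTime_commonDen hcosts).scaleAbs EncodedInstance.polyTime_data.snd.snd.fst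

theorem polyTime_rho : PolyTime fun C : {C // C ∈ 𝒞} => (scalingOf hmem C).rho :=
  (polyTime_commonDen hcosts).scaleAbs EncodedInstance.polyTime_data.snd.snd.snd.fst

theorem polyTime_c : PolyTime fun C : {C // C ∈ 𝒞} => (scalingOf hmem C).c :=
  (polyTime_costShift hcosts).add
    ((polyTime_commonDen hcosts).scaleAbs EncodedInstance.polyTime_data.snd.fst)

theorem polyTime_cellCost : PolyTime fun z : CellIdx costs =>
    (scalingOf hmem z.1.1.1).cost z.1.2 :=
  polyTime_scaledCost hcosts CellIdx.polyTime_query.fst PolyTime.id.val.snd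

variable (hcount : PolyTime fun z : CellIdx costs => (scalingOf hmem z.1.1.1).count z.1.1.2 z.1.2)
include hcount

theorem polyTime_cellLo : PolyTime fun z : CellIdx costs =>
    (scalingOf hmem z.1.1.1).alpha z.1.1.2 * (scalingOf hmem z.1.1.1).count z.1.1.2 z.1.2 :=
  (((polyTime_commonDen hcosts).comp CellIdx.polyTime_data.fst).scaleAbs
    CellIdx.polyTime_data.snd.fst.fst).mul hcount

theorem polyTime_cellHi : PolyTime fun z : CellIdx costs =>
    (scalingOf hmem z.1.1.1).beta z.1.1.2 * (scalingOf hmem z.1.1.1).count z.1.1.2 z.1.2 :=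
  (((polyTime_commonDen hcosts).comp CellIdx.polyTime_data.fst).scaleAbs
    CellIdx.polyTime_data.snd.fst.snd).mul hcount

variable (hnodup : ∀ C, (costs C).Nodup)
include hnodup

theorem polyDec_usable : PolyDec fun y : LabelIdx 𝒞 => (scalingOf hmem y.1).Usable y.2 :=
  have hl : PolyTime fun y : LabelIdx 𝒞 => costs y.1 := hcosts.comp LabelIdx.polyTime_instance
  have hM := (polyTime_M (hmem := hmem) hcosts).comp LabelIdx.polyTime_instance
  .and (.le (.sum_toFinset hl (fun y => hnodup y.1) (polyTime_cellLo hcosts hcount)) hM)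
    (.le hM (.sum_toFinset hl (fun y => hnodup y.1) (polyTime_cellHi hcosts hcount)))

theorem polyTime_cellWeight : PolyTime fun z : CellIdx costs =>
    (scalingOf hmem z.1.1.1).cellWeight z.1.1.2 z.1.2 := by
  have hl : PolyTime fun z : CellIdx costs => costs z.1.1.1 :=
    hcosts.comp CellIdx.polyTime_query.fst
  have hw : PolyTime fun w : {w : CellIdx costs × ℚ // w.2 ∈ costs w.1.1.1.1} => w.1 :=
    PolyTime.id.val
  have hg : PolyTime fun w : {w : CellIdx costs × ℚ // w.2 ∈ costs w.1.1.1.1} =>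
      (⟨(w.1.1.1.1, w.1.2), w.2⟩ : CellIdx costs) :=
    (hw.fst.val.fst.pair hw.snd).subtype_mk fun w => w.2
  have hlo := polyTime_cellLo hcosts hcount
  have hhi := polyTime_cellHi hcosts hcount
  have hT := polyTime_cellCost (hmem := hmem) hcosts
  exact hlo.add (((((polyTime_M (hmem := hmem) hcosts).comp CellIdx.polyTime_query.fst).sub
    (.sum_toFinset hl (fun z => hnodup z.1.1.1) (hlo.comp hg))).sub
    (.sum_toFinset hl (fun z => hnodup z.1.1.1) (.ite (.lt (hT.comp hg) (hT.comp hw.fst))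
      ((hhi.comp hg).sub (hlo.comp hg)) (.const 0)))).min (hhi.sub hlo))

theorem polyTime_labelCost : PolyTime fun y : LabelIdx 𝒞 =>
    (scalingOf hmem y.1).labelCost y.2 :=
  .sum_toFinset (hcosts.comp LabelIdx.polyTime_instance) (fun y => hnodup y.1)
    ((polyTime_cellWeight hcosts hcount hnodup).mul (polyTime_cellCost hcosts))

theorem polyTime_labelKey : PolyTime fun y : LabelIdx 𝒞 => (scalingOf hmem y.1).labelKey y.2 := by
  refine (((polyTime_labelCost hcosts hcount hnodup).mul
    (EncodedInstance.polyTime_data.comp LabelIdx.polyTime_instance).snd.snd.snd.snd.length).add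
    LabelIdx.polyTime_data.snd.snd).congr fun y => ?_
  simp only [EncodedInstance.data, List.length_ofFn]
  rfl

theorem polyTime_labelLo : PolyTime fun y : LabelIdx 𝒞 => (scalingOf hmem y.1).labelLo y.2 :=
  open Classical in .ite (polyDec_usable hcosts hcount hnodup)
    ((polyTime_lam hcosts).comp LabelIdx.polyTime_instance) (.const 0)

theorem polyTime_labelHi : PolyTime fun y : LabelIdx 𝒞 => (scalingOf hmem y.1).labelHi y.2 :=
  open Classical in .ite (polyDec_usable hcosts hcount hnodup)
    ((polyTime_rho hcosts).comp LabelIdx.polyTime_instance) (.const 0)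

theorem polyTime_labelWeight : PolyTime fun y : LabelIdx 𝒞 =>
    (scalingOf hmem y.1).labelWeight y.2 := by
  have hlo := polyTime_labelLo hcosts hcount hnodup
  have hhi := polyTime_labelHi hcosts hcount hnodup
  have hkey := polyTime_labelKey hcosts hcount hnodup
  have h0 : PolyTime fun w : LabelIdx 𝒞 × LabelIdx 𝒞 => w := .id
  exact hlo.add (((((polyTime_M (hmem := hmem) hcosts).comp LabelIdx.polyTime_instance).sub
    (.sum_fin LabelIdx.polyTime_instance (hlo.comp h0.snd))).sub
    (.sum_fin LabelIdx.polyTime_instance (.ite (.lt (hkey.comp h0.snd) (hkey.comp h0.fst))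
      ((hhi.comp h0.snd).sub (hlo.comp h0.snd)) (.const 0)))).min (hhi.sub hlo))

theorem polyDec_accepts : PolyDec fun C : {C // C ∈ 𝒞} => (scalingOf hmem C).Accepts := by
  classical
  have h0 : PolyTime fun w : {C // C ∈ 𝒞} × LabelIdx 𝒞 => w.2 := PolyTime.id.snd
  have hM := polyTime_M (hmem := hmem) hcosts
  have hi := polyTime_lam (hmem := hmem) hcosts
  have h1 : PolyTime fun C : {C // C ∈ 𝒞} => ∑ i,
      if (scalingOf hmem C).Usable i then 0 else (scalingOf hmem C).lam :=
    .sum_fin .id (.ite ((polyDec_usable hcosts hcount hnodup).comp h0) (.const 0)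
      (hi.comp (LabelIdx.polyTime_instance.comp h0)))
  refine ((PolyDec.ne_zero h1).not.and ((PolyDec.le
    (PolyTime.sum_fin .id ((polyTime_labelLo (hmem := hmem) hcosts hcount hnodup).comp h0)) hM).and
    ((PolyDec.le hM
    (PolyTime.sum_fin .id ((polyTime_labelHi (hmem := hmem) hcosts hcount hnodup).comp h0))).and
    (PolyDec.le (PolyTime.sum_fin .id
      (((polyTime_labelWeight (hmem := hmem) hcosts hcount hnodup).comp h0).mul
      ((polyTime_labelCost (hmem := hmem) hcosts hcount hnodup).comp h0)))
      ((polyTime_c (hmem := hmem) hcosts).mul (hM.mul hM)))))).congr fun C => ?_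
  have h2 : (¬ ∑ i, (if (scalingOf hmem C).Usable i then 0 else (scalingOf hmem C).lam) ≠ 0) ↔
      ∀ i, (scalingOf hmem C).Usable i ∨ (scalingOf hmem C).lam = 0 := by
    rw [not_not, Finset.sum_eq_zero_iff]
    refine ⟨fun h i => ?_, fun h i _ => ?_⟩
    · have := h i (Finset.mem_univ _)
      by_cases hu : (scalingOf hmem C).Usable i
      · exact .inl hu
      · rw [if_neg hu] at this; exact .inr this
    · rcases h i with hu | h0
      · rw [if_pos hu]
      · rw [h0, ite_self]
  exact ⟨fun ⟨a, b, c, d⟩ => ⟨h2.1 a, b, c, d⟩, fun ⟨a, b, c, d⟩ => ⟨h2.2 a, b, c, d⟩⟩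

end Solver

section Improviser

variable (hmem : ∀ C : {C // C ∈ 𝒞}, ∀ θ, θ ∈ costs C ↔ θ ∈ C.1.possibleCosts)

/-- The value that presents a cost class to the sampling operation. -/
def query (C : EncodedInstance) (i : Fin C.numLabels) (θ : ℚ) : Value :=
  .cons C.code (.cons (encNat i.val) (encRat θ))

/-- The cost classes of all labels, presented by the inputs for the sampling operation, with their
greedy weights. -/
noncomputable def weightedQueries (C : {C // C ∈ 𝒞}) : List (ℕ × Value) :=
  (List.ofFn fun i => (costs C).map fun θ =>
    ((scalingOf hmem C).jointWeight i θ, query C.1 i θ)).flatten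

/-- The sum of a function over the weighted cost classes. -/
theorem sum_weightedQueries {M : Type*} [AddCommMonoid M] (hnodup : ∀ C, (costs C).Nodup)
    (C : {C // C ∈ 𝒞}) (F : ℕ × Value → M) :
    ((weightedQueries hmem C).map F).sum = ∑ i, ∑ θ ∈ (costs C).toFinset,
      F ((scalingOf hmem C).jointWeight i θ, query C.1 i θ) := by
  rw [weightedQueries, List.map_flatten, List.sum_flatten, List.map_ofFn, List.map_ofFn,
    List.sum_ofFn]
  refine Finset.sum_congr rfl fun i _ => ?_
  rw [List.sum_toFinset _ (hnodup C)]
  simp [Function.comp_def]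

/-- The initial state of the sampling loop. -/
noncomputable def initialState (C : {C // C ∈ 𝒞}) : LoopState :=
  (true, ((weightedQueries hmem C).map Prod.fst).sum, weightedQueries hmem C)

variable {hmem}

theorem sum_weights (hnodup : ∀ C, (costs C).Nodup) {C : {C // C ∈ 𝒞}}
    (h : (scalingOf hmem C).Accepts) : ((weightedQueries hmem C).map Prod.fst).sum =
      (scalingOf hmem C).M * (scalingOf hmem C).M := by
  rw [sum_weightedQueries hmem hnodup]
  change ∑ i, ∑ θ ∈ (scalingOf hmem C).costs, (scalingOf hmem C).jointWeight i θ = _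
  rw [Finset.sum_congr rfl fun i _ => (scalingOf hmem C).sum_jointWeight i, ← Finset.sum_mul,
    Scaling.sum_labelWeight _ h]

theorem polyTime_initialState (hcosts : PolyTime costs)
    (hcount : PolyTime fun z : CellIdx costs => (scalingOf hmem z.1.1.1).count z.1.1.2 z.1.2)
    (hnodup : ∀ C, (costs C).Nodup) : PolyTime (initialState hmem) := by
  have hjoint : PolyTime fun z : CellIdx costs =>
      (scalingOf hmem z.1.1.1).jointWeight z.1.1.2 z.1.2 :=
    ((polyTime_labelWeight hcosts hcount hnodup).comp PolyTime.id.val.fst).mul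
      (polyTime_cellWeight hcosts hcount hnodup)
  have hquery : PolyTime fun z : CellIdx costs => query z.1.1.1.1 z.1.1.2 z.1.2 :=
    CellIdx.polyTime_query.congr_enc fun _ => rfl
  have hrow : PolyTime fun y : LabelIdx 𝒞 => (costs y.1).map fun θ =>
      ((scalingOf hmem y.1).jointWeight y.2 θ, query y.1.1 y.2 θ) :=
    (hcosts.comp LabelIdx.polyTime_instance).map_mem (hjoint.pair hquery)
  have hw : PolyTime (weightedQueries hmem) :=
    (PolyTime.ofFn (Γ := {C // C ∈ 𝒞}) .id (hrow.comp PolyTime.id.snd)).flatten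
  exact (PolyTime.const true).pair ((hw.map (f := fun _ c => c.1) PolyTime.id.snd.fst).sum.pair hw)

end Improviser

/-- The text of the improviser, or the report that the instance is infeasible. -/
theorem polyTime_answer {A : Γ → Prop} [DecidablePred A] {x : Γ → LoopState} (hA : PolyDec A)
    (hx : PolyTime x) (q : Prog) : PolyTime fun C =>
      encAnswer (if A C then some (.seq (.const (enc (x C))) q) else none) := by
  have hcode : PolyTime fun C => (Prog.seq (.const (enc (x C))) q).code :=
    ((PolyTime.const 6).pair (((PolyTime.const 0).pair hx).pair (.const q.code))).congr_enc
      fun _ => rfl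
  have hsome : PolyTime fun C => encAnswer (some (.seq (.const (enc (x C))) q)) :=
    ((PolyTime.const Value.nil).pair hcode).congr_enc fun _ => rfl
  refine (PolyTime.ite hA hsome (.const (encAnswer none))).congr fun C => ?_
  split_ifs <;> rfl

end Algorithm

/-- An improvisation scheme from algorithms for the three operations. -/
theorem hasPolyTimeImprovisationScheme {𝒞 : Set EncodedInstance} (hcosts : CanListCosts 𝒞)
    (hcount : CanCountCostClasses 𝒞) (hsample : CanSampleCostClasses 𝒞) :
    HasPolyTimeImprovisationScheme 𝒞 := by
  classical
  obtain ⟨pc, Pc, hc⟩ := hcosts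
  obtain ⟨ps, Ps, hs⟩ := hsample
  have hc' : ∀ C : {C // C ∈ 𝒞}, ∃ l : List ℚ, l.Nodup ∧ (∀ θ, θ ∈ l ↔ θ ∈ C.1.possibleCosts) ∧
      pc.ComputesInTime C.1.code (encList (l.map encRat)) (Pc.eval C.1.size) := fun C => hc C.1 C.2
  choose costs hnodup hmem hcomp using hc'
  have hcosts : PolyTime costs := PolyTime.of_le pc (PolyBdd.sz.eval Pc) hcomp
  have hN : PolyTime fun z : CellIdx costs => (scalingOf hmem z.1.1.1).count z.1.1.2 z.1.2 :=
    polyTime_count hcount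
  obtain ⟨U, T, hT, hU⟩ := exists_sampler ps
  have hstate : PolyTime (initialState hmem) := polyTime_initialState hcosts hN hnodup
  have hacc := polyDec_accepts (hmem := hmem) hcosts hN hnodup
  obtain ⟨S, t, ⟨P, hP⟩, hS⟩ := polyTime_answer hacc hstate (.seq U ps)
  obtain ⟨Q, hQ⟩ := (hT.comp hstate.polyBdd_sz).add (PolyBdd.sz.eval Ps)
  refine ⟨S, P, Q, fun C hC => ?_⟩
  set Z := scalingOf hmem ⟨C, hC⟩ with hZ
  constructor
  · intro hinf
    have hA : ¬ (scalingOf hmem ⟨C, hC⟩).Accepts := fun h =>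
      hinf (let ⟨D, hD, _⟩ := Z.exists_improvisingDistribution h; ⟨D, hD⟩)
    have := hS ⟨C, hC⟩
    simp only [if_neg hA] at this
    exact ⟨_, hP ⟨C, hC⟩, this⟩
  · intro hfeas
    have hA : (scalingOf hmem ⟨C, hC⟩).Accepts := Z.accepts_of_feasible hfeas
    have hans := hS ⟨C, hC⟩
    simp only [if_pos hA] at hans
    refine ⟨_, ⟨_, hP ⟨C, hC⟩, hans⟩, ?_⟩
    -- Cost classes of positive weight are not empty.
    have hcell : ∀ i θ, 0 < Z.jointWeight i θ → (C.costClass i θ).Nonempty := by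
      intro i θ h0
      have h1 : 0 < Z.cellWeight i θ := Nat.pos_of_mul_pos_left h0
      have h2 : 0 < Z.count i θ := Nat.pos_of_mul_pos_left (h1.trans_le (Z.cellWeight_le i θ))
      exact Set.nonempty_of_ncard_ne_zero h2.ne'
    have hsum := sum_weights hnodup hA
    obtain ⟨htime, hprob⟩ := hU (weightedQueries hmem ⟨C, hC⟩) (initialState hmem ⟨C, hC⟩)
      (Ps.eval C.size) rfl (by
        change 0 < (List.map Prod.fst _).sum
        rw [hsum]; exact Nat.mul_pos Z.M_pos Z.M_pos) (by
        intro c hcm h0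
        simp only [weightedQueries, List.mem_flatten, List.mem_ofFn'] at hcm
        obtain ⟨l, ⟨i, rfl⟩, hcm⟩ := hcm
        obtain ⟨θ, hθ, rfl⟩ := List.mem_map.1 hcm
        exact (hs C hC i θ ((hmem ⟨C, hC⟩ θ).1 hθ) (hcell i θ h0)).1)
    have htime' := htime.trans (Nat.cast_le.2 (hQ ⟨C, hC⟩))
    obtain ⟨D, hD, hDw⟩ := Z.exists_improvisingDistribution hA
    refine ⟨⟨htime'.trans_lt (by simp), D, hD, fun w => ?_⟩, htime'⟩
    rw [hprob, hDw, sum_weightedQueries hmem hnodup]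
    have hterm : ∀ i, ∀ θ ∈ (costs ⟨C, hC⟩).toFinset,
        (Z.jointWeight i θ : ℝ≥0∞) * ps.outProb (query C i θ) (encWord w) =
          if w ∈ C.costClass i θ then (Z.jointWeight i θ : ℝ≥0∞) * (Z.count i θ : ℝ≥0∞)⁻¹ else 0 := by
      intro i θ hθ
      by_cases h0 : 0 < Z.jointWeight i θ
      · obtain ⟨-, E, hE, hsamp⟩ := hs C hC i θ ((hmem ⟨C, hC⟩ θ).1 (List.mem_toFinset.1 hθ))
          (hcell i θ h0)
        rw [query, hsamp w, hE w, mul_ite, mul_zero]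
        rfl
      · simp [Nat.eq_zero_of_not_pos h0]
    rw [Finset.sum_congr rfl fun i _ => Finset.sum_congr rfl fun θ hθ => hterm i θ hθ]
    by_cases hw : w ∈ C.impr
    · have hwI := C.mem_impr.1 hw
      have hK : C.K w ∈ (costs ⟨C, hC⟩).toFinset :=
        List.mem_toFinset.2 ((hmem ⟨C, hC⟩ _).2 ⟨w, hwI, rfl⟩)
      rw [if_pos hw, Finset.sum_eq_single (C.L w), Finset.sum_eq_single (C.K w)]
      · rw [if_pos ⟨hwI, rfl, rfl⟩]
        have hn : Z.count (C.L w) (C.K w) ≠ 0 := by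
          rw [← Z.card_cell]
          exact Finset.card_ne_zero.2 ⟨w, by simp [hw]⟩
        have hM := Z.M_pos'
        have hn' : (0 : ℝ) < Z.count (C.L w) (C.K w) := by exact_mod_cast Nat.pos_of_ne_zero hn
        change (((List.map Prod.fst (weightedQueries hmem ⟨C, hC⟩)).sum : ℕ) : ℝ≥0∞)⁻¹ * _ = _
        rw [hsum, Scaling.wordWeight, ENNReal.ofReal_div_of_pos hn',
          ENNReal.ofReal_div_of_pos (by positivity), ← Nat.cast_mul]
        simp only [ENNReal.ofReal_natCast, div_eq_mul_inv]
        ring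
      · exact fun θ _ hne => if_neg fun h => hne h.2.2.symm
      · exact fun h => absurd hK h
      · exact fun i _ hne => Finset.sum_eq_zero fun θ _ => if_neg fun h => hne h.2.1.symm
      · simp
    · rw [if_neg hw, Finset.sum_eq_zero fun i _ => Finset.sum_eq_zero fun θ _ =>
        if_neg fun h => hw (C.mem_impr.2 h.1), mul_zero]

end LQCI

theorem theorem2 (𝒞 : Set LQCI.EncodedInstance)
    (hcosts : LQCI.CanListCosts 𝒞)
    (hcount : LQCI.CanCountCostClasses 𝒞)
    (hsample : LQCI.CanSampleCostClasses 𝒞) :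
    LQCI.HasPolyTimeImprovisationScheme 𝒞 :=
  LQCI.hasPolyTimeImprovisationScheme hcosts hcount hsample
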